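/- **Setting.** Let $F$ be a nonarchimedean local field of characteristic $\neq 2$ with ring of integers $\mathcal O$, uniformizer $\varpi$ and normalised absolute value $|\cdot|$, let $\psi:F\to S^1$ be a continuous additive character of conductor $\mathcal O$, and let $dx$ be the Haar measure on $F$ self-dual for $\psi(xy)$ (so $\mathcal O$ has volume $1$). Let $(V,q)$ be a nondegenerate quadratic space over $F$ of even dimension $\dim V\ge 3$ and (signed) discriminant $1\in F^\times/F^{\times2}$, put $\langle x,y\rangle=q(x+y)-q(x)-q(y)$, and give $V$ the Haar measure self-dual for $\psi(\langle x,y\rangle)$. Fix $v_1\in V$ with $q(v_1)=1$, let $X_a=\{v\in V: q(v)=a\}$, and let $\mathrm O(v_1^\perp)$ be the stabiliser of $v_1$ in $\mathrm O(V)$. $S(\cdot)$ denotes the locally constant compactly supported complex functions. Write $n(b)=\begin{pmatrix}1&b\\0&1\end{pmatrix}$, $t(a)=\begin{pmatrix}a&0\\0&a^{-1}\end{pmatrix}$, $w=\begin{pmatrix}0&1\\-1&0\end{pmatrix}$. Let $\mathrm{SL}_2(F)$ act on $S(V)$ by the Weil representation: $(n(b)\Phi)(v)=\psi(b\,q(v))\Phi(v)$,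 $(t(a)\Phi)(v)=|a|^{\dim V/2}\chi_{\mathrm{disc}\,V}(a)\Phi(av)$, where $\chi_{\mathrm{disc}\,V}$ is the quadratic character of $F^\times$ attached to the discriminant (trivial here), and $(w\Phi)(v)=\gamma_{\psi,q}\int_V\Phi(y)\psi(\langle v,y\rangle)\,dy$, where $\gamma_{\psi,q}$ is the Weil index, i.e. the stable value of $\int_L\psi(q(x))\,dx$ over large compact open subgroups $L\subset V$. For $\Phi\in S(V)$ let $p(\Phi)(g)=(g\cdot\Phi)(v_1)$, let $\mathcal S(N,\psi\backslash \mathrm{SL}_2)=p(S(V))$, and let $$\mathcal I(N,\psi\backslash \mathrm{SL}_2)=\mathcal S(N,\psi\backslash \mathrm{SL}_2)_{N,\psi},\qquad \mathcal I(X_1)=S(X_1)_{\mathrm O(v_1^\perp)}$$ be the coinvariants ($N$ acting by right translation). **Statement.** (1) There is a unique linear map $t_\psi:\mathcal I(X_1)\to\mathcal I(N,\psi\backslash\mathrm{SL}_2)$, the transfer map, which for every $\Phi\in S(V)$ sends the class of $\Phi|_{X_1}$ to the class of $p(\Phi)$. (2) There are measures $|\omega_a|$ on $X_a$ ($a\in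 F^\times$), finite on compact sets, such that for every $f\in S(V)$ vanishing on $X_0$ the function $a\mapsto\int_{X_a}f\,|\omega_a|$ is locally constant and compactly supported on $F^\times$ and $\int_V f(v)\,dv=\int_{F^\times}\int_{X_a}f\,|\omega_a|\,da$. Likewise, with $F^\heartsuit=F\setminus\{\pm2\}$, there are measures $|\nu_\xi|$ ($\xi\in F^\heartsuit$), finite on compact sets, on the fibres of $x\mapsto\langle v_1,x\rangle$, $X_1\to F$, such that for every $f\in S(X_1)$ supported over $F^\heartsuit$ the fibre integral of $f$ is locally constant and compactly supported on $F^\heartsuit$ and $\int_{X_1}f\,|\omega_1|=\int_{F^\heartsuit}\int_{\langle v_1,x\rangle=\xi}f(x)\,|\nu_\xi(x)|\,d\xi$. (3) For any such measures, the elements of the two spaces of orbital integrals are regarded as functions as follows. There is a linear map from $\mathcal I(X_1)$ to the locally constant functions on $F^\heartsuit$ which sends the class of $\varphi\in S(X_1)$ to $\xi\mapsto\int_{\langle v_1,x\rangle=\xi}\varphi(x)\,|\nu_\xi(x)|$. There is a linear map from $\mathcal I(N,\psi\backslash\mathrm{SL}_2)$ to the locally constant functions on $F^\times$ which sends the class of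 $f$ to the function of $a$ given by the stable value, for $n$ large, of $\int_{\varpi^{-n}\mathcal O}f(wt(a)n(b))\,\overline{\psi(b)}\,db$ (in particular this sequence stabilizes for every $a$). In these terms $t_\psi$ is the integral transform $$t_\psi(\phi)(a)=\gamma_{\psi,q}\,|a|^{-\frac12\dim V}\int_{F^\heartsuit}\phi(\xi)\,\psi(a^{-1}\xi)\,d\xi\qquad(\phi\in\mathcal I(X_1),\ a\in F^\times),$$ the integral being absolutely convergent. -/

import Mathlib

open MeasureTheory Filter Topology
open scoped MatrixGroups

noncomputable section

namespace ThetaTransfer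

/-! ### Schwartz-Bruhat functions and measures -/

/-- The Schwartz-Bruhat space `S(X)` of a totally disconnected locally compact space `X`:
locally constant, compactly supported functions `X → ℂ`. -/
def SchwartzBruhat (X : Type*) [TopologicalSpace X] : Submodule ℂ (X → ℂ) where
  carrier := {f | IsLocallyConstant f ∧ HasCompactSupport f}
  zero_mem' := ⟨IsLocallyConstant.const 0, HasCompactSupport.zero⟩
  add_mem' hf hg := ⟨hf.1.add hg.1, hf.2.add hg.2⟩
  smul_mem' c _ hf := ⟨hf.1.comp (fun z => c • z), hf.2.smul_left (f := fun _ => c)⟩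

/-- The Fourier transform of `f : V → ℂ` for the pairing `ψ(B(x, y))` and the measure `μ`. -/
def fourier {F V : Type*} [Field F] [MeasurableSpace V] (ψ : AddChar F Circle) (B : V → V → F)
    (μ : Measure V) (f : V → ℂ) (x : V) : ℂ :=
  ∫ y, f y * (ψ (B x y) : ℂ) ∂μ

/-- `μ` is self-dual for the pairing `ψ(B(x, y))`: Fourier inversion holds on `S(V)`. -/
def IsSelfDual {F V : Type*} [Field F] [AddCommGroup V] [TopologicalSpace V] [MeasurableSpace V]
    (ψ : AddChar F Circle) (B : V → V → F) (μ : Measure V) : Prop :=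
  ∀ f ∈ SchwartzBruhat V, ∀ x, fourier ψ B μ (fourier ψ B μ f) x = f (-x)

/-- Let `π : X → Y` be submersive over the open set `Y₀ ⊆ Y`.  The measures `μ` on `X` and `lam` on
`Y` induce measures `ν y` on the fibres of `π` over `Y₀`, characterised as follows: for every
`f ∈ S(X)` supported in `π⁻¹(Y₀)` the integral of `f` along the fibres is locally constant and
compactly supported, and integrating it against `lam` gives `∫ f dμ`.  (For such `f` the integral
along a fibre outside `Y₀` is `0`; the `ν y` with `y ∉ Y₀` play no role.) -/
structure IsFiberMeasure {X Y : Type*} [TopologicalSpace X] [MeasurableSpace X]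
    [TopologicalSpace Y] [MeasurableSpace Y] (μ : Measure X) (lam : Measure Y) (π : X → Y)
    (Y₀ : Set Y) (ν : (y : Y) → Measure {x : X // π x = y}) : Prop where
  finite_on_compacts : ∀ y ∈ Y₀, IsFiniteMeasureOnCompacts (ν y)
  fiber_integral_mem : ∀ f ∈ SchwartzBruhat X, (∀ x, f x ≠ 0 → π x ∈ Y₀) →
    (fun y => ∫ x : {x : X // π x = y}, f x ∂(ν y)) ∈ SchwartzBruhat Y
  integral_eq : ∀ f ∈ SchwartzBruhat X, (∀ x, f x ≠ 0 → π x ∈ Y₀) →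
    ∫ x, f x ∂μ = ∫ y, (∫ x : {x : X // π x = y}, f x ∂(ν y)) ∂lam

/-! ### The field

A nonarchimedean local field is a nontrivially normed field `F` that is ultrametric and locally
compact.  Its norm need not be the normalised one, so the normalised absolute value is defined
separately. -/

section Field

variable {F : Type*} [NontriviallyNormedField F]

/-- The normalised absolute value `|a|` of `F`: the factor by which multiplication by `a` scales
additive Haar measure. -/
def absF [LocallyCompactSpace F] (a : F) : ℝ := by
  classical
  exact if h : a = 0 then 0 else (distribHaarChar F (Units.mk0 a h) : ℝ)

/-- The conductor of `ψ` is the ring of integers `{x | ‖x‖ ≤ 1}`: this is the largest fractional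
ideal on which `ψ` is trivial. -/
def HasConductorIntegers (ψ : AddChar F Circle) : Prop :=
  ∀ x : F, (∀ y : F, ‖y‖ ≤ 1 → ψ (x * y) = 1) ↔ ‖x‖ ≤ 1

/-- `ϖ` generates the maximal ideal `{x | ‖x‖ < 1}` of the ring of integers. -/
def IsUniformizer (ϖ : F) : Prop :=
  ‖ϖ‖ < 1 ∧ ∀ x : F, ‖x‖ < 1 → ‖x‖ ≤ ‖ϖ‖

/-- The fractional ideal `U_n = ϖ⁻ⁿ 𝒪`. -/
def idealU (ϖ : F) (n : ℕ) : Set F := {b | ‖ϖ ^ n * b‖ ≤ 1}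

/-- The quadratic character `χ_d` of `Fˣ` attached to `d ∈ Fˣ / Fˣ²`, i.e. the Hilbert symbol
`(a, d)`: it is `1` exactly if `a` is a value of the form `x² - d y²`. -/
def quadChar (d a : F) : ℂ := by
  classical
  exact if ∃ x y : F, a = x ^ 2 - d * y ^ 2 then 1 else -1

/-- `n(b)` is the upper triangular unipotent matrix with entry `b`. -/
def nMat (b : F) : SL(2, F) := ⟨!![1, b; 0, 1], by simp⟩

/-- `t(a) = diag(a, a⁻¹)`. -/
def tMat (a : Fˣ) : SL(2, F) := ⟨!![(a : F), 0; 0, ((a⁻¹ : Fˣ) : F)], by simp⟩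

/-- The Weyl element `w`. -/
def wMat (F : Type*) [NontriviallyNormedField F] : SL(2, F) := ⟨!![0, 1; -1, 0], by simp⟩

/-- The set `F ∖ {2, -2}`. -/
abbrev Heart (F : Type*) [NontriviallyNormedField F] : Type _ := {ξ : F // ξ ≠ 2 ∧ ξ ≠ -2}

end Field

/-! ### The Weil representation of `SL₂(F)` on `S(V)`, for `dim V` even -/

section Weil

variable {F : Type*} [NontriviallyNormedField F]
variable {V : Type*} [AddCommGroup V] [Module F V]

/-- The discriminant `(-1)^(m(m-1)/2) det(⟨e_i, e_j⟩)`, `m = dim V`, where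
`⟨x, y⟩ = Q(x + y) - Q(x) - Q(y)`; its square class does not depend on the basis. -/
def disc [FiniteDimensional F V] (Q : QuadraticForm F V) : F :=
  (-1) ^ (Module.finrank F V * (Module.finrank F V - 1) / 2) *
    (Matrix.of fun i j => QuadraticMap.polar Q (Module.finBasis F V i)
      (Module.finBasis F V j)).det

/-- The Weil index `γ_{ψ,Q}`: the stable value of `∫_L ψ(Q(x)) dx` as `L` runs through the compact
open subgroups of `V`, directed by inclusion. -/
def weilIndex [TopologicalSpace V] [MeasurableSpace V] (ψ : AddChar F Circle)
    (Q : QuadraticForm F V) (μ : Measure V) : ℂ :=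
  limUnder atTop fun L : {L : AddSubgroup V // IsOpen (L : Set V) ∧ IsCompact (L : Set V)} =>
    ∫ x in (L.1 : Set V), (ψ (Q x) : ℂ) ∂μ

/-- The action of `n(b)`: multiplication by `ψ(b Q(v))`. -/
def weilN (ψ : AddChar F Circle) (Q : QuadraticForm F V) (b : F) (Φ : V → ℂ) (v : V) : ℂ :=
  (ψ (b * Q v) : ℂ) * Φ v

/-- The action of `t(a)`: `(t(a) Φ)(v) = |a|^(dim V / 2) χ_{disc V}(a) Φ(a v)`. -/
def weilT [LocallyCompactSpace F] [FiniteDimensional F V] (Q : QuadraticForm F V) (a : F)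
    (Φ : V → ℂ) (v : V) : ℂ :=
  ((absF a ^ ((Module.finrank F V : ℝ) / 2) : ℝ) : ℂ) * quadChar (disc Q) a * Φ (a • v)

/-- The action of `w`: the Fourier transform normalised by the Weil index. -/
def weilW [TopologicalSpace V] [MeasurableSpace V] (ψ : AddChar F Circle)
    (Q : QuadraticForm F V) (μ : Measure V) (Φ : V → ℂ) (v : V) : ℂ :=
  weilIndex ψ Q μ * fourier ψ (QuadraticMap.polar Q) μ Φ v

/-- The action of `g = (a b; c d) ∈ SL₂(F)` in the Weil representation, through the Bruhat
decomposition: `g = t(a) n(b/a)` if `c = 0`, and `g = n(a/c) w t(-c) n(d/c)` if `c ≠ 0`. -/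
def weil [LocallyCompactSpace F] [FiniteDimensional F V] [TopologicalSpace V] [MeasurableSpace V]
    (ψ : AddChar F Circle) (Q : QuadraticForm F V) (μ : Measure V) (g : SL(2, F)) (Φ : V → ℂ) :
    V → ℂ := by
  classical
  exact
    if g 1 0 = 0 then weilT Q (g 0 0) (weilN ψ Q (g 0 1 / g 0 0) Φ)
    else weilN ψ Q (g 0 0 / g 1 0) (weilW ψ Q μ (weilT Q (-(g 1 0))
      (weilN ψ Q (g 1 1 / g 1 0) Φ)))

end Weil

/-! ### Test functions, orbital integrals and transfer -/

section Transfer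

variable {F : Type*} [NontriviallyNormedField F]
variable {V : Type*} [AddCommGroup V] [Module F V] [TopologicalSpace V]

/-- The hyperboloid `X_a = {v | Q(v) = a}`. -/
abbrev Hyperboloid (Q : QuadraticForm F V) (a : F) : Type _ := {v : V // Q v = a}

/-- The action of `O(V)` on `X_a`. -/
def act (Q : QuadraticForm F V) {a : F} (h : Q.IsometryEquiv Q) (x : Hyperboloid Q a) :
    Hyperboloid Q a :=
  ⟨h x.1, (h.map_app x.1).trans x.2⟩

/-- The span of all `h · φ - φ` with `φ ∈ S(X₁)` and `h ∈ O(v₁^⊥)`, where `O(v₁^⊥)` is the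
stabiliser of `v₁` in `O(V)` and `(h · φ)(x) = φ(h⁻¹ x)`. -/
def relX (Q : QuadraticForm F V) (v₁ : V) : Submodule ℂ (SchwartzBruhat (Hyperboloid Q 1)) :=
  Submodule.span ℂ {η | ∃ h : Q.IsometryEquiv Q, h v₁ = v₁ ∧
    ∃ φ : SchwartzBruhat (Hyperboloid Q 1), ∀ x, η.1 x = φ.1 (act Q h.symm x) - φ.1 x}

/-- The space `I(X₁) = S(X₁)_{O(v₁^⊥)}` of coinvariants. -/
abbrev OrbitalX (Q : QuadraticForm F V) (v₁ : V) : Type _ :=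
  SchwartzBruhat (Hyperboloid Q 1) ⧸ relX Q v₁

variable [LocallyCompactSpace F] [FiniteDimensional F V] [MeasurableSpace V]

/-- `p(Φ)(g) = (g · Φ)(v₁)`. -/
def pMap (ψ : AddChar F Circle) (Q : QuadraticForm F V) (μ : Measure V) (v₁ : V) (Φ : V → ℂ)
    (g : SL(2, F)) : ℂ :=
  weil ψ Q μ g Φ v₁

/-- The space `S(N, ψ \ SL₂)`, spanned by the functions `p(Φ)` for `Φ ∈ S(V)`.  As `p` is linear on
`S(V)`, it is simply the image of `p`; see `mem_whittakerSpace_iff`. -/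
def whittakerSpace (ψ : AddChar F Circle) (Q : QuadraticForm F V) (μ : Measure V) (v₁ : V) :
    Submodule ℂ (SL(2, F) → ℂ) :=
  Submodule.span ℂ (pMap ψ Q μ v₁ '' (SchwartzBruhat V : Set (V → ℂ)))

/-- The span of all `n(b) · f - ψ(b) f` with `f ∈ S(N, ψ \ SL₂)` and `b ∈ F`, for the action of
`SL₂(F)` by right translation. -/
def relN (ψ : AddChar F Circle) (Q : QuadraticForm F V) (μ : Measure V) (v₁ : V) :
    Submodule ℂ (whittakerSpace ψ Q μ v₁) :=
  Submodule.span ℂ {η | ∃ b : F, ∃ f : whittakerSpace ψ Q μ v₁,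
    ∀ g, η.1 g = f.1 (g * nMat b) - (ψ b : ℂ) * f.1 g}

/-- The space `I(N, ψ \ SL₂) = S(N, ψ \ SL₂)_{N, ψ}` of coinvariants. -/
abbrev OrbitalN (ψ : AddChar F Circle) (Q : QuadraticForm F V) (μ : Measure V) (v₁ : V) : Type _ :=
  whittakerSpace ψ Q μ v₁ ⧸ relN ψ Q μ v₁

/-- `f ∈ S(N, ψ \ SL₂)` and `φ ∈ S(X₁)` are transfers of each other: there is `Φ ∈ S(V)` with
`p(Φ) = f` whose restriction to `X₁` is `φ`. -/
def AreTransfers (ψ : AddChar F Circle) (Q : QuadraticForm F V) (μ : Measure V) (v₁ : V)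
    (f : whittakerSpace ψ Q μ v₁) (φ : SchwartzBruhat (Hyperboloid Q 1)) : Prop :=
  ∃ Φ ∈ SchwartzBruhat V, pMap ψ Q μ v₁ Φ = f.1 ∧ ∀ x : Hyperboloid Q 1, Φ x.1 = φ.1 x

/-- `t : I(X₁) → I(N, ψ \ SL₂)` is the transfer map `t_ψ`: the linear map induced by the
transfer correspondence. -/
def IsTransferMap (ψ : AddChar F Circle) (Q : QuadraticForm F V) (μ : Measure V) (v₁ : V)
    (t : OrbitalX Q v₁ →ₗ[ℂ] OrbitalN ψ Q μ v₁) : Prop :=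
  ∀ f φ, AreTransfers ψ Q μ v₁ f φ → t ((relX Q v₁).mkQ φ) = (relN ψ Q μ v₁).mkQ f

/-- `J` is the incarnation of `I(X₁)` as functions on `F ∖ {2, -2}`: the class of `φ` is sent to
its integrals over the fibres of `x ↦ ⟨v₁, x⟩` with respect to the measures `ν ξ`. -/
def IsIncarnationX (Q : QuadraticForm F V) (v₁ : V)
    (ν : (ξ : F) → Measure {x : Hyperboloid Q 1 // QuadraticMap.polar Q v₁ x.1 = ξ})
    (J : OrbitalX Q v₁ →ₗ[ℂ] (Heart F → ℂ)) : Prop :=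
  ∀ (φ : SchwartzBruhat (Hyperboloid Q 1)) (ξ : Heart F),
    J ((relX Q v₁).mkQ φ) ξ =
      ∫ x : {x : Hyperboloid Q 1 // QuadraticMap.polar Q v₁ x.1 = ξ.1}, φ.1 x.1 ∂(ν ξ.1)

/-- `J` is the incarnation of `I(N, ψ \ SL₂)` as functions on `Fˣ`: the class of `f` is sent to its
`(N, ψ)`-orbital integrals over the open cell, namely the function whose value at `a` is the stable
value of the integral of `f(w t(a) n(b)) ψ(-b)` over `b ∈ ϖ⁻ⁿ 𝒪` for large `n`. -/
def IsIncarnationN [MeasurableSpace F] (ψ : AddChar F Circle) (μF : Measure F)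
    (Q : QuadraticForm F V) (μ : Measure V) (v₁ : V) (ϖ : F)
    (J : OrbitalN ψ Q μ v₁ →ₗ[ℂ] (Fˣ → ℂ)) : Prop :=
  ∀ (f : whittakerSpace ψ Q μ v₁) (a : Fˣ), ∀ᶠ n : ℕ in atTop,
    ∫ b in idealU ϖ n, f.1 (wMat F * tMat a * nMat b) * (starRingEnd ℂ) (ψ b : ℂ) ∂μF =
      J ((relN ψ Q μ v₁).mkQ f) a

end Transfer

/-! ### The space `S(N, ψ \ SL₂)` is the image of `p` -/

section Image

variable {F : Type*} [NontriviallyNormedField F] [LocallyCompactSpace F]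
variable {V : Type*} [AddCommGroup V] [Module F V] [FiniteDimensional F V] [TopologicalSpace V]
  [IsTopologicalAddGroup V] [ContinuousSMul F V] [T2Space V] [MeasurableSpace V] [BorelSpace V]

theorem continuous_polar (Q : QuadraticForm F V) (v : V) :
    Continuous fun y => QuadraticMap.polar Q v y := by
  have : ProperSpace F := ProperSpace.of_locallyCompactSpace F
  exact (Q.polarBilin v).continuous_of_finiteDimensional

theorem continuous_quadraticForm (h2 : (2 : F) ≠ 0) (Q : QuadraticForm F V) :
    Continuous Q := by
  have : ProperSpace F := ProperSpace.of_locallyCompactSpace F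
  have key : ∀ x, Q x = 2⁻¹ * ∑ i, (Module.finBasis F V).coord i x *
      QuadraticMap.polar Q (Module.finBasis F V i) x := by
    intro x
    have h1 : QuadraticMap.polar Q x x = 2 * Q x := by
      rw [QuadraticMap.polar_self]; simp
    have h3 : QuadraticMap.polar Q x x = ∑ i, (Module.finBasis F V).coord i x *
        QuadraticMap.polar Q (Module.finBasis F V i) x := by
      have : Q.polarBilin x x = Q.polarBilin (∑ i, (Module.finBasis F V).repr x i •
          Module.finBasis F V i) x := by
        rw [(Module.finBasis F V).sum_repr]
      simp only [map_sum, LinearMap.sum_apply, map_smul, LinearMap.smul_apply, smul_eq_mul] at this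
      exact this
    rw [← h3, h1, inv_mul_cancel_left₀ h2]
  have : (Q : V → F) = fun x => 2⁻¹ * ∑ i, (Module.finBasis F V).coord i x *
      QuadraticMap.polar Q (Module.finBasis F V i) x := funext key
  rw [this]
  refine continuous_const.mul (continuous_finsetSum _ fun i _ => ?_)
  exact ((Module.finBasis F V).coord i).continuous_of_finiteDimensional.mul
    (continuous_polar Q _)

theorem integrable_weil (h2 : (2 : F) ≠ 0) {ψ : AddChar F Circle} (hψ : Continuous ψ)
    (Q : QuadraticForm F V) (μ : Measure V) [IsFiniteMeasureOnCompacts μ] {Φ : V → ℂ}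
    (hΦ : Φ ∈ SchwartzBruhat V) {c : F} (hc : c ≠ 0) (d : F) (v : V) :
    Integrable (fun y => weilT Q c (weilN ψ Q d Φ) y * (ψ (QuadraticMap.polar Q v y) : ℂ)) μ := by
  have hQ := continuous_quadraticForm h2 Q
  have hB := continuous_polar Q v
  have hcont : Continuous fun y : V => c • y := continuous_const_smul c
  have hΦc : Continuous Φ := hΦ.1.continuous
  refine Continuous.integrable_of_hasCompactSupport ?_ ?_
  · unfold weilT weilN
    have e1 : Continuous fun y => ((ψ (QuadraticMap.polar Q v y) : Circle) : ℂ) :=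
      continuous_subtype_val.comp (hψ.comp hB)
    have e2 : Continuous fun y => ((ψ (d * Q (c • y)) : Circle) : ℂ) :=
      continuous_subtype_val.comp (hψ.comp (continuous_const.mul (hQ.comp hcont)))
    exact (continuous_const.mul (e2.mul (hΦc.comp hcont))).mul e1
  · have h : HasCompactSupport fun y => Φ (c • y) :=
      hΦ.2.comp_homeomorph (Homeomorph.smulOfNeZero c hc)
    unfold weilT weilN
    exact ((h.mul_left (f := fun y => ((ψ (d * Q (c • y)) : Circle) : ℂ))).mul_left
      (f := fun _ => _)).mul_right

theorem weil_add (h2 : (2 : F) ≠ 0) {ψ : AddChar F Circle} (hψ : Continuous ψ)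
    (Q : QuadraticForm F V) (μ : Measure V) [IsFiniteMeasureOnCompacts μ] {Φ Φ' : V → ℂ}
    (hΦ : Φ ∈ SchwartzBruhat V) (hΦ' : Φ' ∈ SchwartzBruhat V) (g : SL(2, F)) (v : V) :
    weil ψ Q μ g (Φ + Φ') v = weil ψ Q μ g Φ v + weil ψ Q μ g Φ' v := by
  unfold weil
  split_ifs with h
  · simp only [weilT, weilN, Pi.add_apply]; ring
  · have hc : -(g 1 0) ≠ 0 := neg_ne_zero.mpr h
    have key := integral_add (integrable_weil h2 hψ Q μ hΦ hc (g 1 1 / g 1 0) v)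
      (integrable_weil h2 hψ Q μ hΦ' hc (g 1 1 / g 1 0) v)
    have e : weilT Q (-(g 1 0)) (weilN ψ Q (g 1 1 / g 1 0) (Φ + Φ')) =
        weilT Q (-(g 1 0)) (weilN ψ Q (g 1 1 / g 1 0) Φ) +
          weilT Q (-(g 1 0)) (weilN ψ Q (g 1 1 / g 1 0) Φ') := by
      funext y; simp only [weilT, weilN, Pi.add_apply]; ring
    rw [e]
    generalize weilT Q (-(g 1 0)) (weilN ψ Q (g 1 1 / g 1 0) Φ) = A at key ⊢
    generalize weilT Q (-(g 1 0)) (weilN ψ Q (g 1 1 / g 1 0) Φ') = A' at key ⊢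
    unfold weilN weilW fourier
    simp only [Pi.add_apply, add_mul]
    rw [key]; ring

theorem weil_smul (ψ : AddChar F Circle) (Q : QuadraticForm F V) (μ : Measure V) (z : ℂ)
    (Φ : V → ℂ) (g : SL(2, F)) (v : V) :
    weil ψ Q μ g (z • Φ) v = z * weil ψ Q μ g Φ v := by
  unfold weil
  split_ifs with h
  · simp only [weilT, weilN, Pi.smul_apply, smul_eq_mul]; ring
  · have e : weilT Q (-(g 1 0)) (weilN ψ Q (g 1 1 / g 1 0) (z • Φ)) =
        fun y => z * weilT Q (-(g 1 0)) (weilN ψ Q (g 1 1 / g 1 0) Φ) y := by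
      funext y; simp only [weilT, weilN, Pi.smul_apply, smul_eq_mul]; ring
    rw [e]
    generalize weilT Q (-(g 1 0)) (weilN ψ Q (g 1 1 / g 1 0) Φ) = A
    unfold weilN weilW fourier
    simp only [mul_assoc]
    rw [integral_const_mul]; ring

/-- `S(N, ψ \ SL₂)` is the image of `p : S(V) → C^∞(N, ψ \ SL₂)`. -/
theorem mem_whittakerSpace_iff (h2 : (2 : F) ≠ 0) {ψ : AddChar F Circle} (hψ : Continuous ψ)
    (Q : QuadraticForm F V) (μ : Measure V) [IsFiniteMeasureOnCompacts μ] (v₁ : V)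
    (f : SL(2, F) → ℂ) :
    f ∈ whittakerSpace ψ Q μ v₁ ↔ ∃ Φ ∈ SchwartzBruhat V, pMap ψ Q μ v₁ Φ = f := by
  constructor
  · intro hf
    induction hf using Submodule.span_induction with
    | mem f hf => exact hf
    | zero =>
      refine ⟨0, zero_mem _, funext fun g => ?_⟩
      have := weil_smul ψ Q μ 0 0 g v₁
      simpa [pMap] using this
    | add f g _ _ hf hg =>
      obtain ⟨Φ, hΦ, rfl⟩ := hf
      obtain ⟨Φ', hΦ', rfl⟩ := hg
      exact ⟨Φ + Φ', add_mem hΦ hΦ', funext fun g => weil_add h2 hψ Q μ hΦ hΦ' g v₁⟩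
    | smul z f _ hf =>
      obtain ⟨Φ, hΦ, rfl⟩ := hf
      exact ⟨z • Φ, Submodule.smul_mem _ z hΦ, funext fun g => weil_smul ψ Q μ z Φ g v₁⟩
  · rintro ⟨Φ, hΦ, rfl⟩
    exact Submodule.subset_span ⟨Φ, hΦ, rfl⟩

end Image

end ThetaTransfer

end

set_option linter.unusedSectionVars false

/-! For `Φ ∈ S(V)` the Bruhat formula and the substitution `v ↦ a v` give `p(Φ)(w t(a) n(b)) = γ
|a|^(-dim V / 2) ∫ Φ(v) ψ(a⁻¹⟨v₁, v⟩) ψ(b Q(v)) dv` (`pMap_wMat_tMat_nMat`). Integrating over `b ∈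
ϖ⁻ⁿ 𝒪` against `ψ(-b)` averages over `Q(v) ∈ 1 + ϖⁿ 𝒪`, so for large `n` it produces `∫ Φ(x)
ψ(a⁻¹⟨v₁, x⟩)` over `X₁` (`eventually_integral_idealU_eq`). Integrating first along the fibres `⟨v₁,
x⟩ = ξ` turns this into the Fourier integral of the orbital integrals of `Φ|_{X₁}`
(`integral_hyperboloid_twist_eq`).

The transfer map exists because the class of `p(Φ)` depends only on the class of `Φ|_{X₁}`. If `Φ`
vanishes on `X₁`, its support is covered by finitely many compact open sets such that on functions
supported in one of them some `n(b)` acts by a scalar other than `ψ(b)`; such functions die in the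
`(N, ψ)`-coinvariants (`pClass_eq_zero_of_vanish`). Isometries preserve the self-dual measure, hence
commute with the action of `SL₂`, and those fixing `v₁` leave `p(Φ)` unchanged (`integral_isometry`,
`weil_comp_isometry`).

Both families of fibre measures come from one principle: if `∫_K ψ(b π(x)) dμ` vanishes for all
large `b`, the push-forward of `μ|_K` has a locally constant density (`eventually_real_inter_eq`),
and these densities define a content on each fibre (`exists_fiber_measure`). The vanishing is
nonarchimedean stationary phase (`exists_setIntegral_phase_eq_zero`): the phase `b Q(v) + c⟨v₁, v⟩`
is critical only where `b v + c v₁ = 0`, that is at `0` if `c = 0`, and on `X₁` at most at `±v₁`,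
which lie over `±2`. The fibres over `±2` are null (`measure_inter_fiber_eq_zero`): away from `±v₁`
a finite density is still available, and small balls around `±v₁` have small mass. So these fibres
may be left out of the final integral. -/

namespace ThetaTransfer

/-! ### Schwartz-Bruhat functions on spaces with a basis of compact open sets -/

section CompactOpen

/-- The compact open subsets form a basis of the topology. -/
def HasCompactOpenBasis (X : Type*) [TopologicalSpace X] : Prop :=
  ∀ (x : X) (U : Set X), IsOpen U → x ∈ U → ∃ K : Set X, IsCompact K ∧ IsOpen K ∧ x ∈ K ∧ K ⊆ U

variable {X : Type*} [TopologicalSpace X]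

theorem HasCompactOpenBasis.exists_between (hX : HasCompactOpenBasis X) {C U : Set X}
    (hC : IsCompact C) (hU : IsOpen U) (hCU : C ⊆ U) :
    ∃ K : Set X, IsCompact K ∧ IsOpen K ∧ C ⊆ K ∧ K ⊆ U := by
  refine hC.induction_on (p := fun C => ∃ K : Set X, IsCompact K ∧ IsOpen K ∧ C ⊆ K ∧ K ⊆ U)
    ⟨∅, isCompact_empty, isOpen_empty, le_rfl, Set.empty_subset _⟩ ?_ ?_ ?_
  · rintro s t hst ⟨K, h1, h2, h3, h4⟩
    exact ⟨K, h1, h2, hst.trans h3, h4⟩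
  · rintro s t ⟨K, h1, h2, h3, h4⟩ ⟨K', h1', h2', h3', h4'⟩
    exact ⟨K ∪ K', h1.union h1', h2.union h2', Set.union_subset_union h3 h3',
      Set.union_subset h4 h4'⟩
  · intro x hx
    obtain ⟨K, h1, h2, h3, h4⟩ := hX x U hU (hCU hx)
    exact ⟨K, mem_nhdsWithin_of_mem_nhds (h2.mem_nhds h3), K, h1, h2, le_rfl, h4⟩

/-- An open `O` of `X` cuts out `C`, and any compact open set between `C` and `O` meets the subspace
exactly in `C`. Compactness of `C` replaces closedness of the subspace. -/
theorem HasCompactOpenBasis.exists_extension (hX : HasCompactOpenBasis X) {p : X → Prop}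
    {C : Set {x // p x}} (hC : IsCompact C) (hC' : IsOpen C) {U : Set X} (hU : IsOpen U)
    (hCU : ∀ x ∈ C, x.1 ∈ U) :
    ∃ K : Set X, IsCompact K ∧ IsOpen K ∧ (∀ x : {x // p x}, x.1 ∈ K ↔ x ∈ C) ∧ K ⊆ U := by
  obtain ⟨O, hO, rfl⟩ := isOpen_induced_iff.1 hC'
  obtain ⟨K, h1, h2, h3, h4⟩ := hX.exists_between (hC.image continuous_subtype_val)
    (hO.inter hU) (by rintro _ ⟨x, hx, rfl⟩; exact ⟨hx, hCU x hx⟩)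
  exact ⟨K, h1, h2, fun x => ⟨fun hx => (h4 hx).1, fun hx => h3 ⟨x, hx, rfl⟩⟩,
    fun x hx => (h4 hx).2⟩

theorem HasCompactOpenBasis.subtype (hX : HasCompactOpenBasis X) {p : X → Prop}
    (hp : IsClosed {x | p x}) : HasCompactOpenBasis {x // p x} := by
  rintro x _ hU hx
  obtain ⟨O, hO, rfl⟩ := isOpen_induced_iff.1 hU
  obtain ⟨K, h1, h2, h3, h4⟩ := hX x.1 O hO hx
  exact ⟨Subtype.val ⁻¹' K, hp.isClosedEmbedding_subtypeVal.isCompact_preimage h1,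
    h2.preimage continuous_subtype_val, h3, fun y hy => h4 hy⟩

theorem isLocallyConstant_indicator {K : Set X} (hK : IsClopen K) {f : X → ℂ}
    (hf : IsLocallyConstant f) : IsLocallyConstant (K.indicator f) := by
  rw [IsLocallyConstant.iff_eventually_eq] at hf ⊢
  intro x
  by_cases hx : x ∈ K
  · filter_upwards [hf x, hK.isOpen.mem_nhds hx] with y hy hyK
    simp [hx, hyK, hy]
  · filter_upwards [hK.compl.isOpen.mem_nhds hx] with y hyK
    rw [Set.indicator_of_notMem hx, Set.indicator_of_notMem hyK]

namespace SchwartzBruhat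

theorem indicator_mem_of_mem {K : Set X} (hK : IsClopen K) {f : X → ℂ}
    (hf : f ∈ SchwartzBruhat X) : K.indicator f ∈ SchwartzBruhat X := by
  refine ⟨isLocallyConstant_indicator hK hf.1, hf.2.mono ?_⟩
  rw [Set.support_indicator]
  exact Set.inter_subset_right

theorem mul_mem {f g : X → ℂ} (hf : f ∈ SchwartzBruhat X) (hg : IsLocallyConstant g) :
    (fun x => f x * g x) ∈ SchwartzBruhat X :=
  ⟨hf.1.mul hg, hf.2.mul_right⟩

theorem indicator_mem [T2Space X] {K : Set X} (hK : IsCompact K) (hK' : IsOpen K) (c : ℂ) :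
    (K.indicator fun _ => c) ∈ SchwartzBruhat X :=
  ⟨isLocallyConstant_indicator ⟨hK.isClosed, hK'⟩ (IsLocallyConstant.const c),
    HasCompactSupport.intro hK fun _ hx => Set.indicator_of_notMem hx _⟩

theorem norm_mem {f : X → ℂ} (hf : f ∈ SchwartzBruhat X) :
    (fun x => (‖f x‖ : ℂ)) ∈ SchwartzBruhat X :=
  ⟨hf.1.comp fun z : ℂ => (‖z‖ : ℂ), hf.2.comp_left (g := fun z : ℂ => (‖z‖ : ℂ)) (by simp)⟩

theorem comp_subtype {f : X → ℂ} (hf : f ∈ SchwartzBruhat X) {p : X → Prop}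
    (hp : IsClosed {x | p x}) : (fun x : {x // p x} => f x.1) ∈ SchwartzBruhat {x // p x} :=
  ⟨hf.1.comp_continuous continuous_subtype_val,
    hf.2.comp_isClosedEmbedding hp.isClosedEmbedding_subtypeVal⟩

theorem comp_homeomorph {Y : Type*} [TopologicalSpace Y] {f : X → ℂ} (hf : f ∈ SchwartzBruhat X)
    (e : Y ≃ₜ X) : (fun y => f (e y)) ∈ SchwartzBruhat Y :=
  ⟨hf.1.comp_continuous e.continuous, hf.2.comp_homeomorph e⟩

theorem integrable [MeasurableSpace X] [OpensMeasurableSpace X] (μ : Measure X)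
    [IsFiniteMeasureOnCompacts μ] {f : X → ℂ} (hf : f ∈ SchwartzBruhat X) : Integrable f μ :=
  hf.1.continuous.integrable_of_hasCompactSupport hf.2

theorem isCompact_support {f : X → ℂ} (hf : f ∈ SchwartzBruhat X) :
    IsCompact (Function.support f) ∧ IsOpen (Function.support f) := by
  have h : IsClopen (Function.support f) :=
    ⟨(hf.1.isOpen_fiber 0).isClosed_compl, (hf.1.isClosed_fiber 0).isOpen_compl⟩
  refine ⟨?_, h.isOpen⟩
  have := hf.2
  rwa [HasCompactSupport, tsupport, h.isClosed.closure_eq] at this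

/-- On its compact support `f` takes finitely many values, so it is a combination of indicators of
its nonzero level sets. Recording `K ⊆ Function.support f` lets later inductions keep the pieces
over the allowed set. -/
theorem mem_span_indicator {f : X → ℂ} (hf : f ∈ SchwartzBruhat X) :
    f ∈ Submodule.span ℂ {g : X → ℂ | ∃ K : Set X, IsCompact K ∧ IsOpen K ∧
      K ⊆ Function.support f ∧ g = K.indicator fun _ => 1} := by
  have hfin : (f '' Function.support f).Finite := by
    have := isCompact_iff_compactSpace.1 (isCompact_support hf).1
    rw [Set.image_eq_range]
    exact (hf.1.comp_continuous continuous_subtype_val :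
      IsLocallyConstant fun x : Function.support f => f x).range_finite
  have : f = ∑ c ∈ hfin.toFinset, c • (f ⁻¹' {c}).indicator fun _ => (1 : ℂ) := by
    classical
    funext x
    simp only [Finset.sum_apply, Pi.smul_apply, Set.indicator_apply, Set.mem_preimage,
      Set.mem_singleton_iff, smul_eq_mul, mul_ite, mul_one, mul_zero]
    rw [Finset.sum_ite_eq]
    split_ifs with h
    · rfl
    · by_contra h0
      exact h (by simpa using ⟨x, h0, rfl⟩)
  rw [this]
  refine Submodule.sum_mem _ fun c hc => Submodule.smul_mem _ _ (Submodule.subset_span ?_)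
  rw [Set.Finite.mem_toFinset] at hc
  obtain ⟨x, hx, rfl⟩ := hc
  have hsub : f ⁻¹' {f x} ⊆ Function.support f := by
    intro y hy
    rw [Set.mem_preimage, Set.mem_singleton_iff] at hy
    rw [Function.mem_support, hy]; exact hx
  refine ⟨f ⁻¹' {f x}, (isCompact_support hf).1.of_isClosed_subset (hf.1.isClosed_fiber _) hsub,
    hf.1.isOpen_fiber _, ?_, rfl⟩
  rw [← this]; exact hsub

theorem exists_extension [T2Space X] (hX : HasCompactOpenBasis X) {p : X → Prop}
    {φ : {x // p x} → ℂ} (hφ : φ ∈ SchwartzBruhat {x // p x}) :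
    ∃ Φ ∈ SchwartzBruhat X, ∀ x : {x // p x}, Φ x.1 = φ x := by
  have hspan := mem_span_indicator hφ
  -- The support is frozen as `s`: functions met in the induction are combinations of indicators of
  -- subsets of `s`, but need not have support `s`.
  clear hφ
  generalize Function.support φ = s at hspan
  induction hspan using Submodule.span_induction with
  | mem g hg =>
    obtain ⟨C, h1, h2, -, rfl⟩ := hg
    obtain ⟨K, k1, k2, k3, -⟩ := hX.exists_extension h1 h2 isOpen_univ fun _ _ => trivial
    refine ⟨_, indicator_mem k1 k2 1, fun x => ?_⟩
    by_cases hx : x ∈ C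
    · rw [Set.indicator_of_mem ((k3 x).2 hx), Set.indicator_of_mem hx]
    · rw [Set.indicator_of_notMem (fun h => hx ((k3 x).1 h)), Set.indicator_of_notMem hx]
  | zero => exact ⟨0, zero_mem _, fun _ => rfl⟩
  | add f g _ _ hf hg =>
    obtain ⟨Φ, h, h'⟩ := hf
    obtain ⟨Φ', k, k'⟩ := hg
    exact ⟨Φ + Φ', add_mem h k, fun x => by simp [h', k']⟩
  | smul c f _ hf =>
    obtain ⟨Φ, h, h'⟩ := hf
    exact ⟨c • Φ, Submodule.smul_mem _ c h, fun x => by simp [h']⟩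

end SchwartzBruhat

end CompactOpen

/-! ### Characters, ideals and Fourier inversion on the field -/

/-- Translation by `l` preserves the integral over `H` and also multiplies it by `χ l ≠ 1`. -/
theorem integral_character_eq_zero {G : Type*} [AddGroup G] [MeasurableSpace G] [MeasurableAdd G]
    (μ : Measure G) [μ.IsAddRightInvariant] {H : AddSubgroup G} (hH : MeasurableSet (H : Set G))
    {χ : G → ℂ} (hχ : ∀ x ∈ H, ∀ y ∈ H, χ (x + y) = χ x * χ y) {l : G} (hl : l ∈ H)
    (hl1 : χ l ≠ 1) : ∫ x in (H : Set G), χ x ∂μ = 0 := by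
  have h1 : ∀ x, (H : Set G).indicator χ (x + l) = (H : Set G).indicator χ x * χ l := by
    intro x
    by_cases hx : x ∈ H
    · rw [Set.indicator_of_mem (by exact H.add_mem hx hl), Set.indicator_of_mem (by exact hx),
        hχ x hx l hl]
    · rw [Set.indicator_of_notMem, Set.indicator_of_notMem (by exact hx), zero_mul]
      intro h
      exact hx ((H.add_mem_cancel_right hl).1 h)
  have h2 := integral_add_right_eq_self (μ := μ) ((H : Set G).indicator χ) l
  simp_rw [h1] at h2
  rw [integral_mul_const, integral_indicator hH] at h2
  have h3 : (∫ x in (H : Set G), χ x ∂μ) * (χ l - 1) = 0 := by linear_combination h2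
  exact (mul_eq_zero.1 h3).resolve_right (sub_ne_zero.2 hl1)

section Field

variable {F : Type*} [NontriviallyNormedField F]

/-- The fractional ideal `ϖⁿ 𝒪`. -/
def idealP (ϖ : F) (n : ℕ) : Set F := {x | ‖x‖ ≤ ‖ϖ ^ n‖}

variable {ϖ : F}

theorem IsUniformizer.norm_pos (hϖ : IsUniformizer ϖ) : 0 < ‖ϖ‖ := by
  obtain ⟨x, hx, hx'⟩ := NormedField.exists_norm_lt_one F
  exact hx.trans_le (hϖ.2 x hx')

theorem IsUniformizer.ne_zero (hϖ : IsUniformizer ϖ) : ϖ ≠ 0 := norm_pos_iff.1 hϖ.norm_pos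

theorem IsUniformizer.tendsto_pow (hϖ : IsUniformizer ϖ) :
    Tendsto (fun n : ℕ => ‖ϖ ^ n‖) atTop (𝓝 0) := by
  simpa using tendsto_pow_atTop_nhds_zero_of_lt_one hϖ.norm_pos.le hϖ.1

theorem zero_mem_idealP (n : ℕ) : (0 : F) ∈ idealP ϖ n := by simp [idealP]

theorem zero_mem_idealU (n : ℕ) : (0 : F) ∈ idealU ϖ n := by simp [idealU]

theorem idealP_eq_closedBall (ϖ : F) (n : ℕ) : idealP ϖ n = Metric.closedBall 0 ‖ϖ ^ n‖ := by
  ext; simp [idealP]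

theorem idealU_eq_closedBall (hϖ : IsUniformizer ϖ) (n : ℕ) :
    idealU ϖ n = Metric.closedBall 0 ‖ϖ ^ n‖⁻¹ := by
  ext x
  have : 0 < ‖ϖ ^ n‖ := norm_pos_iff.2 (pow_ne_zero n hϖ.ne_zero)
  simp only [idealU, Set.mem_ofPred_eq, mem_closedBall_zero_iff, norm_mul]
  rw [← one_div, le_div_iff₀ this, mul_comm]

theorem idealP_anti (hϖ : IsUniformizer ϖ) : Antitone (idealP ϖ) := by
  intro m n hmn x hx
  refine le_trans (b := ‖ϖ ^ n‖) hx ?_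
  rw [norm_pow, norm_pow]
  exact pow_le_pow_of_le_one hϖ.norm_pos.le hϖ.1.le hmn

theorem eventually_idealP_subset (hϖ : IsUniformizer ϖ) {y : F} {U : Set F} (hU : U ∈ 𝓝 y) :
    ∀ᶠ n in atTop, ∀ x, x - y ∈ idealP ϖ n → x ∈ U := by
  obtain ⟨ε, hε, h⟩ := Metric.mem_nhds_iff.1 hU
  filter_upwards [hϖ.tendsto_pow.eventually_lt_const hε] with n hn x hx
  refine h ?_
  rw [Metric.mem_ball, dist_eq_norm]
  exact lt_of_le_of_lt hx hn

theorem eventually_mem_idealU (hϖ : IsUniformizer ϖ) (R : ℝ) :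
    ∀ᶠ n in atTop, ∀ b : F, ‖b‖ ≤ R → b ∈ idealU ϖ n := by
  have h : Tendsto (fun n : ℕ => ‖ϖ ^ n‖ * |R|) atTop (𝓝 0) := by
    simpa using hϖ.tendsto_pow.mul_const |R|
  filter_upwards [h.eventually_le_const one_pos] with n hn b hb
  rw [idealU, Set.mem_ofPred_eq, norm_mul]
  exact (mul_le_mul_of_nonneg_left (hb.trans (le_abs_self R)) (norm_nonneg _)).trans hn

theorem HasConductorIntegers.eq_one {ψ : AddChar F Circle} (hψ : HasConductorIntegers ψ) {x : F}
    (hx : ‖x‖ ≤ 1) : ψ x = 1 := by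
  simpa using (hψ x).2 hx 1 (by simp)

theorem HasConductorIntegers.exists_ne_one {ψ : AddChar F Circle} (hψ : HasConductorIntegers ψ)
    {x : F} (hx : 1 < ‖x‖) : ∃ y : F, ‖y‖ ≤ 1 ∧ ψ (x * y) ≠ 1 := by
  by_contra! h
  exact absurd ((hψ x).1 h) (not_le.2 hx)

theorem continuous_coe_comp {X : Type*} [TopologicalSpace X] {ψ : AddChar F Circle}
    (hψ : Continuous ψ) {f : X → F} (hf : Continuous f) :
    Continuous fun x => (ψ (f x) : ℂ) :=
  continuous_subtype_val.comp (hψ.comp hf)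

variable [IsUltrametricDist F]

theorem HasConductorIntegers.isLocallyConstant {ψ : AddChar F Circle}
    (hψ : HasConductorIntegers ψ) : IsLocallyConstant fun x : F => (ψ x : ℂ) := by
  rw [IsLocallyConstant.iff_eventually_eq]
  intro x
  filter_upwards [Metric.closedBall_mem_nhds x one_pos] with y hy
  have h : ψ (y - x) = 1 := hψ.eq_one (by simpa [dist_eq_norm] using hy)
  have : ψ y = ψ (y - x) * ψ x := by rw [← AddChar.map_add_eq_mul]; simp
  rw [this, h, one_mul]

theorem add_mem_idealP {n : ℕ} {x y : F} (hx : x ∈ idealP ϖ n) (hy : y ∈ idealP ϖ n) :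
    x + y ∈ idealP ϖ n :=
  (IsUltrametricDist.norm_add_le_max x y).trans (max_le hx hy)

/-- The fractional ideal `ϖ⁻ⁿ 𝒪` as an additive subgroup. -/
def idealUSubgroup (ϖ : F) (n : ℕ) : AddSubgroup F where
  carrier := idealU ϖ n
  zero_mem' := zero_mem_idealU n
  add_mem' {x y} hx hy := by
    rw [idealU, Set.mem_ofPred_eq] at *
    rw [mul_add]
    exact (IsUltrametricDist.norm_add_le_max _ _).trans (max_le hx hy)
  neg_mem' {x} hx := by
    rw [idealU, Set.mem_ofPred_eq] at *
    rwa [mul_neg, norm_neg]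

theorem isClopen_idealP (hϖ : IsUniformizer ϖ) (n : ℕ) : IsClopen (idealP ϖ n) := by
  rw [idealP_eq_closedBall]
  exact IsUltrametricDist.isClopen_closedBall _ (norm_ne_zero_iff.2 (pow_ne_zero n hϖ.ne_zero))

theorem isClopen_idealU (hϖ : IsUniformizer ϖ) (n : ℕ) : IsClopen (idealU ϖ n) := by
  rw [idealU_eq_closedBall hϖ]
  exact IsUltrametricDist.isClopen_closedBall _
    (inv_ne_zero (norm_ne_zero_iff.2 (pow_ne_zero n hϖ.ne_zero)))

/-- The coset `y + ϖⁿ 𝒪`. -/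
def idealPCoset (ϖ : F) (n : ℕ) (y : F) : Set F := {x | x - y ∈ idealP ϖ n}

theorem mem_idealPCoset {n : ℕ} {x y : F} : x ∈ idealPCoset ϖ n y ↔ ‖x - y‖ ≤ ‖ϖ ^ n‖ := Iff.rfl

theorem self_mem_idealPCoset (n : ℕ) (y : F) : y ∈ idealPCoset ϖ n y := by
  simp [idealPCoset, zero_mem_idealP]

theorem isClopen_idealPCoset (hϖ : IsUniformizer ϖ) (n : ℕ) (y : F) :
    IsClopen (idealPCoset ϖ n y) :=
  (isClopen_idealP hϖ n).preimage (continuous_id.sub continuous_const)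

theorem idealPCoset_eq_of_mem {n : ℕ} {x y : F} (h : x ∈ idealPCoset ϖ n y) :
    idealPCoset ϖ n x = idealPCoset ϖ n y := by
  have h' : y - x ∈ idealP ϖ n := by
    rw [idealPCoset, Set.mem_ofPred_eq, idealP, Set.mem_ofPred_eq, norm_sub_rev] at h
    exact h
  ext z
  refine ⟨fun hz => ?_, fun hz => ?_⟩
  · have := add_mem_idealP (n := n) (ϖ := ϖ) (x := z - x) hz h
    rwa [sub_add_sub_cancel] at this
  · have := add_mem_idealP (n := n) (ϖ := ϖ) (x := z - y) hz h'
    rwa [sub_add_sub_cancel] at this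

variable [LocallyCompactSpace F]

theorem isCompact_idealU (hϖ : IsUniformizer ϖ) (n : ℕ) : IsCompact (idealU ϖ n) := by
  have : ProperSpace F := ProperSpace.of_locallyCompactSpace F
  rw [idealU_eq_closedBall hϖ]
  exact isCompact_closedBall _ _

theorem isCompact_idealPCoset (ϖ : F) (n : ℕ) (y : F) : IsCompact (idealPCoset ϖ n y) := by
  have : ProperSpace F := ProperSpace.of_locallyCompactSpace F
  have : idealPCoset ϖ n y = Metric.closedBall y ‖ϖ ^ n‖ := by
    ext; simp [mem_idealPCoset, dist_eq_norm]
  rw [this]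
  exact isCompact_closedBall _ _

/-! ### Dual ideals, orthogonality of characters and localisation to a coset -/

variable [MeasurableSpace F] [BorelSpace F] {ψ : AddChar F Circle} (μF : Measure F)
  [μF.IsAddHaarMeasure]

theorem real_idealPCoset (n : ℕ) (y : F) : μF.real (idealPCoset ϖ n y) = μF.real (idealP ϖ n) := by
  have : idealPCoset ϖ n y = (fun x => x + -y) ⁻¹' idealP ϖ n := by
    ext; simp [idealPCoset, sub_eq_add_neg]
  rw [this, Measure.real, Measure.real, measure_preimage_add_right]

theorem real_idealP_pos (hϖ : IsUniformizer ϖ) (n : ℕ) : 0 < μF.real (idealP ϖ n) := by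
  rw [← real_idealPCoset μF n 0]
  refine ENNReal.toReal_pos ?_ (isCompact_idealPCoset ϖ n 0).measure_lt_top.ne
  exact ((isClopen_idealPCoset hϖ n 0).isOpen.measure_pos μF ⟨0, self_mem_idealPCoset n 0⟩).ne'

theorem integral_idealU (hϖ : IsUniformizer ϖ) (hcond : HasConductorIntegers ψ) (n : ℕ) (x : F) :
    ∫ b in idealU ϖ n, (ψ (b * x) : ℂ) ∂μF =
      (idealP ϖ n).indicator (fun _ => (μF.real (idealU ϖ n) : ℂ)) x := by
  by_cases hx : x ∈ idealP ϖ n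
  · rw [Set.indicator_of_mem hx]
    have : ∀ b ∈ idealU ϖ n, (ψ (b * x) : ℂ) = 1 := by
      intro b hb
      rw [hcond.eq_one, Circle.coe_one]
      rw [norm_mul, mul_comm]
      refine le_trans (mul_le_mul_of_nonneg_right hx (norm_nonneg b)) ?_
      rw [← norm_mul]; exact hb
    rw [setIntegral_congr_fun (isClopen_idealU hϖ n).isOpen.measurableSet this]
    simp
  · rw [Set.indicator_of_notMem hx]
    have h0 : 0 < ‖ϖ ^ n‖ := norm_pos_iff.2 (pow_ne_zero n hϖ.ne_zero)
    have h1 : 1 < ‖(ϖ ^ n)⁻¹ * x‖ := by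
      rw [norm_mul, norm_inv, ← div_eq_inv_mul, one_lt_div h0]
      exact not_le.1 hx
    obtain ⟨y, hy, hy'⟩ := hcond.exists_ne_one h1
    refine integral_character_eq_zero μF (H := idealUSubgroup ϖ n) (l := (ϖ ^ n)⁻¹ * y)
      (isClopen_idealU hϖ n).isOpen.measurableSet ?_ ?_ ?_
    · intro a _ b _
      rw [add_mul, AddChar.map_add_eq_mul, Circle.coe_mul]
    · change ‖ϖ ^ n * ((ϖ ^ n)⁻¹ * y)‖ ≤ 1
      rwa [mul_inv_cancel_left₀ (pow_ne_zero n hϖ.ne_zero)]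
    · rw [← Circle.coe_one, Ne, Circle.coe_inj]
      rwa [mul_right_comm]

theorem integral_idealP (hϖ : IsUniformizer ϖ) (hcond : HasConductorIntegers ψ) (n : ℕ) (x : F) :
    ∫ b in idealP ϖ n, (ψ (b * x) : ℂ) ∂μF =
      (idealU ϖ n).indicator (fun _ => (μF.real (idealP ϖ n) : ℂ)) x := by
  by_cases hx : x ∈ idealU ϖ n
  · rw [Set.indicator_of_mem hx]
    have : ∀ b ∈ idealP ϖ n, (ψ (b * x) : ℂ) = 1 := by
      intro b hb
      rw [hcond.eq_one, Circle.coe_one]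
      rw [norm_mul]
      refine le_trans (mul_le_mul_of_nonneg_right hb (norm_nonneg x)) ?_
      rw [← norm_mul]; exact hx
    rw [setIntegral_congr_fun (isClopen_idealP hϖ n).isOpen.measurableSet this]
    simp
  · rw [Set.indicator_of_notMem hx]
    have h1 : 1 < ‖ϖ ^ n * x‖ := not_le.1 hx
    obtain ⟨y, hy, hy'⟩ := hcond.exists_ne_one h1
    let H : AddSubgroup F :=
      { carrier := idealP ϖ n
        zero_mem' := zero_mem_idealP n
        add_mem' := add_mem_idealP
        neg_mem' := fun {x} hx => by simpa [idealP] using hx }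
    refine integral_character_eq_zero μF (H := H) (l := ϖ ^ n * y)
      (isClopen_idealP hϖ n).isOpen.measurableSet ?_ ?_ ?_
    · intro a _ b _
      rw [add_mul, AddChar.map_add_eq_mul, Circle.coe_mul]
    · change ‖ϖ ^ n * y‖ ≤ ‖ϖ ^ n‖
      rw [norm_mul]
      exact mul_le_of_le_one_right (norm_nonneg _) hy
    · rw [← Circle.coe_one, Ne, Circle.coe_inj]
      rwa [mul_right_comm]

/-- Fourier inversion at `0` for the indicator of `ϖⁿ 𝒪`. This is the only form in which
self-duality of `μF` enters. -/
theorem real_idealU_mul_real_idealP (hϖ : IsUniformizer ϖ) (hcond : HasConductorIntegers ψ)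
    (hμF : IsSelfDual ψ (fun x y : F => x * y) μF) (n : ℕ) :
    μF.real (idealU ϖ n) * μF.real (idealP ϖ n) = 1 := by
  have hK : IsCompact (idealP ϖ n) := by simpa [idealPCoset] using isCompact_idealPCoset ϖ n 0
  have h := hμF _ (SchwartzBruhat.indicator_mem hK (isClopen_idealP hϖ n).isOpen 1) 0
  have h1 : fourier ψ (fun x y : F => x * y) μF ((idealP ϖ n).indicator fun _ => 1) =
      (idealU ϖ n).indicator (fun _ => (μF.real (idealP ϖ n) : ℂ)) := by
    funext x
    rw [← integral_idealP μF hϖ hcond n x,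
      ← integral_indicator (isClopen_idealP hϖ n).isOpen.measurableSet]
    refine integral_congr_ae (Eventually.of_forall fun y => ?_)
    by_cases hy : y ∈ idealP ϖ n <;> simp [hy, mul_comm]
  rw [h1] at h
  simp only [fourier, zero_mul, AddChar.map_zero_eq_one, Circle.coe_one, mul_one, neg_zero] at h
  rw [integral_indicator (isClopen_idealU hϖ n).isOpen.measurableSet,
    Set.indicator_of_mem (zero_mem_idealP n)] at h
  simp only [integral_const, measureReal_restrict_apply_univ, Complex.real_smul] at h
  exact_mod_cast h

/-- Fubini and orthogonality: the integral of `ψ(b(π x - y))` over `b ∈ ϖ⁻ⁿ 𝒪` is a constant times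
the indicator of `π x ∈ y + ϖⁿ 𝒪`. Every passage between Fourier transforms and fibres rests on this
identity. -/
theorem integral_idealU_mul {X : Type*} [TopologicalSpace X] [MeasurableSpace X]
    [OpensMeasurableSpace X] (μ : Measure X) [IsFiniteMeasureOnCompacts μ]
    (hψ : Continuous ψ) (hϖ : IsUniformizer ϖ) (hcond : HasConductorIntegers ψ) {π : X → F}
    (hπ : Continuous π) {f : X → ℂ} (hf : Continuous f) (hf' : HasCompactSupport f) (n : ℕ)
    (y : F) :
    ∫ b in idealU ϖ n, (ψ (-(b * y)) : ℂ) * ∫ x, f x * (ψ (b * π x) : ℂ) ∂μ ∂μF =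
      μF.real (idealU ϖ n) * ∫ x in π ⁻¹' idealPCoset ϖ n y, f x ∂μ := by
  have hU := isClopen_idealU hϖ n
  have hUc := isCompact_idealU hϖ n
  -- The indicator makes the integrand continuous with compact support on `F × X`, so Fubini needs
  -- no σ-finiteness of `μ`.
  have hcont : Continuous (Function.uncurry fun (b : F) (x : X) =>
      (idealU ϖ n).indicator (fun _ => (1 : ℂ)) b * (f x * (ψ (b * (π x - y)) : ℂ))) := by
    refine Continuous.mul ?_ (Continuous.mul (hf.comp continuous_snd) (continuous_coe_comp hψ ?_))
    · exact (isLocallyConstant_indicator hU (IsLocallyConstant.const 1)).continuous.comp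
        continuous_fst
    · exact continuous_fst.mul ((hπ.comp continuous_snd).sub continuous_const)
  have hsupp : HasCompactSupport (Function.uncurry fun (b : F) (x : X) =>
      (idealU ϖ n).indicator (fun _ => (1 : ℂ)) b * (f x * (ψ (b * (π x - y)) : ℂ))) := by
    refine HasCompactSupport.intro' (hUc.prod hf')
      (hU.isClosed.prod (isClosed_tsupport f)) ?_
    rintro ⟨b, x⟩ h
    rw [Set.mem_prod, not_and_or] at h
    rcases h with h | h
    · simp [Set.indicator_of_notMem h]
    · simp [image_eq_zero_of_notMem_tsupport h]
  have key := integral_integral_swap_of_hasCompactSupport (μ := μF) (ν := μ) hcont hsupp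
  have hl : ∫ b, ∫ x, (idealU ϖ n).indicator (fun _ => (1 : ℂ)) b *
      (f x * (ψ (b * (π x - y)) : ℂ)) ∂μ ∂μF =
      ∫ b in idealU ϖ n, (ψ (-(b * y)) : ℂ) * ∫ x, f x * (ψ (b * π x) : ℂ) ∂μ ∂μF := by
    rw [← integral_indicator hU.isOpen.measurableSet]
    refine integral_congr_ae (Eventually.of_forall fun b => ?_)
    by_cases hb : b ∈ idealU ϖ n
    · simp only [hb, Set.indicator_of_mem, one_mul]
      rw [← integral_const_mul]
      refine integral_congr_ae (Eventually.of_forall fun x => ?_)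
      simp only
      rw [mul_sub, sub_eq_add_neg, AddChar.map_add_eq_mul, Circle.coe_mul]
      ring
    · simp [hb]
  have hr : ∫ x, ∫ b, (idealU ϖ n).indicator (fun _ => (1 : ℂ)) b *
      (f x * (ψ (b * (π x - y)) : ℂ)) ∂μF ∂μ =
      μF.real (idealU ϖ n) * ∫ x in π ⁻¹' idealPCoset ϖ n y, f x ∂μ := by
    rw [← integral_indicator ((isClopen_idealPCoset hϖ n y).preimage hπ).isOpen.measurableSet,
      ← integral_const_mul]
    refine integral_congr_ae (Eventually.of_forall fun x => ?_)
    have h1 : ∫ b, (idealU ϖ n).indicator (fun _ => (1 : ℂ)) b * (f x * (ψ (b * (π x - y)) : ℂ)) ∂μF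
        = f x * ∫ b in idealU ϖ n, (ψ (b * (π x - y)) : ℂ) ∂μF := by
      rw [← integral_const_mul, ← integral_indicator hU.isOpen.measurableSet]
      refine integral_congr_ae (Eventually.of_forall fun b => ?_)
      by_cases hb : b ∈ idealU ϖ n <;> simp [hb]
    simp only [h1]
    rw [integral_idealU μF hϖ hcond]
    by_cases hx : π x - y ∈ idealP ϖ n
    · rw [Set.indicator_of_mem hx, Set.indicator_of_mem (by exact hx), mul_comm]
    · rw [Set.indicator_of_notMem hx, Set.indicator_of_notMem (by exact hx)]; simp
  rw [← hl, key, hr]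

end Field

/-! ### Measures on fibres -/

section Fiber

variable {F : Type*} [NontriviallyNormedField F] [IsUltrametricDist F] [LocallyCompactSpace F]
  [MeasurableSpace F] [BorelSpace F] {ϖ : F} (μF : Measure F) [μF.IsAddHaarMeasure]
variable {X : Type*} [TopologicalSpace X] [T2Space X] [MeasurableSpace X] [BorelSpace X]
  (μ : Measure X) {π : X → F} {Y₀ : Set F}

theorem fiberIntegral_indicator (ν : (y : F) → Measure {x : X // π x = y}) (f : X → ℂ) (C : Set F)
    (y : F) :
    ∫ x : {x : X // π x = y}, (π ⁻¹' C).indicator f x ∂(ν y) =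
      C.indicator (fun y => ∫ x : {x : X // π x = y}, f x ∂(ν y)) y := by
  by_cases hy : y ∈ C
  · rw [Set.indicator_of_mem hy]
    refine integral_congr_ae (Eventually.of_forall fun x => ?_)
    have : x.1 ∈ π ⁻¹' C := by rw [Set.mem_preimage, x.2]; exact hy
    simp only [Set.indicator_of_mem this]
  · rw [Set.indicator_of_notMem hy]
    refine integral_eq_zero_of_ae (Eventually.of_forall fun x => ?_)
    have : x.1 ∉ π ⁻¹' C := by rw [Set.mem_preimage, x.2]; exact hy
    simp only [Set.indicator_of_notMem this, Pi.zero_apply]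

namespace IsFiberMeasure

variable {μF μ} {ν : (y : F) → Measure {x : X // π x = y}}

/-- A general `f ∈ S(X)` is not supported over `Y₀`; cutting it off to a clopen `C ⊆ Y₀` makes the
defining properties of `ν` applicable. -/
theorem indicator_mem (hν : IsFiberMeasure μ μF π Y₀ ν) (hπ : Continuous π) {f : X → ℂ}
    (hf : f ∈ SchwartzBruhat X) {C : Set F} (hC : IsClopen C) (hCY : C ⊆ Y₀) :
    C.indicator (fun y => ∫ x : {x : X // π x = y}, f x ∂(ν y)) ∈ SchwartzBruhat F ∧
      ∫ x in π ⁻¹' C, f x ∂μ = ∫ y in C, (∫ x : {x : X // π x = y}, f x ∂(ν y)) ∂μF := by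
  have h1 := SchwartzBruhat.indicator_mem_of_mem (hC.preimage hπ) hf
  have h2 : ∀ x, (π ⁻¹' C).indicator f x ≠ 0 → π x ∈ Y₀ := fun x hx =>
    hCY (show x ∈ π ⁻¹' C from Set.mem_of_indicator_ne_zero hx)
  have h3 := hν.fiber_integral_mem _ h1 h2
  have h4 := hν.integral_eq _ h1 h2
  simp_rw [fiberIntegral_indicator ν f C] at h3 h4
  refine ⟨h3, ?_⟩
  rw [← integral_indicator (hC.preimage hπ).isOpen.measurableSet, h4,
    ← integral_indicator hC.isOpen.measurableSet]

theorem eventually_eq (hν : IsFiberMeasure μ μF π Y₀ ν) (hϖ : IsUniformizer ϖ)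
    (hπ : Continuous π) (hY₀ : IsOpen Y₀) {f : X → ℂ} (hf : f ∈ SchwartzBruhat X) {y : F}
    (hy : y ∈ Y₀) :
    ∀ᶠ z in 𝓝 y, ∫ x : {x : X // π x = z}, f x ∂(ν z) = ∫ x : {x : X // π x = y}, f x ∂(ν y) := by
  obtain ⟨n, hn⟩ := (eventually_idealP_subset hϖ (hY₀.mem_nhds hy)).exists
  have hC := isClopen_idealPCoset hϖ n y
  have h := (hν.indicator_mem hπ hf hC hn).1.1
  filter_upwards [h.eventually_eq y, hC.isOpen.mem_nhds (self_mem_idealPCoset n y)] with z hz hz'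
  rwa [Set.indicator_of_mem hz', Set.indicator_of_mem (self_mem_idealPCoset n y)] at hz

/-- The fibre integral is constant near `y`, so over a small coset it only gets multiplied by the
volume. In particular `μ` determines all fibre integrals over `Y₀`, whichever `ν` is chosen. -/
theorem eventually_setIntegral (hν : IsFiberMeasure μ μF π Y₀ ν) (hϖ : IsUniformizer ϖ)
    (hπ : Continuous π) (hY₀ : IsOpen Y₀) {f : X → ℂ} (hf : f ∈ SchwartzBruhat X) {y : F}
    (hy : y ∈ Y₀) :
    ∀ᶠ n in atTop, ∫ x in π ⁻¹' idealPCoset ϖ n y, f x ∂μ =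
      μF.real (idealP ϖ n) * ∫ x : {x : X // π x = y}, f x ∂(ν y) := by
  filter_upwards [eventually_idealP_subset hϖ (hY₀.mem_nhds hy),
    eventually_idealP_subset hϖ (hν.eventually_eq hϖ hπ hY₀ hf hy)] with n hn hn'
  have hC := isClopen_idealPCoset hϖ n y
  rw [(hν.indicator_mem hπ hf hC hn).2, setIntegral_congr_fun hC.isOpen.measurableSet hn']
  simp [real_idealPCoset]

/-- Both fibre integrals are averages over the preimage of one small coset, and `e` preserves this
preimage and the integrals against `μ`. -/
theorem integral_comp_eq (hν : IsFiberMeasure μ μF π Y₀ ν) (hϖ : IsUniformizer ϖ)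
    (hπ : Continuous π) (hY₀ : IsOpen Y₀) (e : X ≃ₜ X) (he : ∀ x, π (e x) = π x)
    (hμ : ∀ f ∈ SchwartzBruhat X, ∫ x, f (e x) ∂μ = ∫ x, f x ∂μ) {f : X → ℂ}
    (hf : f ∈ SchwartzBruhat X) {y : F} (hy : y ∈ Y₀) :
    ∫ x : {x : X // π x = y}, f (e x) ∂(ν y) = ∫ x : {x : X // π x = y}, f x ∂(ν y) := by
  obtain ⟨n, h1, h2⟩ := ((hν.eventually_setIntegral hϖ hπ hY₀ hf hy).and
    (hν.eventually_setIntegral hϖ hπ hY₀ (SchwartzBruhat.comp_homeomorph hf e) hy)).exists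
  have hC := (isClopen_idealPCoset hϖ n y).preimage hπ
  have h3 := hμ _ (SchwartzBruhat.indicator_mem_of_mem hC hf)
  have h4 : (fun x => (π ⁻¹' idealPCoset ϖ n y).indicator f (e x)) =
      (π ⁻¹' idealPCoset ϖ n y).indicator fun x => f (e x) := by
    funext x
    by_cases hx : x ∈ π ⁻¹' idealPCoset ϖ n y
    · rw [Set.indicator_of_mem hx, Set.indicator_of_mem]
      rwa [Set.mem_preimage, he]
    · rw [Set.indicator_of_notMem hx, Set.indicator_of_notMem]
      rwa [Set.mem_preimage, he]
  rw [h4, integral_indicator hC.isOpen.measurableSet, integral_indicator hC.isOpen.measurableSet,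
    h1, h2] at h3
  exact mul_left_cancel₀ (by exact_mod_cast (real_idealP_pos μF hϖ n).ne') h3

end IsFiberMeasure

/-! ### Existence of fibre measures -/

/-- The measure of the part of `K` over a small ball around `y` is `c` times the measure of the
ball. -/
def HasDensityAt (ϖ : F) (π : X → F) (K : Set X) (y : F) (c : NNReal) : Prop :=
  ∀ᶠ n in atTop, μ.real (K ∩ π ⁻¹' idealPCoset ϖ n y) = c * μF.real (idealP ϖ n)

variable {μF μ}

/-- The compact set `π '' (K \ K')` misses `y`, hence misses a small coset around it. -/
theorem eventually_subset_of_fiber (hϖ : IsUniformizer ϖ) (hπ : Continuous π) {K K' : Set X}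
    (hK : IsCompact K) (hK' : IsOpen K') {y : F} (h : ∀ x ∈ K, π x = y → x ∈ K') :
    ∀ᶠ n in atTop, K ∩ π ⁻¹' idealPCoset ϖ n y ⊆ K' := by
  have h1 : IsCompact (π '' (K \ K')) := (hK.diff hK').image hπ
  have h2 : (π '' (K \ K'))ᶜ ∈ 𝓝 y := by
    refine h1.isClosed.isOpen_compl.mem_nhds ?_
    rintro ⟨x, hx, hxy⟩
    exact hx.2 (h x hx.1 hxy)
  filter_upwards [eventually_idealP_subset hϖ h2] with n hn x hx
  by_contra hx'
  exact hn (π x) hx.2 ⟨x, ⟨hx.1, hx'⟩, rfl⟩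

/-- The density of a compact open set depends only on its intersection with the fibre, and
monotonically so. -/
theorem HasDensityAt.le [IsFiniteMeasureOnCompacts μ] (hϖ : IsUniformizer ϖ) (hπ : Continuous π)
    {K K' : Set X} {y : F} {c c' : NNReal} (h : HasDensityAt μF μ ϖ π K y c)
    (h' : HasDensityAt μF μ ϖ π K' y c') (hK : IsCompact K) (hK' : IsCompact K')
    (hK'o : IsOpen K') (hsub : ∀ x ∈ K, π x = y → x ∈ K') : c ≤ c' := by
  obtain ⟨n, h1, h2, h3⟩ := (h.and (h'.and (eventually_subset_of_fiber hϖ hπ hK hK'o hsub))).exists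
  have h4 : μ.real (K ∩ π ⁻¹' idealPCoset ϖ n y) ≤ μ.real (K' ∩ π ⁻¹' idealPCoset ϖ n y) :=
    measureReal_mono (fun x hx => ⟨h3 hx, hx.2⟩)
      ((measure_mono Set.inter_subset_left).trans_lt hK'.measure_lt_top).ne
  rw [h1, h2] at h4
  exact_mod_cast le_of_mul_le_mul_right h4 (real_idealP_pos μF hϖ n)

theorem HasDensityAt.union [IsFiniteMeasureOnCompacts μ] (hϖ : IsUniformizer ϖ)
    {K K' : Set X} {y : F} {c c' d : NNReal} (h : HasDensityAt μF μ ϖ π K y c)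
    (h' : HasDensityAt μF μ ϖ π K' y c') (hd : HasDensityAt μF μ ϖ π (K ∪ K') y d) :
    d ≤ c + c' := by
  obtain ⟨n, h1, h2, h3⟩ := (h.and (h'.and hd)).exists
  have h4 := measureReal_union_le (μ := μ) (K ∩ π ⁻¹' idealPCoset ϖ n y)
    (K' ∩ π ⁻¹' idealPCoset ϖ n y)
  rw [← Set.union_inter_distrib_right, h1, h2, h3, ← add_mul] at h4
  exact_mod_cast le_of_mul_le_mul_right h4 (real_idealP_pos μF hϖ n)

theorem HasDensityAt.union_disjoint [IsFiniteMeasureOnCompacts μ] (hϖ : IsUniformizer ϖ)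
    (hπ : Continuous π) {K K' : Set X} {y : F} {c c' d : NNReal}
    (h : HasDensityAt μF μ ϖ π K y c)
    (h' : HasDensityAt μF μ ϖ π K' y c') (hd : HasDensityAt μF μ ϖ π (K ∪ K') y d)
    (hK : IsCompact K) (hK' : IsCompact K') (hdisj : Disjoint K K') :
    c + c' = d := by
  obtain ⟨n, h1, h2, h3⟩ := (h.and (h'.and hd)).exists
  have h4 := measureReal_union (μ := μ) (s₁ := K ∩ π ⁻¹' idealPCoset ϖ n y)
    (s₂ := K' ∩ π ⁻¹' idealPCoset ϖ n y)
    (hdisj.mono Set.inter_subset_left Set.inter_subset_left)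
    (hK'.measurableSet.inter ((isClopen_idealPCoset hϖ n y).preimage hπ).isOpen.measurableSet)
    ((measure_mono Set.inter_subset_left).trans_lt hK.measure_lt_top).ne
    ((measure_mono Set.inter_subset_left).trans_lt hK'.measure_lt_top).ne
  rw [← Set.union_inter_distrib_right, h1, h2, h3, ← add_mul] at h4
  exact_mod_cast (mul_right_cancel₀ (real_idealP_pos μF hϖ n).ne' h4).symm

/-- The content of a compact subset `C` of the fibre is the infimum of the densities of the compact
open `K ⊆ X₀` containing it. The measure it induces has the prescribed value on `K` because the
density sees only the trace of `K` on the fibre. -/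
theorem exists_fiber_measure [IsFiniteMeasureOnCompacts μ] (hX : HasCompactOpenBasis X)
    (hϖ : IsUniformizer ϖ) (hπ : Continuous π) {X₀ : Set X} (hX₀ : IsOpen X₀) {y : F}
    (hy : ∀ x, π x = y → x ∈ X₀)
    (hex : ∀ K : Set X, IsCompact K → IsOpen K → K ⊆ X₀ → ∃ c, HasDensityAt μF μ ϖ π K y c) :
    ∃ ν : Measure {x : X // π x = y}, IsFiniteMeasureOnCompacts ν ∧
      ∀ K : Set X, IsCompact K → IsOpen K → K ⊆ X₀ → ∀ c, HasDensityAt μF μ ϖ π K y c →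
        ν (Subtype.val ⁻¹' K) = c := by
  have hclosed : IsClosed {x | π x = y} := isClosed_eq hπ continuous_const
  let S : Set {x : X // π x = y} → Set NNReal := fun C => {c | ∃ K : Set X, IsCompact K ∧
    IsOpen K ∧ K ⊆ X₀ ∧ (∀ x ∈ C, x.1 ∈ K) ∧ HasDensityAt μF μ ϖ π K y c}
  have hcov : ∀ C : Set {x : X // π x = y}, IsCompact C → ∃ K : Set X, IsCompact K ∧
      IsOpen K ∧ K ⊆ X₀ ∧ (∀ x ∈ C, x.1 ∈ K) := by
    intro C hC
    obtain ⟨K, h1, h2, h3, h4⟩ := hX.exists_between (hC.image continuous_subtype_val) hX₀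
      (by rintro _ ⟨x, -, rfl⟩; exact hy _ x.2)
    exact ⟨K, h1, h2, h4, fun x hx => h3 ⟨x, hx, rfl⟩⟩
  have hne : ∀ C, IsCompact C → (S C).Nonempty := by
    intro C hC
    obtain ⟨K, h1, h2, h4, h3⟩ := hcov C hC
    obtain ⟨c, hc⟩ := hex K h1 h2 h4
    exact ⟨c, K, h1, h2, h4, h3, hc⟩
  have hle : ∀ C, ∀ c ∈ S C, sInf (S C) ≤ c := fun C c hc => csInf_le (OrderBot.bddBelow _) hc
  have hsub : ∀ C C' : Set {x : X // π x = y}, IsCompact C → IsCompact C' →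
      sInf (S (C ∪ C')) ≤ sInf (S C) + sInf (S C') := by
    intro C C' hC hC'
    rw [← tsub_le_iff_right]
    refine le_csInf (hne C hC) fun c hc => ?_
    rw [tsub_le_iff_right, ← tsub_le_iff_left]
    refine le_csInf (hne C' hC') fun c' hc' => ?_
    rw [tsub_le_iff_left]
    obtain ⟨K, h1, h2, h3, h4, h5⟩ := hc
    obtain ⟨K', h1', h2', h3', h4', h5'⟩ := hc'
    obtain ⟨d, hd⟩ := hex _ (h1.union h1') (h2.union h2') (Set.union_subset h3 h3')
    refine (hle _ d ⟨_, h1.union h1', h2.union h2', Set.union_subset h3 h3', ?_, hd⟩).trans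
      (h5.union hϖ h5' hd)
    rintro x (hx | hx)
    exacts [Or.inl (h4 x hx), Or.inr (h4' x hx)]
  let cont : Content {x : X // π x = y} :=
    { toFun := fun C => sInf (S C)
      mono' := by
        intro C C' h
        refine csInf_le_csInf (OrderBot.bddBelow _) (hne _ C'.isCompact) ?_
        rintro c ⟨K, h1, h2, h3, h4, h5⟩
        exact ⟨K, h1, h2, h3, fun x hx => h4 x (h hx), h5⟩
      sup_le' := by
        intro C C'
        rw [TopologicalSpace.Compacts.coe_sup]
        exact hsub _ _ C.isCompact C'.isCompact
      sup_disjoint' := by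
        intro C C' hCC' _ _
        rw [TopologicalSpace.Compacts.coe_sup]
        refine le_antisymm (hsub _ _ C.isCompact C'.isCompact) ?_
        refine le_csInf (hne _ (C.isCompact.union C'.isCompact)) ?_
        rintro d ⟨K, h1, h2, h3, h4, h5⟩
        have hc' : IsClosed (Subtype.val '' (C' : Set {x : X // π x = y})) :=
          (C'.isCompact.image continuous_subtype_val).isClosed
        -- `K₁` contains `C` and avoids `C'`, so the competitor `K` for `C ∪ C'` splits into
        -- competitors `K₁` for `C` and `K \ K₁` for `C'`.
        obtain ⟨K₁, k1, k2, k3, k4⟩ := hX.exists_between (C.isCompact.image continuous_subtype_val)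
          (h2.inter hc'.isOpen_compl) (by
            rintro _ ⟨x, hx, rfl⟩
            refine ⟨h4 x (Or.inl hx), ?_⟩
            rintro ⟨x', hx', hxx'⟩
            rw [Subtype.coe_injective hxx'] at hx'
            exact Set.disjoint_left.1 hCC' hx hx')
        have k5 : IsCompact (K \ K₁) := h1.diff k2
        have k6 : IsOpen (K \ K₁) := h2.sdiff k1.isClosed
        have k7 : K₁ ⊆ K := fun x hx => (k4 hx).1
        have k8 : K₁ ∪ K \ K₁ = K := Set.union_sdiff_cancel k7
        obtain ⟨c, hc⟩ := hex K₁ k1 k2 (k7.trans h3)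
        obtain ⟨c', hc'⟩ := hex _ k5 k6 (Set.sdiff_subset.trans h3)
        have e : c + c' = d :=
          hc.union_disjoint hϖ hπ hc' (by rwa [k8]) k1 k5 Set.disjoint_sdiff_right
        rw [← e]
        refine add_le_add (hle _ c ⟨K₁, k1, k2, k7.trans h3, fun x hx => k3 ⟨x, hx, rfl⟩, hc⟩)
          (hle _ c' ⟨_, k5, k6, Set.sdiff_subset.trans h3, fun x hx => ⟨h4 x (Or.inr hx), ?_⟩, hc'⟩)
        intro hx'
        exact (k4 hx').2 ⟨x, hx, rfl⟩ }
  have hval : ∀ K : Set X, IsCompact K → IsOpen K → K ⊆ X₀ → ∀ c, HasDensityAt μF μ ϖ π K y c →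
        cont.measure (Subtype.val ⁻¹' K) = c := by
    intro K h1 h2 h3 c hc
    have hKc : IsCompact (Subtype.val ⁻¹' K : Set {x : X // π x = y}) :=
      hclosed.isClosedEmbedding_subtypeVal.isCompact_preimage h1
    have hKo : IsOpen (Subtype.val ⁻¹' K : Set {x : X // π x = y}) :=
      h2.preimage continuous_subtype_val
    rw [cont.measure_apply hKo.measurableSet, cont.outerMeasure_of_isOpen _ hKo,
      cont.innerContent_of_isCompact hKc hKo]
    change ((sInf (S (Subtype.val ⁻¹' K)) : NNReal) : ENNReal) = c
    congr 1
    -- `K` is itself a competitor, and any other one contains the part of `K` in the fibre, so the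
    -- infimum is attained at `c`.
    refine le_antisymm (hle _ c ⟨K, h1, h2, h3, fun x hx => hx, hc⟩) (le_csInf (hne _ hKc) ?_)
    rintro c' ⟨K', k1, k2, k3, k4, k5⟩
    exact hc.le hϖ hπ k5 h1 k1 k2 fun x hx hxy => k4 ⟨x, hxy⟩ hx
  refine ⟨cont.measure, ⟨fun C hC => ?_⟩, hval⟩
  obtain ⟨K, h1, h2, h4, h3⟩ := hcov C hC
  obtain ⟨c, hc⟩ := hex K h1 h2 h4
  refine (measure_mono (t := Subtype.val ⁻¹' K) h3).trans_lt ?_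
  rw [hval K h1 h2 h4 c hc]
  exact ENNReal.coe_lt_top

/-- Fubini for the set of pairs `(y, x)` with `x ∈ K` and `π x - y ∈ ϖⁿ 𝒪`. -/
theorem integral_real_inter (hϖ : IsUniformizer ϖ) [IsFiniteMeasureOnCompacts μ]
    (hπ : Continuous π) {K : Set X} (hK : IsCompact K) (hK' : IsOpen K) (n : ℕ) :
    ∫ y, (μ.real (K ∩ π ⁻¹' idealPCoset ϖ n y) : ℂ) ∂μF = μF.real (idealP ϖ n) * μ.real K := by
  have hP := isClopen_idealP hϖ n
  have hPc : IsCompact (idealP ϖ n) := by simpa [idealPCoset] using isCompact_idealPCoset ϖ n 0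
  let k : F → X → ℂ := fun y x => K.indicator (fun _ => (1 : ℂ)) x *
    (idealP ϖ n).indicator (fun _ => (1 : ℂ)) (π x - y)
  have hcont : Continuous (Function.uncurry k) := by
    refine Continuous.mul ?_ ?_
    · exact (isLocallyConstant_indicator ⟨hK.isClosed, hK'⟩
        (IsLocallyConstant.const 1)).continuous.comp continuous_snd
    · exact (isLocallyConstant_indicator hP (IsLocallyConstant.const 1)).continuous.comp
        ((hπ.comp continuous_snd).sub continuous_fst)
  have hsupp : HasCompactSupport (Function.uncurry k) := by
    refine HasCompactSupport.intro ((hK.prod hPc).image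
      (f := fun q : X × F => (π q.1 - q.2, q.1)) (by fun_prop)) ?_
    rintro ⟨y, x⟩ h
    by_contra hne
    have h1 : x ∈ K := Set.mem_of_indicator_ne_zero (left_ne_zero_of_mul hne)
    have h2 : π x - y ∈ idealP ϖ n := Set.mem_of_indicator_ne_zero (right_ne_zero_of_mul hne)
    exact h ⟨(x, π x - y), ⟨h1, h2⟩, by simp⟩
  have key := integral_integral_swap_of_hasCompactSupport (μ := μF) (ν := μ) hcont hsupp
  have hl : ∀ y, ∫ x, k y x ∂μ = (μ.real (K ∩ π ⁻¹' idealPCoset ϖ n y) : ℂ) := by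
    intro y
    have hm : MeasurableSet (K ∩ π ⁻¹' idealPCoset ϖ n y) := hK'.measurableSet.inter
      ((isClopen_idealPCoset hϖ n y).preimage hπ).isOpen.measurableSet
    have : (fun x => k y x) = (K ∩ π ⁻¹' idealPCoset ϖ n y).indicator fun _ => (1 : ℂ) := by
      funext x
      have h : π x - y ∈ idealP ϖ n ↔ x ∈ π ⁻¹' idealPCoset ϖ n y := Iff.rfl
      by_cases h1 : x ∈ K <;> by_cases h2 : π x - y ∈ idealP ϖ n <;> simp [k, h1, h2, ← h]
    rw [this, integral_indicator hm]
    simp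
  have hr : ∀ x, ∫ y, k y x ∂μF = K.indicator (fun _ => (μF.real (idealP ϖ n) : ℂ)) x := by
    intro x
    have : (fun y => k y x) = fun y => K.indicator (fun _ => (1 : ℂ)) x *
        (idealPCoset ϖ n (π x)).indicator (fun _ => (1 : ℂ)) y := by
      funext y
      have h : π x - y ∈ idealP ϖ n ↔ y ∈ idealPCoset ϖ n (π x) := by
        rw [mem_idealPCoset, idealP, Set.mem_ofPred_eq, norm_sub_rev]
      by_cases h2 : π x - y ∈ idealP ϖ n <;> simp [k, h2, ← h]
    rw [this, integral_const_mul,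
      integral_indicator (isClopen_idealPCoset hϖ n (π x)).isOpen.measurableSet]
    by_cases h1 : x ∈ K <;> simp [h1, real_idealPCoset]
  simp_rw [hl, hr] at key
  rw [key, integral_indicator hK'.measurableSet]
  simp [mul_comm]

/-- It matters in `hex` that `n₀` is independent of `y`: then `g` is constant on cosets of `ϖ^n₀ 𝒪`,
and integrating the equation at level `n₀` over `y` recovers `μ(K)`. -/
theorem exists_isFiberMeasure [IsFiniteMeasureOnCompacts μ] (hX : HasCompactOpenBasis X)
    (hϖ : IsUniformizer ϖ) (hπ : Continuous π) (hY₀ : IsOpen Y₀)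
    (hex : ∀ K : Set X, IsCompact K → IsOpen K → K ⊆ π ⁻¹' Y₀ → ∃ (g : F → NNReal) (n₀ : ℕ),
      ∀ n ≥ n₀, ∀ y, μ.real (K ∩ π ⁻¹' idealPCoset ϖ n y) = g y * μF.real (idealP ϖ n)) :
    ∃ ν : (y : F) → Measure {x : X // π x = y}, IsFiberMeasure μ μF π Y₀ ν := by
  classical
  have hX₀ := hY₀.preimage hπ
  have hden : ∀ y ∈ Y₀, ∃ ν : Measure {x : X // π x = y}, IsFiniteMeasureOnCompacts ν ∧
      ∀ K : Set X, IsCompact K → IsOpen K → K ⊆ π ⁻¹' Y₀ → ∀ c, HasDensityAt μF μ ϖ π K y c →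
        ν (Subtype.val ⁻¹' K) = c := by
    intro y hy
    refine exists_fiber_measure hX hϖ hπ hX₀ (fun x hx => by rwa [Set.mem_preimage, hx]) ?_
    intro K h1 h2 h3
    obtain ⟨g, n₀, h⟩ := hex K h1 h2 h3
    exact ⟨g y, (eventually_ge_atTop n₀).mono fun n hn => h n hn y⟩
  choose! ν hν hν' using hden
  -- With the value `0` off `Y₀` every fibre measure is finite on compacts, so fibre integrals are
  -- additive in `f` for all `y`.
  let ν₀ : (y : F) → Measure {x : X // π x = y} := fun y => if y ∈ Y₀ then ν y else 0
  have hν₀ : ∀ y, IsFiniteMeasureOnCompacts (ν₀ y) := by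
    intro y
    by_cases hy : y ∈ Y₀
    · simpa [ν₀, hy] using hν y hy
    · simp only [ν₀, hy, if_false]; infer_instance
  have hclosed : ∀ y, IsClosed {x | π x = y} := fun y => isClosed_eq hπ continuous_const
  -- Membership of `f` is repeated in the conclusion because the sum step needs it for both
  -- summands.
  have main : ∀ f ∈ SchwartzBruhat X, (∀ x, f x ≠ 0 → π x ∈ Y₀) →
      f ∈ SchwartzBruhat X ∧
      (fun y => ∫ x : {x : X // π x = y}, f x ∂(ν₀ y)) ∈ SchwartzBruhat F ∧
      ∫ x, f x ∂μ = ∫ y, (∫ x : {x : X // π x = y}, f x ∂(ν₀ y)) ∂μF := by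
    intro f hf hfY
    have hspan := SchwartzBruhat.mem_span_indicator hf
    have hs : Function.support f ⊆ π ⁻¹' Y₀ := hfY
    clear hf hfY
    generalize Function.support f = s at hspan hs
    induction hspan using Submodule.span_induction with
    | zero => simp [zero_mem]; exact zero_mem _
    | smul c f _ ih =>
      obtain ⟨h1, h2, h3⟩ := ih
      refine ⟨Submodule.smul_mem _ c h1, ?_, ?_⟩
      · simp only [Pi.smul_apply, smul_eq_mul, integral_const_mul]
        exact Submodule.smul_mem _ c h2
      · simp only [Pi.smul_apply, smul_eq_mul, integral_const_mul, h3]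
    | add f g _ _ ihf ihg =>
      obtain ⟨h1, h2, h3⟩ := ihf
      obtain ⟨k1, k2, k3⟩ := ihg
      have hadd : ∀ y, ∫ x : {x : X // π x = y}, (f + g) x ∂(ν₀ y) =
          (∫ x : {x : X // π x = y}, f x ∂(ν₀ y)) + ∫ x : {x : X // π x = y}, g x ∂(ν₀ y) := by
        intro y
        exact integral_add
          (SchwartzBruhat.integrable (ν₀ y) (SchwartzBruhat.comp_subtype h1 (hclosed y)))
          (SchwartzBruhat.integrable (ν₀ y) (SchwartzBruhat.comp_subtype k1 (hclosed y)))
      refine ⟨add_mem h1 k1, ?_, ?_⟩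
      · simp_rw [hadd]
        exact add_mem h2 k2
      · simp_rw [hadd]
        rw [integral_add (SchwartzBruhat.integrable μF h2) (SchwartzBruhat.integrable μF k2),
          ← h3, ← k3]
        exact integral_add (SchwartzBruhat.integrable μ h1) (SchwartzBruhat.integrable μ k1)
    | mem f hf =>
      obtain ⟨K, h1, h2, h3, rfl⟩ := hf
      obtain ⟨g, n₀, hg⟩ := hex K h1 h2 (h3.trans hs)
      have hgd : ∀ y, HasDensityAt μF μ ϖ π K y (g y) := fun y =>
        (eventually_ge_atTop n₀).mono fun n hn => hg n hn y
      have hg0 : ∀ y, y ∉ π '' K → g y = 0 := by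
        intro y hy
        have h0 : HasDensityAt μF μ ϖ π (∅ : Set X) y 0 :=
          Eventually.of_forall fun n => by simp
        refine le_antisymm ?_ zero_le
        exact (hgd y).le hϖ hπ h0 h1 isCompact_empty isOpen_empty
          fun x hx hxy => (hy ⟨x, hx, hxy⟩).elim
      have hint : (fun y => ∫ x : {x : X // π x = y}, K.indicator (fun _ => (1 : ℂ)) x ∂(ν₀ y)) =
          fun y => ((g y : ℝ) : ℂ) := by
        funext y
        have e : (fun x : {x : X // π x = y} => K.indicator (fun _ => (1 : ℂ)) x.1) =
            (Subtype.val ⁻¹' K).indicator fun _ => 1 := rfl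
        rw [e, integral_indicator (h2.preimage continuous_subtype_val).measurableSet]
        by_cases hy : y ∈ Y₀
        · simp [ν₀, hy, Measure.real, hν' y hy K h1 h2 (h3.trans hs) _ (hgd y)]
        · have : g y = 0 := hg0 y (by
            rintro ⟨x, hx, rfl⟩
            exact hy (hs (h3 hx)))
          simp [ν₀, hy, this]
      have hgS : (fun y => ((g y : ℝ) : ℂ)) ∈ SchwartzBruhat F := by
        refine ⟨?_, HasCompactSupport.intro (h1.image hπ) fun y hy => by simp [hg0 y hy]⟩
        rw [IsLocallyConstant.iff_eventually_eq]
        intro y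
        filter_upwards [(isClopen_idealPCoset hϖ n₀ y).isOpen.mem_nhds
          (self_mem_idealPCoset n₀ y)] with z hz
        have e1 := hg n₀ le_rfl y
        have e2 := hg n₀ le_rfl z
        rw [idealPCoset_eq_of_mem hz, e1] at e2
        rw [mul_right_cancel₀ (real_idealP_pos μF hϖ n₀).ne' e2]
      refine ⟨SchwartzBruhat.indicator_mem h1 h2 1, ?_, ?_⟩
      · rw [hint]; exact hgS
      · rw [hint, integral_indicator h2.measurableSet]
        have e := integral_real_inter (μF := μF) (μ := μ) hϖ hπ h1 h2 n₀
        simp_rw [hg n₀ le_rfl, Complex.ofReal_mul, integral_mul_const] at e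
        rw [mul_comm] at e
        rw [mul_left_cancel₀ (by exact_mod_cast (real_idealP_pos μF hϖ n₀).ne') e]
        simp
  exact ⟨ν₀, fun y _ => hν₀ y, fun f hf hf' => (main f hf hf').2.1,
    fun f hf hf' => (main f hf hf').2.2⟩

/-- Decay of the Fourier transform of the push-forward of `μ|_K` makes the push-forward a
multiple of Haar measure near every point. -/
theorem eventually_real_inter_eq [IsFiniteMeasureOnCompacts μ] {ψ : AddChar F Circle}
    (hψ : Continuous ψ) (hϖ : IsUniformizer ϖ) (hcond : HasConductorIntegers ψ)
    (hμF : IsSelfDual ψ (fun x y : F => x * y) μF) (hπ : Continuous π) {K : Set X}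
    (hK : IsCompact K) (hK' : IsOpen K)
    (hdecay : ∃ R : ℝ, ∀ b : F, R < ‖b‖ → ∫ x in K, (ψ (b * π x) : ℂ) ∂μ = 0) :
    ∃ (g : F → NNReal) (n₀ : ℕ), ∀ n ≥ n₀, ∀ y,
      μ.real (K ∩ π ⁻¹' idealPCoset ϖ n y) = g y * μF.real (idealP ϖ n) := by
  obtain ⟨R, hR⟩ := hdecay
  obtain ⟨n₀, hn₀⟩ := eventually_atTop.1 (eventually_mem_idealU hϖ R)
  have hf := SchwartzBruhat.indicator_mem hK hK' 1
  have key : ∀ n y, ∫ b in idealU ϖ n, (ψ (-(b * y)) : ℂ) * ∫ x in K, (ψ (b * π x) : ℂ) ∂μ ∂μF =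
      μF.real (idealU ϖ n) * μ.real (K ∩ π ⁻¹' idealPCoset ϖ n y) := by
    intro n y
    have h := integral_idealU_mul μF μ hψ hϖ hcond hπ hf.1.continuous hf.2 n y
    have hC := (isClopen_idealPCoset hϖ n y).preimage hπ
    have e1 : ∫ x in π ⁻¹' idealPCoset ϖ n y, K.indicator (fun _ => (1 : ℂ)) x ∂μ =
        μ.real (K ∩ π ⁻¹' idealPCoset ϖ n y) := by
      rw [setIntegral_indicator hK'.measurableSet, Set.inter_comm]; simp
    rw [e1] at h
    rw [← h]
    refine setIntegral_congr_fun (isClopen_idealU hϖ n).isOpen.measurableSet fun b _ => ?_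
    rw [← integral_indicator hK'.measurableSet]
    congr 1
    refine integral_congr_ae (Eventually.of_forall fun x => ?_)
    by_cases hx : x ∈ K <;> simp [hx]
  -- Outside `ϖ⁻ⁿ⁰ 𝒪` the inner integral vanishes, so the left side of `key` no longer changes for
  -- `n ≥ n₀`.
  have hstable : ∀ n ≥ n₀, ∀ y, μF.real (idealU ϖ n) * μ.real (K ∩ π ⁻¹' idealPCoset ϖ n y) =
      μF.real (idealU ϖ n₀) * μ.real (K ∩ π ⁻¹' idealPCoset ϖ n₀ y) := by
    intro n hn y
    have h : ∀ m ≥ n₀, ∫ b in idealU ϖ m, (ψ (-(b * y)) : ℂ) * ∫ x in K, (ψ (b * π x) : ℂ) ∂μ ∂μF =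
        ∫ b, (ψ (-(b * y)) : ℂ) * ∫ x in K, (ψ (b * π x) : ℂ) ∂μ ∂μF := by
      intro m hm
      refine setIntegral_eq_integral_of_forall_compl_eq_zero fun b hb => ?_
      rw [hR b (not_le.1 fun h => hb (hn₀ m hm b h)), mul_zero]
    have := (h n hn).trans (h n₀ le_rfl).symm
    rw [key, key] at this
    exact_mod_cast this
  refine ⟨fun y => Real.toNNReal (μF.real (idealU ϖ n₀) *
    μ.real (K ∩ π ⁻¹' idealPCoset ϖ n₀ y)), n₀, fun n hn y => ?_⟩
  rw [Real.coe_toNNReal _ (by positivity), ← hstable n hn y]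
  have := real_idealU_mul_real_idealP μF hϖ hcond hμF n
  linear_combination (-μ.real (K ∩ π ⁻¹' idealPCoset ϖ n y)) * this

end Fiber

/-! ### Lattices in a quadratic space and stationary phase -/

section Lattice

variable {F : Type*} [NontriviallyNormedField F] [LocallyCompactSpace F]
variable {V : Type*} [AddCommGroup V] [Module F V] [FiniteDimensional F V] [TopologicalSpace V]
  [IsTopologicalAddGroup V] [ContinuousSMul F V] [T2Space V]

variable (F V) in
/-- Coordinates with respect to the standard basis of `V`. -/
noncomputable def coordL : V ≃L[F] (Fin (Module.finrank F V) → F) :=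
  haveI : ProperSpace F := ProperSpace.of_locallyCompactSpace F
  (Module.finBasis F V).equivFunL

theorem coordL_finBasis (i : Fin (Module.finrank F V)) :
    coordL F V (Module.finBasis F V i) = Pi.single i 1 := by
  classical
  funext j
  have : coordL F V (Module.finBasis F V i) j = (Module.finBasis F V).equivFun
    (Module.finBasis F V i) j := rfl
  rw [this, Module.Basis.equivFun_self, Pi.single_apply]
  simp [eq_comm]

/-- The coordinates `⟨x, e_i⟩` for the standard basis `e_i` of `V`. -/
noncomputable def dualL (Q : QuadraticForm F V) (hQ : Q.polarBilin.Nondegenerate) :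
    V ≃L[F] (Fin (Module.finrank F V) → F) :=
  haveI : ProperSpace F := ProperSpace.of_locallyCompactSpace F
  (LinearMap.linearEquivOfInjective
    (LinearMap.pi fun i => (Q.polarBilin.flip (Module.finBasis F V i)))
    (by
      rw [injective_iff_map_eq_zero]
      intro x hx
      refine hQ.1 x fun y => ?_
      have h : Q.polarBilin x = 0 := (Module.finBasis F V).ext fun i => congr_fun hx i
      rw [h, LinearMap.zero_apply])
    (by simp)).toContinuousLinearEquiv

theorem dualL_apply (Q : QuadraticForm F V) (hQ : Q.polarBilin.Nondegenerate) (x : V)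
    (i : Fin (Module.finrank F V)) :
    dualL Q hQ x i = QuadraticMap.polar Q x (Module.finBasis F V i) := rfl

theorem continuous_polar_comp (h2 : (2 : F) ≠ 0) (Q : QuadraticForm F V) {X : Type*}
    [TopologicalSpace X] {f g : X → V} (hf : Continuous f) (hg : Continuous g) :
    Continuous fun x => QuadraticMap.polar Q (f x) (g x) := by
  borelize V
  have hQ := continuous_quadraticForm h2 Q
  exact ((hQ.comp (hf.add hg)).sub (hQ.comp hf)).sub (hQ.comp hg)

variable [IsUltrametricDist F] {ϖ : F}

variable (V) in
/-- The lattice `ϖᵏ L₀`, where `L₀` is spanned by the standard basis of `V`. -/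
def lattice (ϖ : F) (k : ℕ) : AddSubgroup V where
  carrier := {v | ‖coordL F V v‖ ≤ ‖ϖ ^ k‖}
  zero_mem' := by simp
  add_mem' {x y} hx hy := by
    rw [Set.mem_ofPred_eq] at *
    rw [map_add]
    exact (IsUltrametricDist.norm_add_le_max _ _).trans (max_le hx hy)
  neg_mem' {x} hx := by
    rw [Set.mem_ofPred_eq] at *
    rwa [map_neg, norm_neg]

theorem mem_lattice {k : ℕ} {v : V} : v ∈ lattice V ϖ k ↔ ‖coordL F V v‖ ≤ ‖ϖ ^ k‖ := Iff.rfl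

theorem coe_lattice (ϖ : F) (k : ℕ) :
    (lattice V ϖ k : Set V) = coordL F V ⁻¹' Metric.closedBall 0 ‖ϖ ^ k‖ := by
  ext v; simp [mem_lattice]

theorem isClopen_lattice (hϖ : IsUniformizer ϖ) (k : ℕ) : IsClopen (lattice V ϖ k : Set V) := by
  rw [coe_lattice]
  exact (IsUltrametricDist.isClopen_closedBall _
    (norm_ne_zero_iff.2 (pow_ne_zero k hϖ.ne_zero))).preimage (coordL F V).continuous

theorem isCompact_lattice (ϖ : F) (k : ℕ) : IsCompact (lattice V ϖ k : Set V) := by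
  have : ProperSpace F := ProperSpace.of_locallyCompactSpace F
  rw [coe_lattice]
  exact (coordL F V).toHomeomorph.isCompact_preimage.2 (isCompact_closedBall _ _)

theorem lattice_anti (hϖ : IsUniformizer ϖ) {j k : ℕ} (h : j ≤ k) :
    lattice V ϖ k ≤ lattice V ϖ j := by
  intro v hv
  refine le_trans (b := ‖ϖ ^ k‖) hv ?_
  rw [norm_pow, norm_pow]
  exact pow_le_pow_of_le_one hϖ.norm_pos.le hϖ.1.le h

theorem eventually_lattice_subset (hϖ : IsUniformizer ϖ) {U : Set V} (hU : U ∈ 𝓝 (0 : V)) :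
    ∀ᶠ k in atTop, (lattice V ϖ k : Set V) ⊆ U := by
  have h1 : (coordL F V).symm ⁻¹' U ∈ 𝓝 (0 : Fin (Module.finrank F V) → F) := by
    refine (coordL F V).symm.continuous.continuousAt.preimage_mem_nhds ?_
    simpa using hU
  obtain ⟨ε, hε, h⟩ := Metric.mem_nhds_iff.1 h1
  filter_upwards [hϖ.tendsto_pow.eventually_lt_const hε] with k hk v hv
  have h3 : coordL F V v ∈ Metric.ball (0 : Fin (Module.finrank F V) → F) ε := by
    rw [mem_ball_zero_iff]
    exact lt_of_le_of_lt hv hk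
  simpa using h h3

theorem hasCompactOpenBasis_module (hϖ : IsUniformizer ϖ) : HasCompactOpenBasis V := by
  intro x U hU hx
  have hU' : (fun v => v + x) ⁻¹' U ∈ 𝓝 (0 : V) :=
    (continuous_add_const x).continuousAt.preimage_mem_nhds (by simpa using hU.mem_nhds hx)
  obtain ⟨k, hk⟩ := (eventually_lattice_subset hϖ hU').exists
  refine ⟨(fun v => v - x) ⁻¹' (lattice V ϖ k : Set V), ?_,
    (isClopen_lattice hϖ k).isOpen.preimage (continuous_id.sub continuous_const), ?_, ?_⟩
  · exact (Homeomorph.subRight x).isCompact_preimage.2 (isCompact_lattice ϖ k)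
  · simp
  · intro v hv
    simpa using hk hv

/-- Supplies the stability under a small lattice that stationary phase asks of `K`. -/
theorem eventually_add_lattice_subset (hϖ : IsUniformizer ϖ) {K : Set V} (hK : IsCompact K)
    (hK' : IsOpen K) : ∀ᶠ k in atTop, ∀ v ∈ K, ∀ l ∈ lattice V ϖ k, v + l ∈ K := by
  obtain ⟨W, hW, h⟩ := compact_open_separated_add_right hK hK' le_rfl
  filter_upwards [eventually_lattice_subset hϖ hW] with k hk v hv l hl
  exact h (Set.add_mem_add hv (hk hl))

theorem smul_mem_lattice {k : ℕ} {a : F} {v : V} (hv : v ∈ lattice V ϖ 0) (ha : ‖a‖ ≤ ‖ϖ ^ k‖) :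
    a • v ∈ lattice V ϖ k := by
  rw [mem_lattice] at *
  rw [map_smul, norm_smul]
  calc ‖a‖ * ‖coordL F V v‖ ≤ ‖ϖ ^ k‖ * 1 := by
        refine mul_le_mul ha (by simpa using hv) (norm_nonneg _) (norm_nonneg _)
    _ = ‖ϖ ^ k‖ := mul_one _

theorem mem_lattice_iff_exists (hϖ : IsUniformizer ϖ) {k : ℕ} {v : V} :
    v ∈ lattice V ϖ k ↔ ∃ w ∈ lattice V ϖ 0, v = ϖ ^ k • w := by
  constructor
  · intro hv
    have h0 : ϖ ^ k ≠ 0 := pow_ne_zero k hϖ.ne_zero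
    refine ⟨(ϖ ^ k)⁻¹ • v, ?_, (smul_inv_smul₀ h0 v).symm⟩
    rw [mem_lattice] at *
    rw [map_smul, norm_smul, norm_inv, pow_zero, norm_one, ← div_eq_inv_mul]
    exact (div_le_one (norm_pos_iff.2 h0)).2 hv
  · rintro ⟨w, hw, rfl⟩
    exact smul_mem_lattice hw le_rfl

theorem finBasis_mem_lattice (i : Fin (Module.finrank F V)) :
    Module.finBasis F V i ∈ lattice V ϖ 0 := by
  classical
  rw [mem_lattice, coordL_finBasis, pow_zero, norm_one]
  refine (pi_norm_le_iff_of_nonneg zero_le_one).2 fun j => ?_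
  rw [Pi.single_apply]
  split_ifs <;> simp

variable [MeasurableSpace V] [BorelSpace V] (μ : Measure V) [μ.IsAddHaarMeasure]
  {ψ : AddChar F Circle}

/-- Since `ψ(b Q)` is trivial on `L`, the shift `v ↦ v + l` multiplies the integrand by `ψ(⟨b v + u,
l⟩)`, where `b v + u` is the gradient of the phase. For each `v ∈ K` this is a nontrivial character
of `l ∈ L`, so averaging over `L` gives `0`. -/
theorem setIntegral_phase_eq_zero (h2 : (2 : F) ≠ 0) (hψ : Continuous ψ) (Q : QuadraticForm F V)
    {L : AddSubgroup V} (hL : IsCompact (L : Set V)) (hL' : IsOpen (L : Set V)) {K : Set V}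
    (hK : IsCompact K) (hK' : IsOpen K) (hKL : ∀ v ∈ K, ∀ l ∈ L, v + l ∈ K) {b : F} {u : V}
    (hb : ∀ l ∈ L, ψ (b * Q l) = 1)
    (hne : ∀ v ∈ K, ∃ l ∈ L, ψ (QuadraticMap.polar Q (b • v + u) l) ≠ 1) :
    ∫ v in K, (ψ (b * Q v + QuadraticMap.polar Q u v) : ℂ) ∂μ = 0 := by
  have hQc := continuous_quadraticForm h2 Q
  have hKcl : IsClopen K := ⟨hK.isClosed, hK'⟩
  have hLcl : IsClopen (L : Set V) := ⟨hL.isClosed, hL'⟩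
  let g : V → ℂ := K.indicator fun v => (ψ (b * Q v + QuadraticMap.polar Q u v) : ℂ)
  have hgc : Continuous g := by
    refine Continuous.indicator (fun v hv => ?_) (continuous_coe_comp hψ
      ((continuous_const.mul hQc).add (continuous_polar Q u)))
    rw [hKcl.frontier_eq] at hv; exact hv.elim
  have hshift : ∀ l ∈ L, ∀ v, g (v + l) = g v * (ψ (QuadraticMap.polar Q (b • v + u) l) : ℂ) := by
    intro l hl v
    by_cases hv : v ∈ K
    · simp only [g]
      rw [Set.indicator_of_mem hv, Set.indicator_of_mem (hKL v hv l hl), ← Circle.coe_mul,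
        ← AddChar.map_add_eq_mul]
      have e : b * Q (v + l) + QuadraticMap.polar Q u (v + l) = b * Q l +
          (b * Q v + QuadraticMap.polar Q u v + QuadraticMap.polar Q (b • v + u) l) := by
        rw [QuadraticMap.polar_add_right, QuadraticMap.polar_add_left,
          QuadraticMap.polar_smul_left, QuadraticMap.map_add (f := Q), smul_eq_mul]
        ring
      rw [e, AddChar.map_add_eq_mul, hb l hl, one_mul]
    · have hv' : v + l ∉ K := fun h => hv (by simpa using hKL _ h (-l) (L.neg_mem hl))
      simp only [g]
      rw [Set.indicator_of_notMem hv, Set.indicator_of_notMem hv', zero_mul]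
  -- The double integral over `L × K` is computed in both orders: shift invariance gives the volume
  -- of `L` times the wanted integral, the inner character integrals give `0`.
  let k : V → V → ℂ := fun l v => (L : Set V).indicator (fun _ => (1 : ℂ)) l *
    (g v * (ψ (QuadraticMap.polar Q (b • v + u) l) : ℂ))
  have hcont : Continuous (Function.uncurry k) := by
    refine Continuous.mul ?_ (Continuous.mul (hgc.comp continuous_snd) (continuous_coe_comp hψ ?_))
    · exact (isLocallyConstant_indicator hLcl (IsLocallyConstant.const 1)).continuous.comp
        continuous_fst
    · exact continuous_polar_comp h2 Q
        ((continuous_snd.const_smul b).add continuous_const) continuous_fst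
  have hsupp : HasCompactSupport (Function.uncurry k) := by
    refine HasCompactSupport.intro (hL.prod hK) ?_
    rintro ⟨l, v⟩ h
    rw [Set.mem_prod, not_and_or] at h
    rcases h with h | h
    · simp only [Function.uncurry, k]
      rw [Set.indicator_of_notMem h, zero_mul]
    · simp only [Function.uncurry, k, g]
      rw [Set.indicator_of_notMem h, zero_mul, mul_zero]
  have key := integral_integral_swap_of_hasCompactSupport (μ := μ) (ν := μ) hcont hsupp
  have hl : ∀ l, ∫ v, k l v ∂μ = (L : Set V).indicator (fun _ => ∫ v, g v ∂μ) l := by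
    intro l
    by_cases hl : l ∈ (L : Set V)
    · simp only [k, Set.indicator_of_mem hl, one_mul]
      simp_rw [← hshift l hl]
      exact integral_add_right_eq_self g l
    · simp only [k, Set.indicator_of_notMem hl, zero_mul, integral_zero]
  have hr : ∀ v, ∫ l, k l v ∂μ = 0 := by
    intro v
    by_cases hv : v ∈ K
    · obtain ⟨l, hl, hl'⟩ := hne v hv
      have h0 := integral_character_eq_zero μ (H := L) hL'.measurableSet
        (χ := fun l => (ψ (QuadraticMap.polar Q (b • v + u) l) : ℂ)) (l := l)
        (fun x _ y _ => by
          rw [QuadraticMap.polar_add_right, AddChar.map_add_eq_mul, Circle.coe_mul]) hl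
        (by rwa [← Circle.coe_one, Ne, Circle.coe_inj])
      rw [← integral_indicator hL'.measurableSet] at h0
      have e : (fun l => k l v) = fun l => g v * (L : Set V).indicator
          (fun l => (ψ (QuadraticMap.polar Q (b • v + u) l) : ℂ)) l := by
        funext l
        by_cases hl : l ∈ (L : Set V)
        · simp only [k, Set.indicator_of_mem hl, one_mul]
        · simp only [k, Set.indicator_of_notMem hl, zero_mul, mul_zero]
      rw [e, integral_const_mul, h0, mul_zero]
    · simp only [k, g]
      simp [hv]
  simp_rw [hl, hr, integral_zero] at key
  rw [integral_indicator hL'.measurableSet, setIntegral_const, smul_eq_zero,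
    integral_indicator hK'.measurableSet] at key
  refine key.resolve_left (ENNReal.toReal_pos ?_ hL.measure_lt_top.ne).ne'
  exact (hL'.measure_pos μ ⟨0, L.zero_mem⟩).ne'

/-- `j` is the least index `≥ k` with `C M r^(2j) ≤ 1`. If `j = k`, the lower bound is the
hypothesis with `R = δ⁻¹`. Otherwise minimality gives `1 < C M r^(2(j-1))`, and `C r^(j-1) ≤ δ r` by
the choice of `k₀`. -/
theorem exists_pow_between {r C δ : ℝ} (hr : 0 < r) (hr1 : r < 1) (hC : 0 < C) (hδ : 0 < δ) :
    ∃ (R : ℝ) (k₀ : ℕ), ∀ k ≥ k₀, ∀ M : ℝ, R < M * r ^ k →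
      ∃ j ≥ k, C * M * (r ^ j) ^ 2 ≤ 1 ∧ 1 < δ * M * r ^ j := by
  obtain ⟨k₀, hk₀⟩ := exists_pow_lt_of_lt_one (show 0 < δ * r / C by positivity) hr1
  refine ⟨δ⁻¹, k₀, fun k hk M hM => ?_⟩
  have hMk : 0 < M * r ^ k := (inv_pos.2 hδ).trans hM
  have hM0 : 0 < M := pos_of_mul_pos_left hMk (by positivity)
  have hex : ∃ i, C * M * (r ^ (k + i)) ^ 2 ≤ 1 := by
    have h : Tendsto (fun i : ℕ => C * M * (r ^ (k + i)) ^ 2) atTop (𝓝 0) := by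
      have h1 : Tendsto (fun i : ℕ => r ^ (k + i)) atTop (𝓝 0) :=
        (tendsto_pow_atTop_nhds_zero_of_lt_one hr.le hr1).comp
          (tendsto_atTop_mono (fun i => Nat.le_add_left i k) tendsto_id)
      simpa using (h1.pow 2).const_mul (C * M)
    exact (h.eventually_le_const one_pos).exists
  classical
  refine ⟨k + Nat.find hex, Nat.le_add_right _ _, Nat.find_spec hex, ?_⟩
  rcases hn : Nat.find hex with _ | i
  · have := (inv_lt_iff_one_lt_mul₀ hδ).1 hM
    rw [add_zero]; linarith
  · have h1 : ¬ C * M * (r ^ (k + i)) ^ 2 ≤ 1 := Nat.find_min hex (by omega)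
    rw [not_le] at h1
    have h3 : r ^ (k + i) ≤ r ^ k₀ := pow_le_pow_of_le_one hr.le hr1.le (by omega)
    have h4 : C * r ^ (k + i) ≤ δ * r := by
      have := h3.trans hk₀.le
      rw [le_div_iff₀ hC] at this
      linarith
    have h5 : 0 < M * r ^ (k + i) := by positivity
    calc 1 < C * M * (r ^ (k + i)) ^ 2 := h1
      _ = (C * r ^ (k + i)) * (M * r ^ (k + i)) := by ring
      _ ≤ (δ * r) * (M * r ^ (k + i)) := mul_le_mul_of_nonneg_right h4 h5.le
      _ = δ * M * r ^ (k + (i + 1)) := by ring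

theorem exists_norm_quadraticForm_le (h2 : (2 : F) ≠ 0) (hϖ : IsUniformizer ϖ)
    (Q : QuadraticForm F V) :
    ∃ C : ℝ, 0 < C ∧ ∀ k, ∀ l ∈ lattice V ϖ k, ‖Q l‖ ≤ C * ‖ϖ ^ k‖ ^ 2 := by
  obtain ⟨C, hC⟩ := (isCompact_lattice (V := V) ϖ 0).exists_bound_of_continuousOn
    (continuous_quadraticForm h2 Q).continuousOn
  refine ⟨max C 1, by positivity, fun k l hl => ?_⟩
  obtain ⟨w, hw, rfl⟩ := (mem_lattice_iff_exists hϖ).1 hl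
  rw [QuadraticMap.map_smul, smul_eq_mul, norm_mul, norm_mul, mul_comm, sq]
  exact mul_le_mul_of_nonneg_right ((hC w hw).trans (le_max_left _ _)) (by positivity)

/-- The gradient `p.1 • v + p.2 • z` has no zero on the compact set of `v ∈ K₀` and unit vectors `p
∈ S`, so its norm has a positive minimum there; homogeneity in `p` does the rest. The submodule `S`
makes it possible to drop the linear term of the phase. -/
theorem exists_dualL_lower_bound (Q : QuadraticForm F V) (hQ : Q.polarBilin.Nondegenerate)
    {K₀ : Set V} (hK₀ : IsCompact K₀) (z : V) (S : Submodule F (F × F))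
    (hS : ∀ v ∈ K₀, ∀ p ∈ S, p.1 • v + p.2 • z = 0 → p = 0) :
    ∃ δ : ℝ, 0 < δ ∧ ∀ v ∈ K₀, ∀ p ∈ S, δ * ‖p‖ ≤ ‖dualL Q hQ (p.1 • v + p.2 • z)‖ := by
  have : ProperSpace F := ProperSpace.of_locallyCompactSpace F
  have hA : IsCompact (K₀ ×ˢ ((S : Set (F × F)) ∩ Metric.sphere 0 1)) :=
    hK₀.prod ((isCompact_sphere _ _).inter_left (Submodule.closed_of_finiteDimensional S))
  have hcont : Continuous fun q : V × (F × F) => ‖dualL Q hQ (q.2.1 • q.1 + q.2.2 • z)‖ := by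
    fun_prop
  have hpos : ∃ δ : ℝ, 0 < δ ∧ ∀ q ∈ K₀ ×ˢ ((S : Set (F × F)) ∩ Metric.sphere 0 1),
      δ ≤ ‖dualL Q hQ (q.2.1 • q.1 + q.2.2 • z)‖ := by
    rcases (K₀ ×ˢ ((S : Set (F × F)) ∩ Metric.sphere 0 1)).eq_empty_or_nonempty with h | h
    · exact ⟨1, one_pos, by simp [h]⟩
    · obtain ⟨q, hq, hmin⟩ := hA.exists_isMinOn h hcont.continuousOn
      refine ⟨_, norm_pos_iff.2 ?_, hmin⟩
      intro h0
      have h1 := hS q.1 hq.1 q.2 hq.2.1 ((dualL Q hQ).map_eq_zero_iff.1 h0)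
      have h2 := hq.2.2
      rw [h1] at h2
      simp at h2
  obtain ⟨δ, hδ, h⟩ := hpos
  refine ⟨δ, hδ, fun v hv p hp => ?_⟩
  rcases eq_or_ne p 0 with rfl | hp0
  · simp
  have hpn : 0 < ‖p‖ := norm_pos_iff.2 hp0
  -- The sup norm of `p` is the norm of one of its coordinates, so `p` can be rescaled to norm
  -- exactly `1`.
  obtain ⟨t, ht⟩ : ∃ t : F, ‖t‖ = ‖p‖ := by
    rcases max_choice ‖p.1‖ ‖p.2‖ with h | h
    · exact ⟨p.1, h.symm⟩
    · exact ⟨p.2, h.symm⟩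
  have ht0 : t ≠ 0 := norm_pos_iff.1 (ht ▸ hpn)
  have h1 := h (v, t⁻¹ • p) ⟨hv, S.smul_mem _ hp, by
    rw [mem_sphere_zero_iff_norm, norm_smul, norm_inv, ht, inv_mul_cancel₀ hpn.ne']⟩
  have h3 : (t⁻¹ • p).1 • v + (t⁻¹ • p).2 • z = t⁻¹ • (p.1 • v + p.2 • z) := by
    simp [smul_smul]
  simp only [h3, map_smul, norm_smul, norm_inv, ht] at h1
  rwa [← div_eq_inv_mul, le_div_iff₀ hpn] at h1

/-- The oscillatory integral of `ψ(bQ(v) + c⟨z, v⟩)` vanishes for large `(b, c)` if the phase has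
no critical points; the bound depends explicitly on the size of the neighbourhoods. -/
theorem exists_setIntegral_phase_eq_zero (h2 : (2 : F) ≠ 0) (hψ : Continuous ψ)
    (hϖ : IsUniformizer ϖ) (hcond : HasConductorIntegers ψ) (Q : QuadraticForm F V)
    (hQ : Q.polarBilin.Nondegenerate) {K₀ : Set V} (hK₀ : IsCompact K₀) (z : V)
    (S : Submodule F (F × F)) (hS : ∀ v ∈ K₀, ∀ p ∈ S, p.1 • v + p.2 • z = 0 → p = 0) :
    ∃ (R : ℝ) (k₀ : ℕ), ∀ k ≥ k₀, ∀ K ⊆ K₀, IsCompact K → IsOpen K →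
      (∀ v ∈ K, ∀ l ∈ lattice V ϖ k, v + l ∈ K) → ∀ p ∈ S, R < ‖p‖ * ‖ϖ‖ ^ k →
      ∫ v in K, (ψ (p.1 * Q v + p.2 * QuadraticMap.polar Q z v) : ℂ) ∂μ = 0 := by
  obtain ⟨C, hC, hCQ⟩ := exists_norm_quadraticForm_le h2 hϖ Q
  obtain ⟨δ, hδ, hδT⟩ := exists_dualL_lower_bound Q hQ hK₀ z S hS
  obtain ⟨R, k₀, h⟩ := exists_pow_between hϖ.norm_pos hϖ.1 hC hδ
  refine ⟨R, k₀, fun k hk K hKK hK hK' hKL p hp hR => ?_⟩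
  -- On the lattice of level `j` the quadratic part of the phase is already trivial, while the
  -- linear part still is not.
  obtain ⟨j, hj, hj1, hj2⟩ := h k hk _ hR
  have e : ∀ v, p.2 * QuadraticMap.polar Q z v = QuadraticMap.polar Q (p.2 • z) v := fun v => by
    rw [QuadraticMap.polar_smul_left, smul_eq_mul]
  simp_rw [e]
  refine setIntegral_phase_eq_zero μ h2 hψ Q (isCompact_lattice ϖ j)
    (isClopen_lattice hϖ j).isOpen hK hK' (fun v hv l hl => hKL v hv l (lattice_anti hϖ hj hl))
    ?_ ?_
  · intro l hl
    refine hcond.eq_one ?_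
    rw [norm_mul]
    refine le_trans (mul_le_mul (norm_fst_le p) (hCQ j l hl) (norm_nonneg _) (norm_nonneg _)) ?_
    rw [norm_pow]
    linarith
  · intro v hv
    have h1 : 1 < ‖dualL Q hQ (p.1 • v + p.2 • z)‖ * ‖ϖ ^ j‖ := by
      rw [norm_pow]
      exact hj2.trans_le (mul_le_mul_of_nonneg_right (hδT v (hKK hv) p hp) (by positivity))
    have h0 : 0 < ‖ϖ ^ j‖ := norm_pos_iff.2 (pow_ne_zero j hϖ.ne_zero)
    obtain ⟨i, hi⟩ : ∃ i, 1 < ‖dualL Q hQ (p.1 • v + p.2 • z) i * ϖ ^ j‖ := by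
      by_contra! hall
      refine absurd h1 (not_lt.2 ?_)
      rw [← le_div_iff₀ h0]
      refine (pi_norm_le_iff_of_nonneg (by positivity)).2 fun i => ?_
      rw [le_div_iff₀ h0, ← norm_mul]
      exact hall i
    obtain ⟨y, hy, hy'⟩ := hcond.exists_ne_one hi
    refine ⟨(ϖ ^ j * y) • Module.finBasis F V i,
      smul_mem_lattice (finBasis_mem_lattice i) ?_, ?_⟩
    · rw [norm_mul]
      exact mul_le_of_le_one_right (norm_nonneg _) hy
    · rw [QuadraticMap.polar_smul_right, smul_eq_mul, ← dualL_apply Q hQ]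
      rwa [mul_assoc, mul_comm] at hy'

end Lattice

/-! ### Scaling of Haar measure and invariance under isometries -/

/-- Uniqueness of Haar measure, applied to real and imaginary parts. Comparing only compactly
supported continuous functions avoids regularity assumptions. -/
theorem exists_integral_eq_mul {G : Type*} [TopologicalSpace G] [AddGroup G]
    [IsTopologicalAddGroup G] [MeasurableSpace G] [BorelSpace G] (μ' μ : Measure G)
    [μ.IsAddHaarMeasure] [μ'.IsAddHaarMeasure] :
    ∃ c : ℝ, 0 ≤ c ∧ ∀ f : G → ℂ, Continuous f → HasCompactSupport f →
      ∫ x, f x ∂μ' = c * ∫ x, f x ∂μ := by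
  refine ⟨Measure.addHaarScalarFactor μ' μ, NNReal.coe_nonneg _, fun f hf hf' => ?_⟩
  have key : ∀ g : G → ℝ, Continuous g → HasCompactSupport g →
      ∫ x, g x ∂μ' = (Measure.addHaarScalarFactor μ' μ : ℝ) * ∫ x, g x ∂μ := by
    intro g hg hg'
    rw [Measure.integral_isAddLeftInvariant_eq_smul_of_hasCompactSupport μ' μ hg hg',
      integral_smul_nnreal_measure, NNReal.smul_def, smul_eq_mul]
  have h1 := key (fun x => (f x).re) (Complex.continuous_re.comp hf)
    (hf'.comp_left (g := Complex.re) rfl)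
  have h2 := key (fun x => (f x).im) (Complex.continuous_im.comp hf)
    (hf'.comp_left (g := Complex.im) rfl)
  have e1 : ((∫ x, (f x).re ∂μ' : ℝ) : ℂ) + ((∫ x, (f x).im ∂μ' : ℝ) : ℂ) * Complex.I =
    ∫ x, f x ∂μ' := integral_re_add_im (hf.integrable_of_hasCompactSupport (μ := μ') hf')
  have e2 : ((∫ x, (f x).re ∂μ : ℝ) : ℂ) + ((∫ x, (f x).im ∂μ : ℝ) : ℂ) * Complex.I =
    ∫ x, f x ∂μ := integral_re_add_im (hf.integrable_of_hasCompactSupport (μ := μ) hf')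
  rw [← e1, ← e2, h1, h2]
  push_cast
  ring

/-! ### The normalised absolute value as a scaling factor of volumes -/

section AbsF

variable {F : Type*} [NontriviallyNormedField F] [LocallyCompactSpace F]

theorem absF_units (a : Fˣ) : absF (a : F) = (distribHaarChar F a : ℝ) := by
  simp [absF]

theorem absF_pos (a : Fˣ) : 0 < absF (a : F) := by
  rw [absF_units]
  exact_mod_cast distribHaarChar_pos

theorem absF_units_inv (a : Fˣ) : absF ((a⁻¹ : Fˣ) : F) = (absF (a : F))⁻¹ := by
  rw [absF_units, absF_units, map_inv, NNReal.coe_inv]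

theorem absF_units_mul (a b : Fˣ) : absF ((a * b : Fˣ) : F) = absF (a : F) * absF (b : F) := by
  simp only [absF_units, map_mul, NNReal.coe_mul]

theorem absF_units_pow (a : Fˣ) (n : ℕ) : absF ((a ^ n : Fˣ) : F) = absF (a : F) ^ n := by
  simp only [absF_units, map_pow, NNReal.coe_pow]

variable [MeasurableSpace F] [BorelSpace F]

open scoped Pointwise in
theorem map_smul_pi (μF : Measure F) [μF.IsAddHaarMeasure] (ι : Type*) [Fintype ι] (a : Fˣ) :
    (Measure.pi fun _ : ι => μF).map (fun x => (a : F) • x) =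
      (distribHaarChar F a⁻¹ ^ Fintype.card ι) • Measure.pi fun _ : ι => μF := by
  have : ProperSpace F := ProperSpace.of_locallyCompactSpace F
  set c := distribHaarChar F a⁻¹ with hc
  have hc0 : c ≠ 0 := distribHaarChar_pos.ne'
  have hm : Measurable fun x : ι → F => (a : F) • x := (continuous_const_smul _).measurable
  have h : Measure.pi (fun _ : ι => μF) =
      (c ^ Fintype.card ι)⁻¹ • (Measure.pi fun _ : ι => μF).map (fun x => (a : F) • x) := by
    -- On boxes each coordinate contributes one factor; it belongs to `a⁻¹` because the push-forward
    -- measures the preimage `a⁻¹ • s`.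
    refine Measure.pi_eq fun s hs => ?_
    rw [Measure.smul_apply, Measure.map_apply hm (MeasurableSet.univ_pi hs)]
    have e : (fun x : ι → F => (a : F) • x) ⁻¹' Set.univ.pi s =
        Set.univ.pi fun i => a⁻¹ • s i := by
      ext x
      simp only [Set.mem_preimage, Set.mem_univ_pi, Pi.smul_apply]
      refine forall_congr' fun i => ?_
      rw [Set.mem_inv_smul_set_iff, Units.smul_def]
    rw [e, Measure.pi_pi]
    simp_rw [← distribHaarChar_mul μF a⁻¹]
    rw [Finset.prod_mul_distrib, ← hc, Finset.prod_const, Finset.card_univ, ENNReal.smul_def,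
      smul_eq_mul, ← mul_assoc, ← ENNReal.coe_pow, ← ENNReal.coe_mul,
      inv_mul_cancel₀ (pow_ne_zero _ hc0), ENNReal.coe_one, one_mul]
  conv_rhs => rw [h]
  rw [smul_smul, mul_inv_cancel₀ (pow_ne_zero _ hc0), one_smul]

variable {V : Type*} [AddCommGroup V] [Module F V] [FiniteDimensional F V] [TopologicalSpace V]
  [IsTopologicalAddGroup V] [ContinuousSMul F V] [T2Space V] [MeasurableSpace V] [BorelSpace V]

/-- In coordinates the Haar measure is a multiple of a product measure, and the unknown multiple
occurs on both sides. -/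
theorem integral_comp_units_smul (μ : Measure V) [μ.IsAddHaarMeasure] (a : Fˣ) {f : V → ℂ}
    (hf : Continuous f) (hf' : HasCompactSupport f) :
    ∫ v, f ((a : F) • v) ∂μ =
      (((absF (a : F) ^ Module.finrank F V)⁻¹ : ℝ) : ℂ) * ∫ v, f v ∂μ := by
  have : ProperSpace F := ProperSpace.of_locallyCompactSpace F
  let μF : Measure F := Measure.addHaar
  let ν : Measure (Fin (Module.finrank F V) → F) := Measure.pi fun _ => μF
  let E := (coordL F V).symm
  have hν : (ν.map E).IsAddHaarMeasure := E.isAddHaarMeasure_map ν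
  obtain ⟨c, -, hc⟩ := exists_integral_eq_mul μ (ν.map E)
  have hE : ∀ g : V → ℂ, ∫ v, g v ∂(ν.map E) = ∫ x, g (E x) ∂ν := fun g =>
    E.toHomeomorph.measurableEmbedding.integral_map g
  have hfa : Continuous fun v => f ((a : F) • v) := hf.comp (continuous_const_smul _)
  have hfa' : HasCompactSupport fun v => f ((a : F) • v) :=
    hf'.comp_homeomorph (Homeomorph.smulOfNeZero (a : F) a.ne_zero)
  rw [hc f hf hf', hc _ hfa hfa', hE, hE]
  have h1 : ∫ x, f (E ((a : F) • x)) ∂ν = ∫ x, f (E x) ∂(ν.map fun x => (a : F) • x) :=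
    ((Homeomorph.smulOfNeZero (a : F) a.ne_zero).measurableEmbedding.integral_map
      fun x => f (E x)).symm
  simp_rw [map_smul] at h1
  rw [h1, map_smul_pi, integral_smul_nnreal_measure, NNReal.smul_def, Fintype.card_fin,
    Complex.real_smul, NNReal.coe_pow, map_inv, NNReal.coe_inv, ← absF_units, inv_pow]
  ring

variable [IsUltrametricDist F] {ϖ : F}

theorem indicator_idealP_smul (hϖ : IsUniformizer ϖ) (k : ℕ) (y : F) :
    (idealP ϖ 0).indicator (fun _ => (1 : ℂ)) ((ϖ ^ k)⁻¹ • y) =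
      (idealP ϖ k).indicator (fun _ => 1) y := by
  have h0 : 0 < ‖ϖ ^ k‖ := norm_pos_iff.2 (pow_ne_zero k hϖ.ne_zero)
  have h : (ϖ ^ k)⁻¹ • y ∈ idealP ϖ 0 ↔ y ∈ idealP ϖ k := by
    simp only [idealP, Set.mem_ofPred_eq]
    rw [norm_smul, norm_inv, pow_zero, norm_one, ← div_eq_inv_mul, div_le_one h0]
  by_cases hy : y ∈ idealP ϖ k
  · rw [Set.indicator_of_mem hy, Set.indicator_of_mem (h.2 hy)]
  · rw [Set.indicator_of_notMem hy, Set.indicator_of_notMem (fun h' => hy (h.1 h'))]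

theorem isCompact_idealP (ϖ : F) (n : ℕ) : IsCompact (idealP ϖ n) := by
  simpa [idealPCoset] using isCompact_idealPCoset ϖ n 0

theorem real_idealP_eq (hϖ : IsUniformizer ϖ) (μF : Measure F) [μF.IsAddHaarMeasure] (k : ℕ) :
    μF.real (idealP ϖ k) = absF ϖ ^ k * μF.real (idealP ϖ 0) := by
  let a : Fˣ := (Units.mk0 ϖ hϖ.ne_zero ^ k)⁻¹
  have hS := SchwartzBruhat.indicator_mem (isCompact_idealP ϖ 0) (isClopen_idealP hϖ 0).isOpen 1
  have h := integral_comp_units_smul μF a hS.1.continuous hS.2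
  have e : (a : F) = (ϖ ^ k)⁻¹ := by simp [a]
  rw [absF_units_inv, absF_units_pow, Units.val_mk0, e] at h
  simp_rw [indicator_idealP_smul hϖ] at h
  rw [integral_indicator (isClopen_idealP hϖ k).isOpen.measurableSet,
    integral_indicator (isClopen_idealP hϖ 0).isOpen.measurableSet] at h
  simp only [integral_const, measureReal_restrict_apply_univ, Complex.real_smul, mul_one,
    Module.finrank_self, pow_one, inv_inv] at h
  exact_mod_cast h

theorem absF_uniformizer_pos (hϖ : IsUniformizer ϖ) : 0 < absF ϖ :=
  absF_pos (Units.mk0 ϖ hϖ.ne_zero)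

/-- `ϖ𝒪` and `1 + ϖ𝒪` are disjoint subsets of `𝒪` of equal volume, so `2|ϖ| ≤ 1`. -/
theorem absF_uniformizer_lt_one (hϖ : IsUniformizer ϖ) : absF ϖ < 1 := by
  let μF : Measure F := Measure.addHaar
  have h0 := real_idealP_pos μF hϖ 0
  have h1 := real_idealP_pos μF hϖ 1
  have h := real_idealP_eq hϖ μF 1
  have hdisj : Disjoint (idealP ϖ 1) (idealPCoset ϖ 1 1) := by
    rw [Set.disjoint_left]
    intro x hx hx'
    have h2 : (1 : F) ∈ idealP ϖ 1 := by
      have := add_mem_idealP hx (y := -(x - 1)) (by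
        rw [idealP, Set.mem_ofPred_eq, norm_neg]; exact hx')
      simpa using this
    simp only [idealP, Set.mem_ofPred_eq, norm_one, pow_one] at h2
    exact absurd hϖ.1 (not_lt.2 h2)
  have hsub : idealP ϖ 1 ∪ idealPCoset ϖ 1 1 ⊆ idealP ϖ 0 := by
    have hanti := idealP_anti hϖ (Nat.zero_le 1)
    refine Set.union_subset hanti fun x hx => ?_
    have h1 : (1 : F) ∈ idealP ϖ 0 := by simp [idealP]
    simpa using add_mem_idealP (hanti hx) h1
  have h3 := measureReal_union (μ := μF) hdisj
    (isClopen_idealPCoset hϖ 1 1).isOpen.measurableSet (isCompact_idealP ϖ 1).measure_lt_top.ne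
    (isCompact_idealPCoset ϖ 1 1).measure_lt_top.ne
  have h4 := measureReal_mono (μ := μF) hsub (isCompact_idealP ϖ 0).measure_lt_top.ne
  rw [h3, real_idealPCoset] at h4
  rw [pow_one] at h
  nlinarith

theorem absF_eq_one_of_norm (hϖ : IsUniformizer ϖ) {u : Fˣ} (hu : ‖(u : F)‖ = 1) :
    absF (u : F) = 1 := by
  let μF : Measure F := Measure.addHaar
  have hS := SchwartzBruhat.indicator_mem (isCompact_idealP ϖ 0) (isClopen_idealP hϖ 0).isOpen 1
  have h := integral_comp_units_smul μF u hS.1.continuous hS.2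
  have e : ∀ v : F, (idealP ϖ 0).indicator (fun _ => (1 : ℂ)) ((u : F) • v) =
      (idealP ϖ 0).indicator (fun _ => (1 : ℂ)) v := by
    intro v
    have : (u : F) • v ∈ idealP ϖ 0 ↔ v ∈ idealP ϖ 0 := by
      simp [idealP, norm_mul, hu]
    by_cases hv : v ∈ idealP ϖ 0
    · rw [Set.indicator_of_mem hv, Set.indicator_of_mem (this.2 hv)]
    · rw [Set.indicator_of_notMem hv, Set.indicator_of_notMem (fun h' => hv (this.1 h'))]
  simp_rw [e] at h
  rw [integral_indicator (isClopen_idealP hϖ 0).isOpen.measurableSet] at h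
  simp only [integral_const, measureReal_restrict_apply_univ, Complex.real_smul, mul_one,
    Module.finrank_self, pow_one] at h
  have h' : μF.real (idealP ϖ 0) = (absF (u : F))⁻¹ * μF.real (idealP ϖ 0) := by exact_mod_cast h
  have h0 := real_idealP_pos μF hϖ 0
  have h1 : (absF (u : F))⁻¹ = 1 := mul_right_cancel₀ h0.ne' (by rw [← h', one_mul])
  exact inv_eq_one.1 h1

/-- For `b` near `a` the quotient `b / a` has norm `1`, and such an element maps `𝒪` onto itself. -/
theorem eventually_absF_eq (hϖ : IsUniformizer ϖ) (a : Fˣ) :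
    ∀ᶠ b : Fˣ in 𝓝 a, absF (b : F) = absF (a : F) := by
  have h : Continuous fun b : Fˣ => ((b * a⁻¹ : Fˣ) : F) :=
    Units.continuous_val.comp (continuous_mul_const a⁻¹)
  have h1 : Metric.ball (1 : F) 1 ∈ 𝓝 ((a * a⁻¹ : Fˣ) : F) := by
    rw [mul_inv_cancel, Units.val_one]
    exact Metric.ball_mem_nhds _ one_pos
  filter_upwards [h.continuousAt.preimage_mem_nhds h1] with b hb
  have h2 : ‖((b * a⁻¹ : Fˣ) : F)‖ = 1 := by
    rw [Set.mem_preimage, Metric.mem_ball, dist_eq_norm] at hb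
    have := IsUltrametricDist.norm_add_eq_max_of_norm_ne_norm
      (x := ((b * a⁻¹ : Fˣ) : F) - 1) (y := 1) (by rw [norm_one]; exact hb.ne)
    rw [sub_add_cancel, norm_one, max_eq_right hb.le] at this
    exact this
  have h3 := absF_eq_one_of_norm hϖ h2
  have h4 := absF_units_mul (b * a⁻¹) a
  rw [inv_mul_cancel_right, h3, one_mul] at h4
  exact h4

theorem real_lattice_eq (hϖ : IsUniformizer ϖ) (μ : Measure V) [μ.IsAddHaarMeasure] (k : ℕ) :
    μ.real (lattice V ϖ k : Set V) =
      (absF ϖ ^ k) ^ Module.finrank F V * μ.real (lattice V ϖ 0 : Set V) := by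
  let a : Fˣ := (Units.mk0 ϖ hϖ.ne_zero ^ k)⁻¹
  have hS := SchwartzBruhat.indicator_mem (isCompact_lattice (V := V) ϖ 0)
    (isClopen_lattice hϖ 0).isOpen 1
  have h := integral_comp_units_smul μ a hS.1.continuous hS.2
  have e : (a : F) = (ϖ ^ k)⁻¹ := by simp [a]
  have h0 : ϖ ^ k ≠ 0 := pow_ne_zero k hϖ.ne_zero
  have e2 : ∀ v : V, (lattice V ϖ 0 : Set V).indicator (fun _ => (1 : ℂ)) ((ϖ ^ k)⁻¹ • v) =
      (lattice V ϖ k : Set V).indicator (fun _ => 1) v := by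
    intro v
    have h : (ϖ ^ k)⁻¹ • v ∈ (lattice V ϖ 0 : Set V) ↔ v ∈ (lattice V ϖ k : Set V) := by
      constructor
      · intro h
        exact (mem_lattice_iff_exists hϖ).2 ⟨_, h, (smul_inv_smul₀ h0 v).symm⟩
      · intro h
        obtain ⟨w, hw, rfl⟩ := (mem_lattice_iff_exists hϖ).1 h
        rwa [inv_smul_smul₀ h0]
    by_cases hv : v ∈ (lattice V ϖ k : Set V)
    · rw [Set.indicator_of_mem hv, Set.indicator_of_mem (h.2 hv)]
    · rw [Set.indicator_of_notMem hv, Set.indicator_of_notMem (fun h' => hv (h.1 h'))]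
  rw [absF_units_inv, absF_units_pow, Units.val_mk0, e] at h
  simp_rw [e2] at h
  rw [integral_indicator (isClopen_lattice hϖ k).isOpen.measurableSet,
    integral_indicator (isClopen_lattice hϖ 0).isOpen.measurableSet] at h
  simp only [integral_const, measureReal_restrict_apply_univ, Complex.real_smul, mul_one,
    inv_pow, inv_inv] at h
  exact_mod_cast h

/-- The numerator scales like `|ϖ|^(k dim V)` and the denominator like `|ϖ|^k`, so the ratio decays
once `dim V ≥ 2`. -/
theorem tendsto_real_lattice_div (hϖ : IsUniformizer ϖ) (μ : Measure V) [μ.IsAddHaarMeasure]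
    (μF : Measure F) [μF.IsAddHaarMeasure] (hdim : 2 ≤ Module.finrank F V) (k₁ : ℕ) :
    Tendsto (fun k => μ.real (lattice V ϖ k : Set V) / μF.real (idealP ϖ (k + k₁))) atTop
      (𝓝 0) := by
  have hα := absF_uniformizer_pos hϖ
  have h0 := real_idealP_pos μF hϖ 0
  obtain ⟨m, hm⟩ := Nat.exists_eq_add_of_le hdim
  set C := μ.real (lattice V ϖ 0 : Set V) / (absF ϖ ^ k₁ * μF.real (idealP ϖ 0)) with hC
  have hb : ∀ k, μ.real (lattice V ϖ k : Set V) / μF.real (idealP ϖ (k + k₁)) =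
      C * (absF ϖ ^ k) ^ (m + 1) := by
    intro k
    rw [real_lattice_eq hϖ, real_idealP_eq hϖ μF (k + k₁), hm, hC]
    field_simp
    ring
  simp_rw [hb]
  have h1 : Tendsto (fun k => absF ϖ ^ k) atTop (𝓝 0) :=
    tendsto_pow_atTop_nhds_zero_of_lt_one hα.le (absF_uniformizer_lt_one hϖ)
  simpa using (h1.pow (m + 1)).const_mul C

/-! ### Isometries and the self-dual measure -/

variable {ψ : AddChar F Circle} (μ : Measure V) [μ.IsAddHaarMeasure]

/-- The transform is carried by the dual lattice. It provides one test function whose Fourier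
transform is visibly in `S(V)`. -/
theorem fourier_indicator_lattice (hϖ : IsUniformizer ϖ) (hcond : HasConductorIntegers ψ)
    (Q : QuadraticForm F V) (hQ : Q.polarBilin.Nondegenerate) (x : V) :
    fourier ψ (QuadraticMap.polar Q) μ ((lattice V ϖ 0 : Set V).indicator fun _ => 1) x =
      (dualL Q hQ ⁻¹' Metric.closedBall 0 1).indicator
        (fun _ => (μ.real (lattice V ϖ 0 : Set V) : ℂ)) x := by
  have hL := (isClopen_lattice (V := V) hϖ 0).isOpen.measurableSet
  have e : fourier ψ (QuadraticMap.polar Q) μ ((lattice V ϖ 0 : Set V).indicator fun _ => 1) x =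
      ∫ y in (lattice V ϖ 0 : Set V), (ψ (QuadraticMap.polar Q x y) : ℂ) ∂μ := by
    rw [fourier, ← integral_indicator hL]
    refine integral_congr_ae (Eventually.of_forall fun y => ?_)
    by_cases hy : y ∈ (lattice V ϖ 0 : Set V)
    · simp only [Set.indicator_of_mem hy, one_mul]
    · simp only [Set.indicator_of_notMem hy, zero_mul]
  rw [e]
  by_cases hx : x ∈ dualL Q hQ ⁻¹' Metric.closedBall 0 1
  · rw [Set.indicator_of_mem hx]
    have h1 : ∀ y ∈ (lattice V ϖ 0 : Set V), (ψ (QuadraticMap.polar Q x y) : ℂ) = 1 := by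
      intro y hy
      rw [hcond.eq_one, Circle.coe_one]
      have hsum : QuadraticMap.polar Q x y =
          ∑ i, coordL F V y i * dualL Q hQ x i := by
        have h : Q.polarBilin x y = Q.polarBilin x (∑ i, (Module.finBasis F V).repr y i •
            Module.finBasis F V i) := by rw [(Module.finBasis F V).sum_repr]
        simp only [map_sum, map_smul, smul_eq_mul] at h
        exact h
      rw [hsum]
      refine IsUltrametricDist.norm_sum_le_of_forall_le_of_nonneg zero_le_one fun i _ => ?_
      rw [norm_mul]
      have h1 : ‖coordL F V y i‖ ≤ 1 := (norm_le_pi_norm _ i).trans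
        (by simpa using mem_lattice.1 hy)
      have h2 : ‖dualL Q hQ x i‖ ≤ 1 := (norm_le_pi_norm _ i).trans (by simpa using hx)
      exact mul_le_one₀ h1 (norm_nonneg _) h2
    rw [setIntegral_congr_fun hL h1]
    simp
  · rw [Set.indicator_of_notMem hx]
    obtain ⟨i, hi⟩ : ∃ i, 1 < ‖dualL Q hQ x i‖ := by
      by_contra! h
      refine hx ?_
      rw [Set.mem_preimage, mem_closedBall_zero_iff]
      exact (pi_norm_le_iff_of_nonneg zero_le_one).2 h
    obtain ⟨y, hy, hy'⟩ := hcond.exists_ne_one hi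
    refine integral_character_eq_zero μ (l := y • Module.finBasis F V i) hL ?_
      (smul_mem_lattice (finBasis_mem_lattice i) (by simpa using hy)) ?_
    · intro a _ b _
      rw [QuadraticMap.polar_add_right, AddChar.map_add_eq_mul, Circle.coe_mul]
    · rw [← Circle.coe_one, Ne, Circle.coe_inj, QuadraticMap.polar_smul_right, smul_eq_mul,
        ← dualL_apply Q hQ, mul_comm]
      exact hy'

/-- Isometries as homeomorphisms. -/
noncomputable def isometryHomeomorph {Q : QuadraticForm F V} (h : Q.IsometryEquiv Q) : V ≃ₜ V :=
  haveI : ProperSpace F := ProperSpace.of_locallyCompactSpace F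
  h.toLinearEquiv.toContinuousLinearEquiv.toHomeomorph

theorem isometryHomeomorph_apply {Q : QuadraticForm F V} (h : Q.IsometryEquiv Q) (v : V) :
    isometryHomeomorph h v = h v := rfl

theorem isometry_polar {Q : QuadraticForm F V} (h : Q.IsometryEquiv Q) (x y : V) :
    QuadraticMap.polar Q (h x) (h y) = QuadraticMap.polar Q x y := by
  have e : h x + h y = h (x + y) := (h.toLinearEquiv.map_add x y).symm
  simp only [QuadraticMap.polar, e, h.map_app]

/-- By uniqueness of Haar measure `h` scales integrals by some `c ≥ 0`. The Fourier transform of `f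
∘ h` is then `c` times that of `f`, composed with `h`; doing this twice and using Fourier inversion
forces `c² = 1`. -/
theorem integral_isometry (hψ : Continuous ψ) (hϖ : IsUniformizer ϖ)
    (hcond : HasConductorIntegers ψ)
    {Q : QuadraticForm F V} (hQ : Q.polarBilin.Nondegenerate)
    (hμ : IsSelfDual ψ (QuadraticMap.polar Q) μ) (h : Q.IsometryEquiv Q) {f : V → ℂ}
    (hf : Continuous f) (hf' : HasCompactSupport f) : ∫ v, f (h v) ∂μ = ∫ v, f v ∂μ := by
  have : ProperSpace F := ProperSpace.of_locallyCompactSpace F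
  have hH : (μ.map h.toLinearEquiv.toContinuousLinearEquiv).IsAddHaarMeasure :=
    h.toLinearEquiv.toContinuousLinearEquiv.isAddHaarMeasure_map μ
  obtain ⟨c, hc0, hc⟩ := exists_integral_eq_mul (μ.map h.toLinearEquiv.toContinuousLinearEquiv) μ
  have hc' : ∀ f : V → ℂ, Continuous f → HasCompactSupport f →
      ∫ v, f (h v) ∂μ = c * ∫ v, f v ∂μ := by
    intro f hf hf'
    rw [← hc f hf hf']
    exact ((isometryHomeomorph h).measurableEmbedding.integral_map f).symm
  let f₀ : V → ℂ := (lattice V ϖ 0 : Set V).indicator fun _ => 1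
  have hf₀ : f₀ ∈ SchwartzBruhat V :=
    SchwartzBruhat.indicator_mem (isCompact_lattice ϖ 0) (isClopen_lattice hϖ 0).isOpen 1
  have hcomp : ∀ (g : V → ℂ), Continuous g → HasCompactSupport g → ∀ x,
      fourier ψ (QuadraticMap.polar Q) μ (fun v => g (h v)) x =
        c * fourier ψ (QuadraticMap.polar Q) μ g (h x) := by
    intro g hg hg' x
    have h1 := hc' (fun v => g v * (ψ (QuadraticMap.polar Q (h x) v) : ℂ))
      (hg.mul (continuous_coe_comp hψ (continuous_polar Q (h x)))) hg'.mul_right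
    simp_rw [isometry_polar h] at h1
    exact h1
  have hhat : fourier ψ (QuadraticMap.polar Q) μ f₀ =
      (dualL Q hQ ⁻¹' Metric.closedBall 0 1).indicator
        (fun _ => (μ.real (lattice V ϖ 0 : Set V) : ℂ)) :=
    funext fun x => fourier_indicator_lattice μ hϖ hcond Q hQ x
  have hhatS : fourier ψ (QuadraticMap.polar Q) μ f₀ ∈ SchwartzBruhat V := by
    rw [hhat]
    exact SchwartzBruhat.indicator_mem
      ((dualL Q hQ).toHomeomorph.isCompact_preimage.2 (isCompact_closedBall _ _))
      ((IsUltrametricDist.isClopen_closedBall _ one_ne_zero).isOpen.preimage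
        (dualL Q hQ).continuous) _
  -- Inversion at `0` for `f₀ ∘ h` and for `f₀`, both of which take the value `1` there.
  have h1 := hμ _ (SchwartzBruhat.comp_homeomorph hf₀ (isometryHomeomorph h)) 0
  have h2 := hμ _ hf₀ 0
  have e1 : fourier ψ (QuadraticMap.polar Q) μ (fun y => f₀ (isometryHomeomorph h y)) =
      fun x => c * fourier ψ (QuadraticMap.polar Q) μ f₀ (h x) :=
    funext fun x => hcomp f₀ hf₀.1.continuous hf₀.2 x
  have hh0 : h 0 = 0 := h.toLinearEquiv.map_zero
  have e2 : fourier ψ (QuadraticMap.polar Q) μ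
      (fun x => c * fourier ψ (QuadraticMap.polar Q) μ f₀ (h x)) 0 = c * (c *
        fourier ψ (QuadraticMap.polar Q) μ (fourier ψ (QuadraticMap.polar Q) μ f₀) 0) := by
    have := hcomp _ hhatS.1.continuous hhatS.2 0
    rw [hh0] at this
    rw [← this]
    simp only [fourier, mul_assoc, integral_const_mul]
  have hf01 : f₀ 0 = 1 := Set.indicator_of_mem (lattice V ϖ 0).zero_mem _
  rw [e1, e2, h2, neg_zero, isometryHomeomorph_apply, hh0, hf01, mul_one] at h1
  have h3 : c * c = 1 := by exact_mod_cast h1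
  have h4 : c = 1 := by nlinarith
  rw [hc' f hf hf', h4, Complex.ofReal_one, one_mul]

end AbsF

/-- Used to descend maps from `S(V)` to either space of coinvariants. -/
theorem exists_linearMap_comp_eq {R M N L : Type*} [Ring R] [AddCommGroup M] [AddCommGroup N]
    [AddCommGroup L] [Module R M] [Module R N] [Module R L] {p : M →ₗ[R] N}
    (hp : Function.Surjective p) (T : M →ₗ[R] L) (h : LinearMap.ker p ≤ LinearMap.ker T) :
    ∃ J : N →ₗ[R] L, ∀ x, J (p x) = T x := by
  refine ⟨(Submodule.liftQ _ T h) ∘ₗ (p.quotKerEquivOfSurjective hp).symm.toLinearMap,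
    fun x => ?_⟩
  have e : (p.quotKerEquivOfSurjective hp).symm (p x) = Submodule.Quotient.mk x := by
    rw [LinearEquiv.symm_apply_eq]; rfl
  rw [LinearMap.comp_apply, LinearEquiv.coe_coe, e, Submodule.liftQ_apply]

/-! ### The transfer map -/

section TransferMap

variable {F : Type*} [NontriviallyNormedField F] [LocallyCompactSpace F]
variable {V : Type*} [AddCommGroup V] [Module F V] [FiniteDimensional F V] [TopologicalSpace V]
  [IsTopologicalAddGroup V] [ContinuousSMul F V] [T2Space V]
  {ψ : AddChar F Circle} {Q : QuadraticForm F V}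

theorem weilN_weilN (b c : F) (Φ : V → ℂ) :
    weilN ψ Q b (weilN ψ Q c Φ) = weilN ψ Q (b + c) Φ := by
  funext v
  simp only [weilN]
  rw [add_mul, AddChar.map_add_eq_mul, Circle.coe_mul, mul_assoc]

/-- Right multiplication by `n(b)` keeps the first column of `g` and adds `b` to the last parameter
of the Bruhat formula. No other case of multiplicativity of the Weil representation is needed. -/
theorem weil_weilN [MeasurableSpace V] (μ : Measure V) (g : SL(2, F)) (b : F) (Φ : V → ℂ) :
    weil ψ Q μ g (weilN ψ Q b Φ) = weil ψ Q μ (g * nMat b) Φ := by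
  have e00 : (g * nMat b) 0 0 = g 0 0 := by
    rw [Matrix.SpecialLinearGroup.coe_mul, Matrix.mul_apply, Fin.sum_univ_two]; simp [nMat]
  have e01 : (g * nMat b) 0 1 = g 0 0 * b + g 0 1 := by
    rw [Matrix.SpecialLinearGroup.coe_mul, Matrix.mul_apply, Fin.sum_univ_two]; simp [nMat]
  have e10 : (g * nMat b) 1 0 = g 1 0 := by
    rw [Matrix.SpecialLinearGroup.coe_mul, Matrix.mul_apply, Fin.sum_univ_two]; simp [nMat]
  have e11 : (g * nMat b) 1 1 = g 1 0 * b + g 1 1 := by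
    rw [Matrix.SpecialLinearGroup.coe_mul, Matrix.mul_apply, Fin.sum_univ_two]; simp [nMat]
  unfold weil
  rw [e00, e01, e10, e11]
  by_cases h : g 1 0 = 0
  · have hdet := g.det_coe
    rw [Matrix.det_fin_two, h, mul_zero, sub_zero] at hdet
    have h0 : g 0 0 ≠ 0 := left_ne_zero_of_mul (hdet ▸ one_ne_zero)
    rw [if_pos h, if_pos h, weilN_weilN]
    congr 2
    field_simp
    ring
  · rw [if_neg h, if_neg h, weilN_weilN]
    congr 4
    field_simp
    ring

theorem weilN_mem [IsUltrametricDist F] (hcond : HasConductorIntegers ψ) (h2 : (2 : F) ≠ 0)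
    (b : F) {Φ : V → ℂ} (hΦ : Φ ∈ SchwartzBruhat V) : weilN ψ Q b Φ ∈ SchwartzBruhat V := by
  borelize V
  have h := SchwartzBruhat.mul_mem hΦ (hcond.isLocallyConstant.comp_continuous
    (continuous_const.mul (continuous_quadraticForm h2 Q) : Continuous fun v => b * Q v))
  convert h using 1
  funext v
  simp [weilN, mul_comm]

theorem weilT_mem {a : F} (ha : a ≠ 0) {Φ : V → ℂ} (hΦ : Φ ∈ SchwartzBruhat V) :
    weilT Q a Φ ∈ SchwartzBruhat V :=
  Submodule.smul_mem _ _ (SchwartzBruhat.comp_homeomorph hΦ (Homeomorph.smulOfNeZero a ha))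

variable [MeasurableSpace V] [BorelSpace V] [IsUltrametricDist F] [MeasurableSpace F]
  [BorelSpace F] (μ : Measure V) [μ.IsAddHaarMeasure] {ϖ : F}

/-- Isometries preserve `Q`, the pairing and, by `integral_isometry`, the measure, so they commute
with each factor of the Bruhat formula. -/
theorem weil_comp_isometry (h2 : (2 : F) ≠ 0) (hψ : Continuous ψ) (hϖ : IsUniformizer ϖ)
    (hcond : HasConductorIntegers ψ) (hQ : Q.polarBilin.Nondegenerate)
    (hμ : IsSelfDual ψ (QuadraticMap.polar Q) μ) (h : Q.IsometryEquiv Q) {Φ : V → ℂ}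
    (hΦ : Φ ∈ SchwartzBruhat V) (g : SL(2, F)) (v : V) :
    weil ψ Q μ g (fun x => Φ (h x)) v = weil ψ Q μ g Φ (h v) := by
  have hN : ∀ (b : F) (f : V → ℂ), weilN ψ Q b (fun x => f (h x)) = fun x => weilN ψ Q b f (h x) :=
    fun b f => funext fun x => by simp only [weilN, h.map_app]
  have hT : ∀ (a : F) (f : V → ℂ), weilT Q a (fun x => f (h x)) = fun x => weilT Q a f (h x) :=
    fun a f => funext fun x => by
      have : h (a • x) = a • h x := h.toLinearEquiv.map_smul a x
      simp only [weilT, this]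
  unfold weil
  split_ifs with h0
  · rw [hN, hT]
  · have hS := weilT_mem (Q := Q) (neg_ne_zero.2 h0)
      (weilN_mem (Q := Q) hcond h2 (g 1 1 / g 1 0) hΦ)
    rw [hN, hT]
    generalize weilT Q (-(g 1 0)) (weilN ψ Q (g 1 1 / g 1 0) Φ) = f at hS
    simp only [weilN, weilW, fourier, h.map_app]
    have key := integral_isometry μ hψ hϖ hcond hQ hμ h
      (f := fun y => f y * (ψ (QuadraticMap.polar Q (h v) y) : ℂ))
      (hS.1.continuous.mul (continuous_coe_comp hψ (continuous_polar Q _))) hS.2.mul_right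
    simp_rw [isometry_polar h] at key
    rw [key]

/-- The map `p` as a linear map onto `S(N, ψ \ SL₂)`. -/
noncomputable def pLinear (h2 : (2 : F) ≠ 0) (hψ : Continuous ψ) (Q : QuadraticForm F V)
    (μ : Measure V) [IsFiniteMeasureOnCompacts μ] (v₁ : V) :
    SchwartzBruhat V →ₗ[ℂ] whittakerSpace ψ Q μ v₁ where
  toFun Φ := ⟨pMap ψ Q μ v₁ Φ.1, Submodule.subset_span ⟨Φ.1, Φ.2, rfl⟩⟩
  map_add' Φ Φ' := Subtype.ext (funext fun g => weil_add h2 hψ Q μ Φ.2 Φ'.2 g v₁)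
  map_smul' c Φ := Subtype.ext (funext fun g => weil_smul ψ Q μ c Φ.1 g v₁)

theorem pLinear_surjective (h2 : (2 : F) ≠ 0) (hψ : Continuous ψ) (v₁ : V) :
    Function.Surjective (pLinear h2 hψ Q μ v₁) := by
  rintro ⟨f, hf⟩
  obtain ⟨Φ, hΦ, rfl⟩ := (mem_whittakerSpace_iff h2 hψ Q μ v₁ f).1 hf
  exact ⟨⟨Φ, hΦ⟩, rfl⟩

/-- The class of `p(Φ)` in `I(N, ψ \ SL₂)`. -/
noncomputable def pClass (h2 : (2 : F) ≠ 0) (hψ : Continuous ψ) (Q : QuadraticForm F V)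
    (μ : Measure V) [IsFiniteMeasureOnCompacts μ] (v₁ : V) :
    SchwartzBruhat V →ₗ[ℂ] OrbitalN ψ Q μ v₁ :=
  (relN ψ Q μ v₁).mkQ ∘ₗ pLinear h2 hψ Q μ v₁

theorem isClosed_hyperboloid (h2 : (2 : F) ≠ 0) (Q : QuadraticForm F V) (a : F) :
    IsClosed {v | Q v = a} :=
  isClosed_eq (continuous_quadraticForm h2 Q) continuous_const

/-- Restriction `S(V) → S(X₁)`. -/
def resX (h2 : (2 : F) ≠ 0) (Q : QuadraticForm F V) (a : F) :
    SchwartzBruhat V →ₗ[ℂ] SchwartzBruhat (Hyperboloid Q a) where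
  toFun Φ := ⟨fun x => Φ.1 x.1, SchwartzBruhat.comp_subtype Φ.2 (isClosed_hyperboloid h2 Q a)⟩
  map_add' _ _ := rfl
  map_smul' _ _ := rfl

theorem resX_surjective (hϖ : IsUniformizer ϖ) (h2 : (2 : F) ≠ 0) (Q : QuadraticForm F V) (a : F) :
    Function.Surjective (resX h2 Q a) := by
  rintro ⟨φ, hφ⟩
  obtain ⟨Φ, hΦ, h⟩ := SchwartzBruhat.exists_extension (hasCompactOpenBasis_module hϖ) hφ
  exact ⟨⟨Φ, hΦ⟩, Subtype.ext (funext h)⟩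

/-- `n(b)` multiplies functions on `V` by `ψ(b Q(v))` but acts on coinvariants by `ψ(b)`; this
conflict kills whatever lives off `X₁`. -/
theorem pClass_weilN (h2 : (2 : F) ≠ 0) (hψ : Continuous ψ) (hcond : HasConductorIntegers ψ)
    (v₁ : V) (b : F) (Φ : SchwartzBruhat V) :
    pClass h2 hψ Q μ v₁ ⟨weilN ψ Q b Φ.1, weilN_mem hcond h2 b Φ.2⟩ =
      (ψ b : ℂ) • pClass h2 hψ Q μ v₁ Φ := by
  rw [← sub_eq_zero, pClass, LinearMap.comp_apply, LinearMap.comp_apply, ← map_smul, ← map_sub,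
    Submodule.mkQ_apply, Submodule.Quotient.mk_eq_zero]
  refine Submodule.subset_span ⟨b, pLinear h2 hψ Q μ v₁ Φ, fun g => ?_⟩
  change pMap ψ Q μ v₁ (weilN ψ Q b Φ.1) g - (ψ b : ℂ) * pMap ψ Q μ v₁ Φ.1 g = _
  rw [pMap, weil_weilN]
  rfl

/-- The class of `p(Φ)` vanishes if `Φ` vanishes on `X₁`. -/
theorem pClass_eq_zero_of_vanish (h2 : (2 : F) ≠ 0) (hψ : Continuous ψ) (hϖ : IsUniformizer ϖ)
    (hcond : HasConductorIntegers ψ) (v₁ : V) (Φ : SchwartzBruhat V)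
    (hΦ : ∀ v, Q v = 1 → Φ.1 v = 0) : pClass h2 hψ Q μ v₁ Φ = 0 := by
  have hV : HasCompactOpenBasis V := hasCompactOpenBasis_module hϖ
  have hcont := continuous_quadraticForm h2 Q
  suffices h : ∃ K : Set V, IsCompact K ∧ IsOpen K ∧ Function.support Φ.1 ⊆ K ∧
      ∀ Φ : SchwartzBruhat V, Function.support Φ.1 ⊆ K → pClass h2 hψ Q μ v₁ Φ = 0 by
    obtain ⟨K, -, -, hsub, hK⟩ := h
    exact hK Φ hsub
  -- Quantifying over all functions supported in a compact open neighbourhood makes the property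
  -- local: such functions can be cut along clopen sets.
  refine (SchwartzBruhat.isCompact_support Φ.2).1.induction_on
    (p := fun s => ∃ K : Set V, IsCompact K ∧ IsOpen K ∧ s ⊆ K ∧ ∀ Φ : SchwartzBruhat V,
      Function.support Φ.1 ⊆ K → pClass h2 hψ Q μ v₁ Φ = 0) ?_ ?_ ?_ ?_
  · refine ⟨∅, isCompact_empty, isOpen_empty, le_rfl, fun Φ h => ?_⟩
    have : Φ = 0 := Subtype.ext (Function.support_eq_empty_iff.1 (Set.subset_empty_iff.1 h))
    rw [this, map_zero]
  · rintro s t hst ⟨K, h1, h2, h3, h4⟩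
    exact ⟨K, h1, h2, hst.trans h3, h4⟩
  · rintro s t ⟨K, h1, h2, h3, h4⟩ ⟨K', h1', h2', h3', h4'⟩
    refine ⟨K ∪ K', h1.union h1', h2.union h2', Set.union_subset_union h3 h3', fun Φ h => ?_⟩
    have hcl : IsClopen K := ⟨h1.isClosed, h2⟩
    let A : SchwartzBruhat V := ⟨_, SchwartzBruhat.indicator_mem_of_mem hcl Φ.2⟩
    let B : SchwartzBruhat V := ⟨_, SchwartzBruhat.indicator_mem_of_mem hcl.compl Φ.2⟩
    have e : Φ = A + B := Subtype.ext (Set.indicator_self_add_compl K Φ.1).symm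
    rw [e, map_add, h4 A, h4' B, add_zero]
    · intro v hv
      have hv' := (Set.support_indicator.subset hv)
      exact (h hv'.2).resolve_left hv'.1
    · intro v hv
      exact (Set.support_indicator.subset hv).1
  · intro v hv
    have hv1 : Q v - 1 ≠ 0 := fun h => hv (hΦ v (sub_eq_zero.1 h))
    -- As `Q v ≠ 1`, a large `a` makes `a (Q v - 1)` non-integral, and the conductor yields `y` with
    -- `ψ(a y (Q v - 1)) ≠ 1`.
    obtain ⟨a, ha⟩ := NormedField.exists_lt_norm F (‖Q v - 1‖⁻¹)
    have h1 : 1 < ‖a * (Q v - 1)‖ := by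
      rw [norm_mul]
      exact (inv_lt_iff_one_lt_mul₀ (norm_pos_iff.2 hv1)).1 ha
    obtain ⟨y, -, hy⟩ := hcond.exists_ne_one h1
    have hne : ψ (a * y * Q v) ≠ ψ (a * y) := by
      intro h
      refine hy ?_
      have e : a * y * Q v = a * (Q v - 1) * y + a * y := by ring
      rw [e, AddChar.map_add_eq_mul] at h
      exact mul_eq_right.1 h
    have hloc := hcond.isLocallyConstant.comp_continuous
      (continuous_const.mul hcont : Continuous fun v => a * y * Q v)
    -- On this `K` the function `ψ(a y Q)` is constant, so `n(a y)` acts on functions supported in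
    -- `K` by a scalar different from `ψ(a y)`.
    obtain ⟨K, k1, k2, k3, k4⟩ := hV v _ (hloc.isOpen_fiber (ψ (a * y * Q v) : ℂ)) rfl
    refine ⟨K, mem_nhdsWithin_of_mem_nhds (k2.mem_nhds k3), K, k1, k2, le_rfl, fun Φ h => ?_⟩
    have e : (⟨weilN ψ Q (a * y) Φ.1, weilN_mem hcond h2 _ Φ.2⟩ : SchwartzBruhat V) =
        (ψ (a * y * Q v) : ℂ) • Φ := by
      refine Subtype.ext (funext fun u => ?_)
      by_cases hu : Φ.1 u = 0
      · simp [weilN, hu]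
      · have : (ψ (a * y * Q u) : ℂ) = ψ (a * y * Q v) := k4 (h hu)
        simp [weilN, this]
    have key := pClass_weilN (Q := Q) μ h2 hψ hcond v₁ (a * y) Φ
    rw [e, map_smul, ← sub_eq_zero, ← sub_smul] at key
    refine (smul_eq_zero.1 key).resolve_left (sub_ne_zero.2 fun h => hne (Circle.coe_inj.1 h))

/-- A generating relation on `X₁` lifts to `Φ ∘ h⁻¹ - Φ`, which `p` kills as `h` fixes `v₁`. What
remains after subtracting such lifts vanishes on `X₁`. -/
theorem pClass_eq_zero_of_resX_mem (h2 : (2 : F) ≠ 0) (hψ : Continuous ψ) (hϖ : IsUniformizer ϖ)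
    (hcond : HasConductorIntegers ψ) (hQ : Q.polarBilin.Nondegenerate)
    (hμ : IsSelfDual ψ (QuadraticMap.polar Q) μ) (v₁ : V) (Φ : SchwartzBruhat V)
    (hΦ : resX h2 Q 1 Φ ∈ relX Q v₁) : pClass h2 hψ Q μ v₁ Φ = 0 := by
  have hle : relX Q v₁ ≤ (LinearMap.ker (pClass h2 hψ Q μ v₁)).map (resX h2 Q 1) := by
    refine Submodule.span_le.2 ?_
    rintro η ⟨h, hh, φ, hφ⟩
    obtain ⟨Φ, rfl⟩ := resX_surjective hϖ h2 Q 1 φ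
    let Φ' : SchwartzBruhat V :=
      ⟨_, SchwartzBruhat.comp_homeomorph Φ.2 (isometryHomeomorph h.symm)⟩
    refine ⟨Φ' - Φ, ?_, Subtype.ext (funext fun x => (hφ x).symm)⟩
    have e : pLinear h2 hψ Q μ v₁ Φ' = pLinear h2 hψ Q μ v₁ Φ := by
      refine Subtype.ext (funext fun g => ?_)
      have h1 := weil_comp_isometry μ h2 hψ hϖ hcond hQ hμ h.symm Φ.2 g v₁
      have h3 : h.symm v₁ = v₁ := by
        conv_lhs => rw [← hh]
        exact h.toLinearEquiv.symm_apply_apply v₁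
      rw [h3] at h1
      exact h1
    rw [SetLike.mem_coe, LinearMap.mem_ker, map_sub, pClass, LinearMap.comp_apply, e,
      ← LinearMap.comp_apply, sub_self]
  obtain ⟨Ψ, hΨ, hres⟩ := hle hΦ
  have h0 : pClass h2 hψ Q μ v₁ (Φ - Ψ) = 0 := by
    refine pClass_eq_zero_of_vanish μ h2 hψ hϖ hcond v₁ _ fun v hv => ?_
    have := congr_fun (congr_arg Subtype.val hres) ⟨v, hv⟩
    exact sub_eq_zero.2 this.symm
  rw [map_sub, LinearMap.mem_ker.1 hΨ, sub_zero] at h0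
  exact h0

/-- The class of `Φ|_{X₁}` in `I(X₁)`. -/
def resClass (h2 : (2 : F) ≠ 0) (Q : QuadraticForm F V) (v₁ : V) :
    SchwartzBruhat V →ₗ[ℂ] OrbitalX Q v₁ :=
  (relX Q v₁).mkQ ∘ₗ resX h2 Q 1

theorem resClass_surjective (hϖ : IsUniformizer ϖ) (h2 : (2 : F) ≠ 0) (Q : QuadraticForm F V)
    (v₁ : V) : Function.Surjective (resClass h2 Q v₁) :=
  (Submodule.mkQ_surjective _).comp (resX_surjective hϖ h2 Q 1)

theorem isTransferMap_iff (h2 : (2 : F) ≠ 0) (hψ : Continuous ψ) (v₁ : V)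
    (t : OrbitalX Q v₁ →ₗ[ℂ] OrbitalN ψ Q μ v₁) :
    IsTransferMap ψ Q μ v₁ t ↔ ∀ Φ, t (resClass h2 Q v₁ Φ) = pClass h2 hψ Q μ v₁ Φ := by
  constructor
  · intro h Φ
    exact h (pLinear h2 hψ Q μ v₁ Φ) (resX h2 Q 1 Φ) ⟨Φ.1, Φ.2, rfl, fun _ => rfl⟩
  · rintro h f φ ⟨Φ, hΦ, h1, h3⟩
    have e1 : f = pLinear h2 hψ Q μ v₁ ⟨Φ, hΦ⟩ := Subtype.ext h1.symm
    have e2 : φ = resX h2 Q 1 ⟨Φ, hΦ⟩ := Subtype.ext (funext fun x => (h3 x).symm)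
    rw [e1, e2]
    exact h ⟨Φ, hΦ⟩

theorem existsUnique_transferMap (h2 : (2 : F) ≠ 0) (hψ : Continuous ψ) (hϖ : IsUniformizer ϖ)
    (hcond : HasConductorIntegers ψ) (hQ : Q.polarBilin.Nondegenerate)
    (hμ : IsSelfDual ψ (QuadraticMap.polar Q) μ) (v₁ : V) :
    ∃! t, IsTransferMap ψ Q μ v₁ t := by
  have hsurj := resClass_surjective hϖ h2 Q v₁
  have hker : LinearMap.ker (resClass h2 Q v₁) ≤ LinearMap.ker (pClass h2 hψ Q μ v₁) := by
    intro Φ hΦ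
    refine pClass_eq_zero_of_resX_mem μ h2 hψ hϖ hcond hQ hμ v₁ Φ ?_
    rwa [LinearMap.mem_ker, resClass, LinearMap.comp_apply, Submodule.mkQ_apply,
      Submodule.Quotient.mk_eq_zero] at hΦ
  obtain ⟨t, ht⟩ := exists_linearMap_comp_eq hsurj _ hker
  refine ⟨t, (isTransferMap_iff μ h2 hψ v₁ t).2 ht, fun t' ht' => LinearMap.ext fun x => ?_⟩
  obtain ⟨Φ, rfl⟩ := hsurj x
  rw [(isTransferMap_iff μ h2 hψ v₁ t').1 ht' Φ, ht]

end TransferMap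

/-! ### The fibre measures `|ω_a|` and `|ν_ξ|` -/

section Measures

variable {F : Type*} [NontriviallyNormedField F] [IsUltrametricDist F] [LocallyCompactSpace F]
  [MeasurableSpace F] [BorelSpace F] {ψ : AddChar F Circle} {μF : Measure F} [μF.IsAddHaarMeasure]
variable {V : Type*} [AddCommGroup V] [Module F V] [FiniteDimensional F V] [TopologicalSpace V]
  [IsTopologicalAddGroup V] [ContinuousSMul F V] [T2Space V] [MeasurableSpace V] [BorelSpace V]
  {Q : QuadraticForm F V} {μV : Measure V} [μV.IsAddHaarMeasure] {v₁ : V} {ϖ : F}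

/-- The only critical point of `b Q` with `b ≠ 0` is the origin. The threshold is uniform in `K` and
explicit in `k`, as the shrinking balls of `tendsto_real_ball` require. -/
theorem exists_decay_quadraticForm (h2 : (2 : F) ≠ 0) (hψ : Continuous ψ)
    (hcond : HasConductorIntegers ψ) (hϖ : IsUniformizer ϖ) (hQ : Q.polarBilin.Nondegenerate)
    {K₀ : Set V} (hK₀ : IsCompact K₀) (h0 : (0 : V) ∉ K₀) :
    ∃ (R : ℝ) (k₀ : ℕ), ∀ k ≥ k₀, ∀ K ⊆ K₀, IsCompact K → IsOpen K →
      (∀ v ∈ K, ∀ l ∈ lattice V ϖ k, v + l ∈ K) → ∀ b : F, R < ‖b‖ * ‖ϖ‖ ^ k →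
      ∫ v in K, (ψ (b * Q v) : ℂ) ∂μV = 0 := by
  obtain ⟨R, k₀, h⟩ := exists_setIntegral_phase_eq_zero μV h2 hψ hϖ hcond Q hQ hK₀ 0
    (Submodule.prod ⊤ ⊥) (by
      rintro v hv p hp hpv
      rw [smul_zero, add_zero] at hpv
      have h1 : p.1 = 0 := (smul_eq_zero.1 hpv).resolve_right fun h => h0 (h ▸ hv)
      exact Prod.ext h1 hp.2)
  refine ⟨R, k₀, fun k hk K hKK hK hK' hKL b hb => ?_⟩
  have := h k hk K hKK hK hK' hKL (b, 0) ⟨trivial, rfl⟩ (by simpa [Prod.norm_def] using hb)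
  simpa using this

theorem exists_isFiberMeasure_quadraticForm (h2 : (2 : F) ≠ 0) (hψ : Continuous ψ)
    (hcond : HasConductorIntegers ψ) (hϖ : IsUniformizer ϖ) (hQ : Q.polarBilin.Nondegenerate)
    (hμF : IsSelfDual ψ (fun x y : F => x * y) μF) :
    ∃ ω : (a : F) → Measure (Hyperboloid Q a), IsFiberMeasure μV μF Q {0}ᶜ ω := by
  have hcont := continuous_quadraticForm h2 Q
  refine exists_isFiberMeasure (hasCompactOpenBasis_module hϖ) hϖ hcont isOpen_compl_singleton ?_
  intro K hK hK' hKs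
  refine eventually_real_inter_eq hψ hϖ hcond hμF hcont hK hK' ?_
  obtain ⟨R, k₀, h⟩ := exists_decay_quadraticForm (μV := μV) h2 hψ hcond hϖ hQ hK
    (fun h0 => hKs h0 (by simp))
  obtain ⟨k, hk, hk'⟩ := ((eventually_add_lattice_subset hϖ hK hK').and
    (eventually_ge_atTop k₀)).exists
  have hr : 0 < ‖ϖ‖ ^ k := pow_pos hϖ.norm_pos k
  exact ⟨R / ‖ϖ‖ ^ k, fun b hb => h k hk' K le_rfl hK hK' hk b ((div_lt_iff₀ hr).1 hb)⟩

variable {ω : (a : F) → Measure (Hyperboloid Q a)}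

/-- The integral over `X₁` in terms of the Fourier transform of the push-forward along `Q`. -/
theorem eventually_integral_idealU_eq (h2 : (2 : F) ≠ 0) (hψ : Continuous ψ)
    (hcond : HasConductorIntegers ψ) (hϖ : IsUniformizer ϖ)
    (hμF : IsSelfDual ψ (fun x y : F => x * y) μF) (hω : IsFiberMeasure μV μF Q {0}ᶜ ω)
    {f : V → ℂ} (hf : f ∈ SchwartzBruhat V) :
    ∀ᶠ n in atTop, ∫ b in idealU ϖ n, (ψ (-b) : ℂ) * ∫ v, f v * (ψ (b * Q v) : ℂ) ∂μV ∂μF =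
      ∫ x : Hyperboloid Q 1, f x.1 ∂(ω 1) := by
  have hcont := continuous_quadraticForm h2 Q
  filter_upwards [hω.eventually_setIntegral hϖ hcont isOpen_compl_singleton hf
    (y := 1) (by simp)] with n hn
  have h := integral_idealU_mul μF μV hψ hϖ hcond hcont hf.1.continuous hf.2 n 1
  simp_rw [mul_one] at h
  rw [h, hn, ← mul_assoc, ← Complex.ofReal_mul, real_idealU_mul_real_idealP μF hϖ hcond hμF,
    Complex.ofReal_one, one_mul]

/-! ### The pairing with `v₁` on `X₁`: decay, fibre measures, null fibres -/

theorem eq_or_eq_neg_of_mem_span (hv₁ : Q v₁ = 1) {x : V} (hx : Q x = 1)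
    (h : x ∈ Submodule.span F {v₁}) : x = v₁ ∨ x = -v₁ := by
  obtain ⟨t, rfl⟩ := Submodule.mem_span_singleton.1 h
  rw [QuadraticMap.map_smul, hv₁, smul_eq_mul, mul_one] at hx
  rcases mul_self_eq_one_iff.1 hx with rfl | rfl
  · left; rw [one_smul]
  · right; rw [neg_smul, one_smul]

theorem polar_self_eq_two (hv₁ : Q v₁ = 1) : QuadraticMap.polar Q v₁ v₁ = 2 := by
  rw [QuadraticMap.polar_self, hv₁]; simp

/-- By `eventually_integral_idealU_eq` an integral over `X₁` is an integral over `b` of integrals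
over `V`, here with phase `b Q(v) + c⟨v₁, v⟩`. Its gradient `b v + c v₁` does not vanish off the
line `F v₁`, so for large `c` the inner integral is `0` for every `b`. -/
theorem exists_decay_hyperboloid (h2 : (2 : F) ≠ 0) (hψ : Continuous ψ)
    (hcond : HasConductorIntegers ψ) (hϖ : IsUniformizer ϖ) (hQ : Q.polarBilin.Nondegenerate)
    (hμF : IsSelfDual ψ (fun x y : F => x * y) μF) (hω : IsFiberMeasure μV μF Q {0}ᶜ ω)
    (hv₁ : Q v₁ = 1) {K : Set (Hyperboloid Q 1)} (hK : IsCompact K) (hK' : IsOpen K)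
    (hKv : ∀ x ∈ K, x.1 ≠ v₁ ∧ x.1 ≠ -v₁) :
    ∃ R : ℝ, ∀ c : F, R < ‖c‖ →
      ∫ x in K, (ψ (c * QuadraticMap.polar Q v₁ x.1) : ℂ) ∂(ω 1) = 0 := by
  have hcont := continuous_quadraticForm h2 Q
  have : ProperSpace F := ProperSpace.of_locallyCompactSpace F
  have hspan : IsClosed (Submodule.span F {v₁} : Set V) := Submodule.closed_of_finiteDimensional _
  have hv0 : v₁ ≠ 0 := by rintro rfl; simp at hv₁
  -- `K` is thickened to a compact open subset of `V` avoiding the line `F v₁`, which meets `X₁`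
  -- only in `±v₁`.
  obtain ⟨K', k1, k2, k3, k4⟩ := (hasCompactOpenBasis_module (V := V) hϖ).exists_extension hK hK'
    hspan.isOpen_compl (fun x hx h => by
      rcases eq_or_eq_neg_of_mem_span hv₁ x.2 h with h | h
      exacts [(hKv x hx).1 h, (hKv x hx).2 h])
  obtain ⟨R, k₀, h⟩ := exists_setIntegral_phase_eq_zero μV h2 hψ hϖ hcond Q hQ k1 v₁ ⊤ (by
      rintro v hv p - hpv
      have h1 : p.1 = 0 := by
        by_contra hp
        refine k4 hv (Submodule.mem_span_singleton.2 ⟨-(p.1⁻¹ * p.2), ?_⟩)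
        have : v = p.1⁻¹ • (p.1 • v + p.2 • v₁) - (p.1⁻¹ * p.2) • v₁ := by
          rw [smul_add, inv_smul_smul₀ hp, smul_smul, add_sub_cancel_right]
        rw [hpv, smul_zero, zero_sub] at this
        rw [neg_smul, ← this]
      rw [h1, zero_smul, zero_add] at hpv
      exact Prod.ext h1 ((smul_eq_zero.1 hpv).resolve_right hv0))
  obtain ⟨k, hk, hk'⟩ := ((eventually_add_lattice_subset hϖ k1 k2).and
    (eventually_ge_atTop k₀)).exists
  have hr : 0 < ‖ϖ‖ ^ k := pow_pos hϖ.norm_pos k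
  refine ⟨R / ‖ϖ‖ ^ k, fun c hc => ?_⟩
  have hf : (fun v => K'.indicator (fun _ => (1 : ℂ)) v *
      (ψ (c * QuadraticMap.polar Q v₁ v) : ℂ)) ∈ SchwartzBruhat V :=
    SchwartzBruhat.mul_mem (SchwartzBruhat.indicator_mem k1 k2 1)
      (hcond.isLocallyConstant.comp_continuous
        (continuous_const.mul (continuous_polar Q v₁) :
          Continuous fun v => c * QuadraticMap.polar Q v₁ v))
  obtain ⟨n, hn⟩ := (eventually_integral_idealU_eq h2 hψ hcond hϖ hμF hω hf).exists
  have hzero : ∀ b : F, ∫ v, K'.indicator (fun _ => (1 : ℂ)) v *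
      (ψ (c * QuadraticMap.polar Q v₁ v) : ℂ) * (ψ (b * Q v) : ℂ) ∂μV = 0 := by
    intro b
    -- The norm of `(b, c)` is a maximum, so a large `c` suffices whatever `b` is.
    have h1 := h k hk' K' le_rfl k1 k2 hk (b, c) trivial ((div_lt_iff₀ hr).1
      (hc.trans_le (le_max_right ‖b‖ ‖c‖)))
    rw [← integral_indicator k2.measurableSet] at h1
    rw [← h1]
    refine integral_congr_ae (Eventually.of_forall fun v => ?_)
    by_cases hv : v ∈ K'
    · simp only [Set.indicator_of_mem hv]
      rw [AddChar.map_add_eq_mul, Circle.coe_mul, one_mul, mul_comm]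
    · simp only [Set.indicator_of_notMem hv, zero_mul]
  simp_rw [hzero, mul_zero, integral_zero] at hn
  rw [← integral_indicator hK'.measurableSet, hn]
  refine integral_congr_ae (Eventually.of_forall fun x => ?_)
  by_cases hx : x ∈ K
  · simp only [Set.indicator_of_mem hx, Set.indicator_of_mem ((k3 x).2 hx), one_mul]
  · simp only [Set.indicator_of_notMem hx, Set.indicator_of_notMem (fun h => hx ((k3 x).1 h)),
      zero_mul]

theorem hasCompactOpenBasis_hyperboloid (h2 : (2 : F) ≠ 0) (hϖ : IsUniformizer ϖ)
    (Q : QuadraticForm F V) (a : F) : HasCompactOpenBasis (Hyperboloid Q a) :=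
  (hasCompactOpenBasis_module hϖ).subtype (isClosed_hyperboloid h2 Q a)

theorem continuous_polar_hyperboloid (Q : QuadraticForm F V) (a : F) (v₁ : V) :
    Continuous fun x : Hyperboloid Q a => QuadraticMap.polar Q v₁ x.1 :=
  (continuous_polar Q v₁).comp continuous_subtype_val

theorem exists_isFiberMeasure_polar (h2 : (2 : F) ≠ 0) (hψ : Continuous ψ)
    (hcond : HasConductorIntegers ψ) (hϖ : IsUniformizer ϖ) (hQ : Q.polarBilin.Nondegenerate)
    (hμF : IsSelfDual ψ (fun x y : F => x * y) μF) (hω : IsFiberMeasure μV μF Q {0}ᶜ ω)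
    (hv₁ : Q v₁ = 1) :
    ∃ ν : (ξ : F) → Measure {x : Hyperboloid Q 1 // QuadraticMap.polar Q v₁ x.1 = ξ},
      IsFiberMeasure (ω 1) μF (fun x => QuadraticMap.polar Q v₁ x.1) {2, -2}ᶜ ν := by
  have := hω.finite_on_compacts 1 (by simp)
  have hcont := continuous_polar_hyperboloid Q 1 v₁
  refine exists_isFiberMeasure (hasCompactOpenBasis_hyperboloid h2 hϖ Q 1) hϖ hcont
    (Set.toFinite _).isClosed.isOpen_compl ?_
  intro K hK hK' hKs
  refine eventually_real_inter_eq hψ hϖ hcond hμF hcont hK hK'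
    (exists_decay_hyperboloid h2 hψ hcond hϖ hQ hμF hω hv₁ hK hK' fun x hx => ⟨?_, ?_⟩)
  · intro h
    refine hKs hx (Or.inl ?_)
    change QuadraticMap.polar Q v₁ x.1 = 2
    rw [h, polar_self_eq_two hv₁]
  · intro h
    refine hKs hx (Or.inr ?_)
    change QuadraticMap.polar Q v₁ x.1 = -2
    rw [h, QuadraticMap.polar_neg_right, polar_self_eq_two hv₁]

/-- Away from `±v₁` the push-forward has a finite density at every `ξ`, including `±2`, and the
volume of `ϖⁿ 𝒪` tends to `0`. -/
theorem real_inter_fiber_eq_zero (h2 : (2 : F) ≠ 0) (hψ : Continuous ψ)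
    (hcond : HasConductorIntegers ψ) (hϖ : IsUniformizer ϖ) (hQ : Q.polarBilin.Nondegenerate)
    (hμF : IsSelfDual ψ (fun x y : F => x * y) μF) (hω : IsFiberMeasure μV μF Q {0}ᶜ ω)
    (hv₁ : Q v₁ = 1) {K : Set (Hyperboloid Q 1)} (hK : IsCompact K) (hK' : IsOpen K)
    (hKv : ∀ x ∈ K, x.1 ≠ v₁ ∧ x.1 ≠ -v₁) (ξ : F) :
    (ω 1).real (K ∩ {x | QuadraticMap.polar Q v₁ x.1 = ξ}) = 0 := by
  have := hω.finite_on_compacts 1 (by simp)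
  have hcont := continuous_polar_hyperboloid Q 1 v₁
  obtain ⟨g, n₀, h⟩ := eventually_real_inter_eq hψ hϖ hcond hμF hcont hK hK'
    (exists_decay_hyperboloid h2 hψ hcond hϖ hQ hμF hω hv₁ hK hK' hKv)
  have hlim : Tendsto (fun n => (g ξ : ℝ) * μF.real (idealP ϖ n)) atTop (𝓝 0) := by
    have h0 := ((tendsto_pow_atTop_nhds_zero_of_lt_one (absF_uniformizer_pos hϖ).le
      (absF_uniformizer_lt_one hϖ)).mul_const (μF.real (idealP ϖ 0))).const_mul (g ξ : ℝ)
    rw [zero_mul, mul_zero] at h0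
    exact h0.congr fun n => by rw [real_idealP_eq hϖ μF n]
  refine le_antisymm (ge_of_tendsto hlim ?_) measureReal_nonneg
  filter_upwards [eventually_ge_atTop n₀] with n hn
  rw [← h n hn ξ]
  refine measureReal_mono ?_
    ((measure_mono Set.inter_subset_left).trans_lt hK.measure_lt_top).ne
  rintro x ⟨hx, hx'⟩
  refine ⟨hx, ?_⟩
  rw [Set.mem_preimage, hx']
  exact self_mem_idealPCoset n ξ

/-- The integral over `b` that computes the mass is confined to `ϖ⁻ᵐ 𝒪`, of volume inverse to that
of `ϖᵐ 𝒪`, and its integrand is bounded by the volume of `B`. -/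
theorem real_hyperboloid_le (h2 : (2 : F) ≠ 0) (hψ : Continuous ψ)
    (hcond : HasConductorIntegers ψ) (hϖ : IsUniformizer ϖ)
    (hμF : IsSelfDual ψ (fun x y : F => x * y) μF) (hω : IsFiberMeasure μV μF Q {0}ᶜ ω)
    {B : Set V} (hB : IsCompact B) (hB' : IsOpen B) (m : ℕ)
    (hzero : ∀ b ∉ idealU ϖ m, ∫ v in B, (ψ (b * Q v) : ℂ) ∂μV = 0) :
    (ω 1).real (Subtype.val ⁻¹' B) ≤ μV.real B / μF.real (idealP ϖ m) := by
  have hf := SchwartzBruhat.indicator_mem hB hB' 1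
  obtain ⟨n, hn⟩ := (eventually_integral_idealU_eq h2 hψ hcond hϖ hμF hω hf).exists
  have e1 : ∀ b, ∫ v, B.indicator (fun _ => (1 : ℂ)) v * (ψ (b * Q v) : ℂ) ∂μV =
      ∫ v in B, (ψ (b * Q v) : ℂ) ∂μV := by
    intro b
    rw [← integral_indicator hB'.measurableSet]
    refine integral_congr_ae (Eventually.of_forall fun v => ?_)
    by_cases hv : v ∈ B
    · simp only [Set.indicator_of_mem hv, one_mul]
    · simp only [Set.indicator_of_notMem hv, zero_mul]
  have e2 : ∫ x : Hyperboloid Q 1, B.indicator (fun _ => (1 : ℂ)) x.1 ∂(ω 1) =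
      (ω 1).real (Subtype.val ⁻¹' B) := by
    have e : (fun x : Hyperboloid Q 1 => B.indicator (fun _ => (1 : ℂ)) x.1) =
        (Subtype.val ⁻¹' B).indicator fun _ => 1 := rfl
    rw [e, integral_indicator (hB'.preimage continuous_subtype_val).measurableSet]
    simp
  simp_rw [e1] at hn
  rw [e2] at hn
  have hUm := (isClopen_idealU hϖ m).isOpen.measurableSet
  have hUc := isCompact_idealU hϖ m
  have e3 : ∫ b in idealU ϖ n, (ψ (-b) : ℂ) * ∫ v in B, (ψ (b * Q v) : ℂ) ∂μV ∂μF =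
      ∫ b in idealU ϖ n ∩ idealU ϖ m,
        (ψ (-b) : ℂ) * ∫ v in B, (ψ (b * Q v) : ℂ) ∂μV ∂μF := by
    rw [← setIntegral_indicator hUm]
    refine setIntegral_congr_fun (isClopen_idealU hϖ n).isOpen.measurableSet fun b _ => ?_
    by_cases hb : b ∈ idealU ϖ m
    · simp only [Set.indicator_of_mem hb]
    · simp only [Set.indicator_of_notMem hb, hzero b hb, mul_zero]
  have hUlt : μF (idealU ϖ n ∩ idealU ϖ m) < ⊤ :=
    (measure_mono Set.inter_subset_right).trans_lt hUc.measure_lt_top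
  have h4 : ‖∫ b in idealU ϖ n ∩ idealU ϖ m,
        (ψ (-b) : ℂ) * ∫ v in B, (ψ (b * Q v) : ℂ) ∂μV ∂μF‖ ≤
      μV.real B * μF.real (idealU ϖ n ∩ idealU ϖ m) := by
    refine norm_setIntegral_le_of_norm_le_const hUlt fun b _ => ?_
    rw [norm_mul, Circle.norm_coe, one_mul]
    refine (norm_setIntegral_le_of_norm_le_const (C := 1) hB.measure_lt_top
      fun v _ => ?_).trans (by rw [one_mul])
    rw [Circle.norm_coe]
  rw [← e3, hn, Complex.norm_real, Real.norm_of_nonneg measureReal_nonneg] at h4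
  refine h4.trans ?_
  rw [le_div_iff₀ (real_idealP_pos μF hϖ m)]
  calc μV.real B * μF.real (idealU ϖ n ∩ idealU ϖ m) * μF.real (idealP ϖ m)
      ≤ μV.real B * μF.real (idealU ϖ m) * μF.real (idealP ϖ m) := by
        gcongr
        · exact hUc.measure_lt_top.ne
        · exact Set.inter_subset_right
    _ = μV.real B := by rw [mul_assoc, real_idealU_mul_real_idealP μF hϖ hcond hμF m, mul_one]

/-- For the ball `z + ϖᵏ L₀` stationary phase confines `b` to norm at most `R ‖ϖ‖⁻ᵏ`, so
`real_hyperboloid_le` bounds the mass by the ratio of `tendsto_real_lattice_div`. -/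
theorem tendsto_real_ball (h2 : (2 : F) ≠ 0) (hψ : Continuous ψ)
    (hcond : HasConductorIntegers ψ) (hϖ : IsUniformizer ϖ) (hQ : Q.polarBilin.Nondegenerate)
    (hμF : IsSelfDual ψ (fun x y : F => x * y) μF) (hω : IsFiberMeasure μV μF Q {0}ᶜ ω)
    (hdim : 2 ≤ Module.finrank F V) {z : V} (hz : z ≠ 0) :
    Tendsto (fun k => (ω 1).real {x | x.1 - z ∈ lattice V ϖ k}) atTop (𝓝 0) := by
  have hBc : ∀ k, IsCompact {v : V | v - z ∈ lattice V ϖ k} := fun k =>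
    (Homeomorph.subRight z).isCompact_preimage.2 (isCompact_lattice ϖ k)
  have hBo : ∀ k, IsOpen {v : V | v - z ∈ lattice V ϖ k} := fun k =>
    (isClopen_lattice hϖ k).isOpen.preimage (continuous_id.sub continuous_const)
  -- `k₂` keeps the balls away from the critical point `0`; below, `k₁` absorbs the constant `R`.
  obtain ⟨k₂, hk₂⟩ := (eventually_lattice_subset hϖ
    (isOpen_compl_singleton.mem_nhds (Ne.symm (neg_ne_zero.2 hz)) : {-z}ᶜ ∈ 𝓝 (0 : V))).exists
  obtain ⟨R, k₀, h⟩ := exists_decay_quadraticForm (μV := μV) (Q := Q) h2 hψ hcond hϖ hQ (hBc k₂)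
    (fun h0 => by
      have h0' : (0 : V) - z ∈ lattice V ϖ k₂ := h0
      rw [zero_sub] at h0'
      exact hk₂ h0' rfl)
  obtain ⟨k₁, hk₁⟩ : ∃ k₁ : ℕ, R * ‖ϖ‖ ^ k₁ ≤ 1 := by
    have := (tendsto_pow_atTop_nhds_zero_of_lt_one hϖ.norm_pos.le hϖ.1).const_mul R
    rw [mul_zero] at this
    exact (this.eventually_le_const one_pos).exists
  refine squeeze_zero' (Eventually.of_forall fun k => measureReal_nonneg) ?_
    (tendsto_real_lattice_div hϖ μV μF hdim k₁)
  filter_upwards [eventually_ge_atTop k₀, eventually_ge_atTop k₂] with k hk hk'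
  have hBμ : μV.real {v : V | v - z ∈ lattice V ϖ k} = μV.real (lattice V ϖ k : Set V) := by
    have : {v : V | v - z ∈ lattice V ϖ k} = (fun v => v + -z) ⁻¹' (lattice V ϖ k : Set V) := by
      ext v; simp [sub_eq_add_neg]
    rw [this, Measure.real, Measure.real, measure_preimage_add_right]
  rw [← hBμ]
  refine real_hyperboloid_le h2 hψ hcond hϖ hμF hω (hBc k) (hBo k) (k + k₁) fun b hb => ?_
  refine h k hk _ (fun v hv => ?_) (hBc k) (hBo k) ?_ b ?_
  · have hv' : v - z ∈ lattice V ϖ k := hv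
    have hv'' : v - z ∈ lattice V ϖ k₂ := lattice_anti hϖ hk' hv'
    exact hv''
  · intro v hv l hl
    have hv' : v - z ∈ lattice V ϖ k := hv
    have : v + l - z = (v - z) + l := by abel
    rw [Set.mem_ofPred_eq, this]
    exact add_mem hv' hl
  · by_contra! hle
    refine hb ?_
    rw [idealU, Set.mem_ofPred_eq, norm_mul, norm_pow, pow_add]
    calc ‖ϖ‖ ^ k * ‖ϖ‖ ^ k₁ * ‖b‖ = (‖b‖ * ‖ϖ‖ ^ k) * ‖ϖ‖ ^ k₁ := by ring
      _ ≤ R * ‖ϖ‖ ^ k₁ := mul_le_mul_of_nonneg_right hle (by positivity)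
      _ ≤ 1 := hk₁

/-- Small balls around the critical points `±v₁` are estimated by their whole mass, which tends to
`0`; the rest of the fibre is null by `real_inter_fiber_eq_zero`. -/
theorem measure_inter_fiber_eq_zero (h2 : (2 : F) ≠ 0) (hψ : Continuous ψ)
    (hcond : HasConductorIntegers ψ) (hϖ : IsUniformizer ϖ) (hQ : Q.polarBilin.Nondegenerate)
    (hμF : IsSelfDual ψ (fun x y : F => x * y) μF) (hω : IsFiberMeasure μV μF Q {0}ᶜ ω)
    (hdim : 2 ≤ Module.finrank F V) (hv₁ : Q v₁ = 1) {K : Set (Hyperboloid Q 1)}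
    (hK : IsCompact K) (hK' : IsOpen K) (ξ : F) :
    (ω 1) (K ∩ {x | QuadraticMap.polar Q v₁ x.1 = ξ}) = 0 := by
  have hfin := hω.finite_on_compacts 1 (by simp)
  have hv0 : v₁ ≠ 0 := by rintro rfl; simp at hv₁
  have hlt : (ω 1) (K ∩ {x | QuadraticMap.polar Q v₁ x.1 = ξ}) ≠ ⊤ :=
    ((measure_mono Set.inter_subset_left).trans_lt hK.measure_lt_top).ne
  rw [← measureReal_eq_zero_iff hlt]
  have hclosed := isClosed_hyperboloid h2 Q 1
  have hBc : ∀ z k, IsCompact {x : Hyperboloid Q 1 | x.1 - z ∈ lattice V ϖ k} := fun z k =>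
    hclosed.isClosedEmbedding_subtypeVal.isCompact_preimage
      ((Homeomorph.subRight z).isCompact_preimage.2 (isCompact_lattice ϖ k))
  have hBo : ∀ z k, IsOpen {x : Hyperboloid Q 1 | x.1 - z ∈ lattice V ϖ k} := fun z k =>
    (isClopen_lattice hϖ k).isOpen.preimage (continuous_subtype_val.sub continuous_const)
  have hlim := (tendsto_real_ball (z := v₁) h2 hψ hcond hϖ hQ hμF hω hdim hv0).add
    (tendsto_real_ball (z := -v₁) h2 hψ hcond hϖ hQ hμF hω hdim (neg_ne_zero.2 hv0))
  rw [add_zero] at hlim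
  refine le_antisymm (ge_of_tendsto' hlim fun k => ?_) measureReal_nonneg
  set B₁ := {x : Hyperboloid Q 1 | x.1 - v₁ ∈ lattice V ϖ k} with hB₁
  set B₂ := {x : Hyperboloid Q 1 | x.1 - -v₁ ∈ lattice V ϖ k} with hB₂
  have hKv : ∀ x ∈ K \ (B₁ ∪ B₂), x.1 ≠ v₁ ∧ x.1 ≠ -v₁ := by
    refine fun x hx => ⟨fun h => hx.2 (Or.inl ?_), fun h => hx.2 (Or.inr ?_)⟩
    · rw [hB₁, Set.mem_ofPred_eq, h, sub_self]
      exact zero_mem _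
    · rw [hB₂, Set.mem_ofPred_eq, h, sub_self]
      exact zero_mem _
  have hz := real_inter_fiber_eq_zero h2 hψ hcond hϖ hQ hμF hω hv₁
    (K := K \ (B₁ ∪ B₂)) (hK.diff ((hBo _ _).union (hBo _ _)))
    (hK'.sdiff ((hBc _ _).union (hBc _ _)).isClosed) hKv ξ
  have hBfin : (ω 1) (B₁ ∪ B₂) ≠ ⊤ := ((hBc v₁ k).union (hBc (-v₁) k)).measure_lt_top.ne
  calc (ω 1).real (K ∩ {x | QuadraticMap.polar Q v₁ x.1 = ξ})
      ≤ (ω 1).real ((B₁ ∪ B₂) ∪ (K \ (B₁ ∪ B₂)) ∩ {x | QuadraticMap.polar Q v₁ x.1 = ξ}) := by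
        refine measureReal_mono ?_ (measure_union_ne_top hBfin
          ((measure_mono (Set.inter_subset_left.trans Set.sdiff_subset)).trans_lt
            hK.measure_lt_top).ne)
        rintro x ⟨hx, hx'⟩
        by_cases hB : x ∈ B₁ ∪ B₂
        exacts [Or.inl hB, Or.inr ⟨⟨hx, hB⟩, hx'⟩]
    _ ≤ (ω 1).real (B₁ ∪ B₂) + (ω 1).real ((K \ (B₁ ∪ B₂)) ∩
          {x | QuadraticMap.polar Q v₁ x.1 = ξ}) := measureReal_union_le _ _
    _ ≤ (ω 1).real B₁ + (ω 1).real B₂ := by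
        rw [hz, add_zero]
        exact measureReal_union_le _ _

variable {ν : (ξ : F) → Measure {x : Hyperboloid Q 1 // QuadraticMap.polar Q v₁ x.1 = ξ}}

/-- Integration over `X₁` by integrating along the fibres over the complement of `{2, -2}`. -/
theorem integral_hyperboloid_eq (h2 : (2 : F) ≠ 0) (hψ : Continuous ψ)
    (hcond : HasConductorIntegers ψ) (hϖ : IsUniformizer ϖ) (hQ : Q.polarBilin.Nondegenerate)
    (hμF : IsSelfDual ψ (fun x y : F => x * y) μF) (hω : IsFiberMeasure μV μF Q {0}ᶜ ω)
    (hdim : 2 ≤ Module.finrank F V) (hv₁ : Q v₁ = 1)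
    (hν : IsFiberMeasure (ω 1) μF (fun x => QuadraticMap.polar Q v₁ x.1) {2, -2}ᶜ ν)
    {φ : Hyperboloid Q 1 → ℂ} (hφ : φ ∈ SchwartzBruhat (Hyperboloid Q 1)) :
    IntegrableOn (fun ξ => ∫ x : {x : Hyperboloid Q 1 // QuadraticMap.polar Q v₁ x.1 = ξ},
      φ x.1 ∂(ν ξ)) {2, -2}ᶜ μF ∧
    ∫ x, φ x ∂(ω 1) = ∫ ξ in {2, -2}ᶜ,
      (∫ x : {x : Hyperboloid Q 1 // QuadraticMap.polar Q v₁ x.1 = ξ}, φ x.1 ∂(ν ξ)) ∂μF := by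
  have hfin := hω.finite_on_compacts 1 (by simp)
  have hcont := continuous_polar_hyperboloid Q 1 v₁
  set I : F → ℂ := fun ξ => ∫ x : {x : Hyperboloid Q 1 // QuadraticMap.polar Q v₁ x.1 = ξ},
      φ x.1 ∂(ν ξ) with hI
  -- These clopen sets exhaust the complement of `±2`, and over each of them fibre integration
  -- applies to any `φ`.
  set A : ℕ → Set F := fun n => (idealPCoset ϖ n 2 ∪ idealPCoset ϖ n (-2))ᶜ with hA
  have hAcl : ∀ n, IsClopen (A n) := fun n =>
    ((isClopen_idealPCoset hϖ n 2).union (isClopen_idealPCoset hϖ n (-2))).compl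
  have hAsub : ∀ n, A n ⊆ {2, -2}ᶜ := by
    rintro n ξ hξ (rfl | rfl)
    exacts [hξ (Or.inl (self_mem_idealPCoset n _)), hξ (Or.inr (self_mem_idealPCoset n _))]
  have hAev : ∀ ξ ∈ ({2, -2}ᶜ : Set F), ∀ᶠ n in atTop, ξ ∈ A n := by
    intro ξ hξ
    have h : ∀ y : F, ξ ≠ y → ∀ᶠ n in atTop, ξ ∉ idealPCoset ϖ n y := by
      intro y hy
      filter_upwards [eventually_idealP_subset hϖ
        (isOpen_compl_singleton.mem_nhds (Ne.symm hy) : {ξ}ᶜ ∈ 𝓝 y)] with n hn h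
      exact hn ξ h rfl
    filter_upwards [h 2 (fun h => hξ (Or.inl h)), h (-2) (fun h => hξ (Or.inr h))] with n h1 h3 h
    rcases h with h | h
    exacts [h1 h, h3 h]
  have hcover : AECover (μF.restrict {2, -2}ᶜ) atTop A :=
    { ae_eventually_mem := by
        rw [ae_restrict_iff' (Set.toFinite _).isClosed.isOpen_compl.measurableSet]
        exact Eventually.of_forall hAev
      measurableSet := fun n => (hAcl n).isOpen.measurableSet }
  have hmem := fun n => hν.indicator_mem hcont hφ (hAcl n) (hAsub n)
  have hmem' := fun n => hν.indicator_mem hcont (SchwartzBruhat.norm_mem hφ) (hAcl n) (hAsub n)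
  have hrestr : ∀ n, (μF.restrict {2, -2}ᶜ).restrict (A n) = μF.restrict (A n) := fun n =>
    Measure.restrict_restrict_of_subset (hAsub n)
  have hIon : ∀ n, IntegrableOn I (A n) μF := fun n =>
    (integrable_indicator_iff (hAcl n).isOpen.measurableSet).1
      (SchwartzBruhat.integrable μF (hmem n).1)
  -- Over `A n` the norm of `I` is at most the fibre integral of `|φ|`, whose total is bounded by `∫
  -- |φ|` independently of `n`.
  have hint : IntegrableOn I {2, -2}ᶜ μF := by
    refine hcover.integrable_of_integral_norm_bounded (∫ x, ‖φ x‖ ∂(ω 1)) (fun n => ?_)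
      (Eventually.of_forall fun n => ?_)
    · rw [IntegrableOn, hrestr]; exact hIon n
    · rw [hrestr]
      have hJ : ∀ ξ, ∫ x : {x : Hyperboloid Q 1 // QuadraticMap.polar Q v₁ x.1 = ξ},
          ((‖φ x.1‖ : ℝ) : ℂ) ∂(ν ξ) = ((∫ x : {x : Hyperboloid Q 1 //
            QuadraticMap.polar Q v₁ x.1 = ξ}, ‖φ x.1‖ ∂(ν ξ) : ℝ) : ℂ) := fun ξ => integral_ofReal
      have h3 := (integrable_indicator_iff (hAcl n).isOpen.measurableSet).1
        (SchwartzBruhat.integrable μF (hmem' n).1)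
      rw [IntegrableOn, funext hJ] at h3
      have h4 : ∫ x in (fun x : Hyperboloid Q 1 => QuadraticMap.polar Q v₁ x.1) ⁻¹' A n,
          ‖φ x‖ ∂(ω 1) = ∫ ξ in A n, (∫ x : {x : Hyperboloid Q 1 //
            QuadraticMap.polar Q v₁ x.1 = ξ}, ‖φ x.1‖ ∂(ν ξ)) ∂μF := by
        have h1 := (hmem' n).2
        rw [funext hJ] at h1
        refine Complex.ofReal_injective ?_
        rw [← integral_complex_ofReal, ← integral_complex_ofReal]
        exact h1
      calc ∫ ξ in A n, ‖I ξ‖ ∂μF ≤ ∫ ξ in A n,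
            (∫ x : {x : Hyperboloid Q 1 // QuadraticMap.polar Q v₁ x.1 = ξ},
              ‖φ x.1‖ ∂(ν ξ)) ∂μF := by
            refine integral_mono (hIon n).norm ?_ fun ξ => norm_integral_le_integral_norm _
            exact h3.re
        _ = _ := h4.symm
        _ ≤ ∫ x, ‖φ x‖ ∂(ω 1) := setIntegral_le_integral
            (SchwartzBruhat.integrable (ω 1) hφ).norm (Eventually.of_forall fun x => norm_nonneg _)
  refine ⟨hint, ?_⟩
  have hlim1 := hcover.integral_tendsto_of_countably_generated hint
  refine tendsto_nhds_unique (f := fun n => ∫ ξ in A n, I ξ ∂(μF.restrict {2, -2}ᶜ)) ?_ hlim1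
  have hsupp := SchwartzBruhat.isCompact_support hφ
  -- As the fibres over `±2` are null, the truncations of `φ` converge to it almost everywhere.
  have hnull : ∀ᵐ x ∂(ω 1), φ x ≠ 0 → QuadraticMap.polar Q v₁ x.1 ∈ ({2, -2}ᶜ : Set F) := by
    have h1 := measure_inter_fiber_eq_zero h2 hψ hcond hϖ hQ hμF hω hdim hv₁ hsupp.1 hsupp.2 2
    have h3 := measure_inter_fiber_eq_zero h2 hψ hcond hϖ hQ hμF hω hdim hv₁ hsupp.1 hsupp.2 (-2)
    refine measure_mono_null ?_ (measure_union_null h1 h3)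
    intro x hx
    simp only [Set.mem_compl_iff, Set.mem_ofPred_eq, Classical.not_imp, not_not] at hx
    rcases hx.2 with h | h
    exacts [Or.inl ⟨hx.1, h⟩, Or.inr ⟨hx.1, h⟩]
  have e : ∀ n, ∫ x, ((fun x : Hyperboloid Q 1 => QuadraticMap.polar Q v₁ x.1) ⁻¹' A n).indicator
      φ x ∂(ω 1) = ∫ ξ in A n, I ξ ∂(μF.restrict {2, -2}ᶜ) := fun n => by
    rw [integral_indicator ((hAcl n).preimage hcont).isOpen.measurableSet, (hmem n).2, hrestr]
  refine Tendsto.congr e ?_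
  refine tendsto_integral_of_dominated_convergence (fun x => ‖φ x‖) (fun n => ?_)
    (SchwartzBruhat.integrable (ω 1) hφ).norm (fun n => Eventually.of_forall fun x =>
      norm_indicator_le_norm_self _ _) ?_
  · exact (SchwartzBruhat.integrable (ω 1)
      (SchwartzBruhat.indicator_mem_of_mem ((hAcl n).preimage hcont) hφ)).aestronglyMeasurable
  · filter_upwards [hnull] with x hx
    by_cases h0 : φ x = 0
    · refine tendsto_const_nhds.congr fun n => ?_
      rw [Set.indicator_apply_eq_self.2 fun _ => h0]
    · refine tendsto_const_nhds.congr' ?_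
      filter_upwards [hAev _ (hx h0)] with n hn
      rw [Set.indicator_of_mem (show x ∈ (fun x : Hyperboloid Q 1 =>
        QuadraticMap.polar Q v₁ x.1) ⁻¹' A n from hn)]

end Measures

/-! ### The spaces of orbital integrals as functions -/

section Incarnation

variable {F : Type*} [NontriviallyNormedField F] [IsUltrametricDist F] [LocallyCompactSpace F]
  [MeasurableSpace F] [BorelSpace F] {ψ : AddChar F Circle} {μF : Measure F} [μF.IsAddHaarMeasure]
variable {V : Type*} [AddCommGroup V] [Module F V] [FiniteDimensional F V] [TopologicalSpace V]
  [IsTopologicalAddGroup V] [ContinuousSMul F V] [T2Space V] [MeasurableSpace V] [BorelSpace V]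
  {Q : QuadraticForm F V} {μV : Measure V} [μV.IsAddHaarMeasure] {v₁ : V} {ϖ : F}
  {ω : (a : F) → Measure (Hyperboloid Q a)}
  {ν : (ξ : F) → Measure {x : Hyperboloid Q 1 // QuadraticMap.polar Q v₁ x.1 = ξ}}

theorem Heart.mem_compl (ξ : Heart F) : ξ.1 ∈ ({2, -2}ᶜ : Set F) := fun h =>
  h.elim ξ.2.1 ξ.2.2

theorem integrable_fiber_polar
    (hν : IsFiberMeasure (ω 1) μF (fun x => QuadraticMap.polar Q v₁ x.1) {2, -2}ᶜ ν)
    {φ : Hyperboloid Q 1 → ℂ} (hφ : φ ∈ SchwartzBruhat (Hyperboloid Q 1)) (ξ : Heart F) :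
    Integrable (fun x : {x : Hyperboloid Q 1 // QuadraticMap.polar Q v₁ x.1 = ξ.1} => φ x.1)
      (ν ξ.1) := by
  have := hν.finite_on_compacts ξ.1 ξ.mem_compl
  exact SchwartzBruhat.integrable _ (SchwartzBruhat.comp_subtype hφ
    (isClosed_eq (continuous_polar_hyperboloid Q 1 v₁) continuous_const))

/-- Integration along the fibres of `x ↦ ⟨v₁, x⟩`, as a linear map. -/
noncomputable def fiberIntegralX
    (hν : IsFiberMeasure (ω 1) μF (fun x => QuadraticMap.polar Q v₁ x.1) {2, -2}ᶜ ν) :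
    SchwartzBruhat (Hyperboloid Q 1) →ₗ[ℂ] (Heart F → ℂ) where
  toFun φ ξ := ∫ x : {x : Hyperboloid Q 1 // QuadraticMap.polar Q v₁ x.1 = ξ.1}, φ.1 x.1 ∂(ν ξ.1)
  map_add' φ φ' := funext fun ξ =>
    integral_add (integrable_fiber_polar hν φ.2 ξ) (integrable_fiber_polar hν φ'.2 ξ)
  map_smul' c _ := funext fun _ => integral_const_mul c _

/-- The action of an isometry on `X_a` as a homeomorphism. -/
noncomputable def actHomeomorph (h : Q.IsometryEquiv Q) (a : F) :
    Hyperboloid Q a ≃ₜ Hyperboloid Q a :=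
  (isometryHomeomorph h).subtype fun v => by
    rw [isometryHomeomorph_apply, h.map_app]

theorem actHomeomorph_apply (h : Q.IsometryEquiv Q) {a : F} (x : Hyperboloid Q a) :
    actHomeomorph h a x = act Q h x :=
  Subtype.ext (isometryHomeomorph_apply h x.1)

theorem integral_hyperboloid_isometry (h2 : (2 : F) ≠ 0) (hψ : Continuous ψ)
    (hcond : HasConductorIntegers ψ) (hϖ : IsUniformizer ϖ) (hQ : Q.polarBilin.Nondegenerate)
    (hμ : IsSelfDual ψ (QuadraticMap.polar Q) μV) (hω : IsFiberMeasure μV μF Q {0}ᶜ ω)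
    (h : Q.IsometryEquiv Q) {a : F} (ha : a ≠ 0) {φ : Hyperboloid Q a → ℂ}
    (hφ : φ ∈ SchwartzBruhat (Hyperboloid Q a)) :
    ∫ x, φ (act Q h x) ∂(ω a) = ∫ x, φ x ∂(ω a) := by
  obtain ⟨Φ, hΦ, e⟩ := SchwartzBruhat.exists_extension (hasCompactOpenBasis_module hϖ) hφ
  have key := hω.integral_comp_eq hϖ (continuous_quadraticForm h2 Q) isOpen_compl_singleton
    (isometryHomeomorph h) (fun v => h.map_app v)
    (fun f hf => integral_isometry μV hψ hϖ hcond hQ hμ h hf.1.continuous hf.2) hΦ (y := a) ha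
  have e' : φ = fun x => Φ x.1 := funext fun x => (e x).symm
  rw [e']
  exact key

/-- An isometry fixing `v₁` preserves both `x ↦ ⟨v₁, x⟩` and integrals against `ω 1`, hence the
integrals along the fibres. -/
theorem exists_incarnationX (h2 : (2 : F) ≠ 0) (hψ : Continuous ψ)
    (hcond : HasConductorIntegers ψ) (hϖ : IsUniformizer ϖ) (hQ : Q.polarBilin.Nondegenerate)
    (hμ : IsSelfDual ψ (QuadraticMap.polar Q) μV) (hω : IsFiberMeasure μV μF Q {0}ᶜ ω)
    (hν : IsFiberMeasure (ω 1) μF (fun x => QuadraticMap.polar Q v₁ x.1) {2, -2}ᶜ ν) :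
    ∃ J : OrbitalX Q v₁ →ₗ[ℂ] (Heart F → ℂ), IsIncarnationX Q v₁ ν J ∧
      ∀ φ, IsLocallyConstant (J φ) := by
  have hcont := continuous_polar_hyperboloid Q 1 v₁
  have hopen : IsOpen ({2, -2}ᶜ : Set F) := (Set.toFinite _).isClosed.isOpen_compl
  have hle : relX Q v₁ ≤ LinearMap.ker (fiberIntegralX hν) := by
    refine Submodule.span_le.2 ?_
    rintro η ⟨h, hh, φ, hφ⟩
    refine funext fun ξ => ?_
    have hh' : h.symm v₁ = v₁ := by
      conv_lhs => rw [← hh]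
      exact h.toLinearEquiv.symm_apply_apply v₁
    have hpolar : ∀ x : Hyperboloid Q 1,
        QuadraticMap.polar Q v₁ (actHomeomorph h.symm 1 x).1 = QuadraticMap.polar Q v₁ x.1 := by
      intro x
      rw [actHomeomorph_apply]
      conv_lhs => rw [← hh']
      exact isometry_polar h.symm v₁ x.1
    have key := hν.integral_comp_eq hϖ hcont hopen (actHomeomorph h.symm 1) hpolar
      (fun f hf => integral_hyperboloid_isometry h2 hψ hcond hϖ hQ hμ hω h.symm one_ne_zero hf)
      φ.2 ξ.mem_compl
    have i1 := integrable_fiber_polar hν φ.2 ξ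
    have i2 := integrable_fiber_polar hν
      (SchwartzBruhat.comp_homeomorph φ.2 (actHomeomorph h.symm 1)) ξ
    change ∫ x : {x : Hyperboloid Q 1 // QuadraticMap.polar Q v₁ x.1 = ξ.1}, η.1 x.1 ∂(ν ξ.1) = 0
    rw [← sub_eq_zero, ← integral_sub i2 i1] at key
    rw [← key]
    exact integral_congr_ae (Eventually.of_forall fun x => hφ x.1)
  refine ⟨Submodule.liftQ _ _ hle, fun φ ξ => rfl, fun φ => ?_⟩
  obtain ⟨φ, rfl⟩ := Submodule.mkQ_surjective _ φ
  refine (IsLocallyConstant.iff_eventually_eq _).2 fun ξ => ?_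
  exact continuous_subtype_val.continuousAt.eventually
    (hν.eventually_eq hϖ hcont hopen φ.2 ξ.mem_compl)

/-! ### Orbital integrals of `p(Φ)` over the open cell -/

theorem disc_ne_zero (hQ : Q.polarBilin.Nondegenerate) : disc Q ≠ 0 := by
  refine mul_ne_zero (pow_ne_zero _ (neg_ne_zero.2 one_ne_zero)) ?_
  convert (LinearMap.BilinForm.nondegenerate_iff_det_ne_zero (Module.finBasis F V)).1 hQ using 2
  ext i j
  rw [LinearMap.BilinForm.toMatrix_apply]
  rfl

/-- For `d = s²` the form is `(x - s y)(x + s y)`; the witness makes the factors `1` and `a`. -/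
theorem quadChar_eq_one (h2 : (2 : F) ≠ 0) {d : F} (hd : IsSquare d) (hd' : d ≠ 0) (a : F) :
    quadChar d a = 1 := by
  obtain ⟨s, rfl⟩ := hd
  have hs : s ≠ 0 := left_ne_zero_of_mul hd'
  refine if_pos ⟨(a + 1) / 2, (a - 1) / (2 * s), ?_⟩
  field_simp
  ring

theorem twist_mem (hcond : HasConductorIntegers ψ) (v : V) (c : F) {Φ : V → ℂ}
    (hΦ : Φ ∈ SchwartzBruhat V) :
    (fun x => Φ x * (ψ (c * QuadraticMap.polar Q v x) : ℂ)) ∈ SchwartzBruhat V :=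
  SchwartzBruhat.mul_mem hΦ (hcond.isLocallyConstant.comp_continuous
    (continuous_const.mul (continuous_polar Q v) :
      Continuous fun x => c * QuadraticMap.polar Q v x))

/-- `|a|^(-dim V / 2)` arises from `t(a)` and the change of variables `v ↦ a v`. -/
theorem rpow_mul_inv_pow {r : ℝ} (hr : 0 < r) (m : ℕ) :
    r ^ ((m : ℝ) / 2) * (r ^ m)⁻¹ = r ^ (-(m : ℝ) / 2) := by
  rw [← Real.rpow_natCast, ← Real.rpow_neg hr.le, ← Real.rpow_add hr]
  congr 1
  ring

/-- The matrix has rows `(0, a⁻¹)` and `(-a, -a b)`, so the Bruhat formula reads `w t(a) n(b)`.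
Replacing `a v` by `v` costs `|a|^(-dim V)` and turns the pairing into `a⁻¹⟨v₁, v⟩`. -/
theorem pMap_wMat_tMat_nMat (h2 : (2 : F) ≠ 0) (hψ : Continuous ψ)
    (hQ : Q.polarBilin.Nondegenerate) (hdisc : IsSquare (disc Q)) {Φ : V → ℂ}
    (hΦ : Φ ∈ SchwartzBruhat V) (a : Fˣ) (b : F) :
    pMap ψ Q μV v₁ Φ (wMat F * tMat a * nMat b) =
      weilIndex ψ Q μV * ((absF (a : F) ^ (-(Module.finrank F V : ℝ) / 2) : ℝ) : ℂ) *
        ∫ v, Φ v * (ψ ((a : F)⁻¹ * QuadraticMap.polar Q v₁ v) : ℂ) * (ψ (b * Q v) : ℂ) ∂μV := by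
  have e : (wMat F * tMat a * nMat b).1 = !![0, (a : F)⁻¹; -a, -a * b] := by
    rw [Matrix.SpecialLinearGroup.coe_mul, Matrix.SpecialLinearGroup.coe_mul]
    simp [wMat, tMat, nMat]
  have e00 : (wMat F * tMat a * nMat b) 0 0 = 0 := by
    rw [e]; rfl
  have e10 : (wMat F * tMat a * nMat b) 1 0 = -(a : F) := by
    rw [e]; rfl
  have e11 : (wMat F * tMat a * nMat b) 1 1 = -(a : F) * b := by
    rw [e]; rfl
  have ha : -(a : F) ≠ 0 := neg_ne_zero.2 a.ne_zero
  rw [pMap, weil, e10, if_neg ha, e00, e11, mul_div_cancel_left₀ _ ha, zero_div, neg_neg]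
  simp only [weilN, weilW, weilT, fourier, zero_mul, AddChar.map_zero_eq_one, Circle.coe_one,
    one_mul, quadChar_eq_one h2 hdisc (disc_ne_zero hQ), mul_one]
  have key := integral_comp_units_smul μV a
    (f := fun v => Φ v * (ψ ((a : F)⁻¹ * QuadraticMap.polar Q v₁ v) : ℂ) * (ψ (b * Q v) : ℂ))
    ((hΦ.1.continuous.mul (continuous_coe_comp hψ
      (continuous_const.mul (continuous_polar Q v₁)))).mul (continuous_coe_comp hψ
      (continuous_const.mul (continuous_quadraticForm h2 Q)))) hΦ.2.mul_right.mul_right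
  rw [← rpow_mul_inv_pow (absF_pos a), Complex.ofReal_mul, mul_assoc, mul_assoc, ← key,
    ← integral_const_mul, ← integral_const_mul, ← integral_const_mul]
  refine integral_congr_ae (Eventually.of_forall fun v => ?_)
  have : (a : F)⁻¹ * QuadraticMap.polar Q v₁ ((a : F) • v) = QuadraticMap.polar Q v₁ v := by
    rw [QuadraticMap.polar_smul_right, smul_eq_mul, inv_mul_cancel_left₀ a.ne_zero]
  simp only [this]
  ring

/-- The orbital integrals of `p(Φ)` in terms of the integral of `Φ` over `X₁`, as a linear map. -/
noncomputable def orbitalN (h2 : (2 : F) ≠ 0) (hcond : HasConductorIntegers ψ)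
    (Q : QuadraticForm F V)
    (μV : Measure V) (v₁ : V) (μ₁ : Measure (Hyperboloid Q 1)) [IsFiniteMeasureOnCompacts μ₁] :
    SchwartzBruhat V →ₗ[ℂ] (Fˣ → ℂ) where
  toFun Φ a := weilIndex ψ Q μV * ((absF (a : F) ^ (-(Module.finrank F V : ℝ) / 2) : ℝ) : ℂ) *
    ∫ x : Hyperboloid Q 1, Φ.1 x.1 * (ψ ((a : F)⁻¹ * QuadraticMap.polar Q v₁ x.1) : ℂ) ∂μ₁
  map_add' Φ Φ' := funext fun a => by
    have hi : ∀ Φ : SchwartzBruhat V, Integrable (fun x : Hyperboloid Q 1 =>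
        Φ.1 x.1 * (ψ ((a : F)⁻¹ * QuadraticMap.polar Q v₁ x.1) : ℂ)) μ₁ := fun Φ =>
      SchwartzBruhat.integrable μ₁ (SchwartzBruhat.comp_subtype
        (twist_mem hcond v₁ (a : F)⁻¹ Φ.2) (isClosed_hyperboloid h2 Q 1))
    simp only [Pi.add_apply, Submodule.coe_add, add_mul]
    rw [integral_add (hi Φ) (hi Φ'), mul_add]
  map_smul' c Φ := funext fun a => by
    simp only [Pi.smul_apply, Submodule.coe_smul, smul_eq_mul, mul_assoc, integral_const_mul,
      RingHom.id_apply]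
    ring

theorem orbitalN_apply (h2 : (2 : F) ≠ 0) (hcond : HasConductorIntegers ψ)
    (μ₁ : Measure (Hyperboloid Q 1)) [IsFiniteMeasureOnCompacts μ₁] (Φ : SchwartzBruhat V)
    (a : Fˣ) :
    orbitalN h2 hcond Q μV v₁ μ₁ Φ a =
      weilIndex ψ Q μV * ((absF (a : F) ^ (-(Module.finrank F V : ℝ) / 2) : ℝ) : ℂ) *
        ∫ x : Hyperboloid Q 1, Φ.1 x.1 * (ψ ((a : F)⁻¹ * QuadraticMap.polar Q v₁ x.1) : ℂ) ∂μ₁ :=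
  rfl

theorem eventually_integral_pMap (h2 : (2 : F) ≠ 0) (hψ : Continuous ψ)
    (hcond : HasConductorIntegers ψ) (hϖ : IsUniformizer ϖ) (hQ : Q.polarBilin.Nondegenerate)
    (hdisc : IsSquare (disc Q)) (hμF : IsSelfDual ψ (fun x y : F => x * y) μF)
    (hω : IsFiberMeasure μV μF Q {0}ᶜ ω) [IsFiniteMeasureOnCompacts (ω 1)]
    (Φ : SchwartzBruhat V) (a : Fˣ) :
    ∀ᶠ n in atTop, ∫ b in idealU ϖ n, pMap ψ Q μV v₁ Φ.1 (wMat F * tMat a * nMat b) *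
      (starRingEnd ℂ) (ψ b : ℂ) ∂μF = orbitalN h2 hcond Q μV v₁ (ω 1) Φ a := by
  filter_upwards [eventually_integral_idealU_eq h2 hψ hcond hϖ hμF hω
    (twist_mem hcond v₁ (a : F)⁻¹ Φ.2)] with n hn
  rw [orbitalN_apply, ← hn, ← integral_const_mul]
  refine integral_congr_ae (Eventually.of_forall fun b => ?_)
  have : (starRingEnd ℂ) (ψ b : ℂ) = (ψ (-b) : ℂ) := by
    rw [AddChar.map_neg_eq_inv, Circle.coe_inv_eq_conj]
  simp only [this, pMap_wMat_tMat_nMat h2 hψ hQ hdisc Φ.2]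
  ring

/-- On the compact support of `Φ` the pairing with `v₁` is bounded, so a small change of `a⁻¹`
alters the phase only by integers of `F`, where `ψ` is trivial. -/
theorem isLocallyConstant_orbitalN (h2 : (2 : F) ≠ 0)
    (hcond : HasConductorIntegers ψ) (hϖ : IsUniformizer ϖ) (μ₁ : Measure (Hyperboloid Q 1))
    [IsFiniteMeasureOnCompacts μ₁] (Φ : SchwartzBruhat V) :
    IsLocallyConstant (orbitalN h2 hcond Q μV v₁ μ₁ Φ) := by
  refine (IsLocallyConstant.iff_eventually_eq _).2 fun a => ?_
  obtain ⟨C, hC⟩ := ((SchwartzBruhat.isCompact_support Φ.2).1.image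
    (continuous_polar Q v₁)).isBounded.exists_norm_le
  have hlim : Tendsto (fun b : Fˣ => ‖(b : F)⁻¹ - (a : F)⁻¹‖ * C) (𝓝 a) (𝓝 0) := by
    have h : Continuous fun b : Fˣ => ‖(b : F)⁻¹ - (a : F)⁻¹‖ * C := by
      have : Continuous fun b : Fˣ => (b : F)⁻¹ := by
        simp_rw [← Units.val_inv_eq_inv_val]
        exact Units.continuous_val.comp continuous_inv
      exact (this.sub continuous_const).norm.mul continuous_const
    simpa using h.tendsto a
  filter_upwards [eventually_absF_eq hϖ a, hlim.eventually_le_const one_pos] with b hb hb'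
  rw [orbitalN_apply, orbitalN_apply, hb]
  congr 1
  refine integral_congr_ae (Eventually.of_forall fun x => ?_)
  by_cases hx : Φ.1 x.1 = 0
  · simp only [hx, zero_mul]
  have h1 : ψ (((b : F)⁻¹ - (a : F)⁻¹) * QuadraticMap.polar Q v₁ x.1) = 1 := by
    refine hcond.eq_one ((norm_mul_le _ _).trans (le_trans ?_ hb'))
    exact mul_le_mul_of_nonneg_left (hC _ ⟨x.1, hx, rfl⟩) (norm_nonneg _)
  have h3 : (b : F)⁻¹ * QuadraticMap.polar Q v₁ x.1 =
      ((b : F)⁻¹ - (a : F)⁻¹) * QuadraticMap.polar Q v₁ x.1 +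
        (a : F)⁻¹ * QuadraticMap.polar Q v₁ x.1 := by ring
  simp only [h3, AddChar.map_add_eq_mul, h1, one_mul]

theorem orbitalN_weilN (h2 : (2 : F) ≠ 0) (hcond : HasConductorIntegers ψ)
    (μ₁ : Measure (Hyperboloid Q 1)) [IsFiniteMeasureOnCompacts μ₁] (b : F)
    (Φ : SchwartzBruhat V) :
    orbitalN h2 hcond Q μV v₁ μ₁ ⟨weilN ψ Q b Φ.1, weilN_mem hcond h2 b Φ.2⟩ =
      (ψ b : ℂ) • orbitalN h2 hcond Q μV v₁ μ₁ Φ := by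
  rw [← map_smul]
  refine funext fun a => ?_
  rw [orbitalN_apply, orbitalN_apply]
  congr 1
  refine integral_congr_ae (Eventually.of_forall fun x => ?_)
  simp [weilN, x.2]

/-- An element of the kernel is a combination of lifted relations `n(b)Φ - ψ(b)Φ` plus some `Φ'`
with `p(Φ') = 0`. The relations are killed because `Q = 1` on `X₁`, and `Φ'` because its orbital
integrals are computed from `p(Φ')`. -/
theorem ker_pClass_le_ker_orbitalN (h2 : (2 : F) ≠ 0) (hψ : Continuous ψ)
    (hcond : HasConductorIntegers ψ) (hϖ : IsUniformizer ϖ) (hQ : Q.polarBilin.Nondegenerate)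
    (hdisc : IsSquare (disc Q)) (hμF : IsSelfDual ψ (fun x y : F => x * y) μF)
    (hω : IsFiberMeasure μV μF Q {0}ᶜ ω) [IsFiniteMeasureOnCompacts (ω 1)] :
    LinearMap.ker (pClass h2 hψ Q μV v₁) ≤ LinearMap.ker (orbitalN h2 hcond Q μV v₁ (ω 1)) := by
  have hle : relN ψ Q μV v₁ ≤ (LinearMap.ker (orbitalN h2 hcond Q μV v₁ (ω 1))).map
      (pLinear h2 hψ Q μV v₁) := by
    refine Submodule.span_le.2 ?_
    rintro η ⟨b, f, hf⟩
    obtain ⟨Φ, rfl⟩ := pLinear_surjective μV h2 hψ v₁ f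
    refine ⟨⟨weilN ψ Q b Φ.1, weilN_mem hcond h2 b Φ.2⟩ - (ψ b : ℂ) • Φ, ?_, ?_⟩
    · rw [SetLike.mem_coe, LinearMap.mem_ker, map_sub, orbitalN_weilN, map_smul, sub_self]
    · refine Subtype.ext (funext fun g => ?_)
      rw [hf, map_sub, map_smul]
      change pMap ψ Q μV v₁ (weilN ψ Q b Φ.1) g - (ψ b : ℂ) * pMap ψ Q μV v₁ Φ.1 g = _
      rw [pMap, weil_weilN]
      rfl
  intro Φ hΦ
  rw [LinearMap.mem_ker, pClass, LinearMap.comp_apply, Submodule.mkQ_apply,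
    Submodule.Quotient.mk_eq_zero] at hΦ
  obtain ⟨Ψ, hΨ, hΨΦ⟩ := hle hΦ
  have h0 : orbitalN h2 hcond Q μV v₁ (ω 1) (Φ - Ψ) = 0 := by
    refine funext fun a => ?_
    have hp : ∀ g, pMap ψ Q μV v₁ (Φ - Ψ).1 g = 0 := fun g => by
      have : pLinear h2 hψ Q μV v₁ (Φ - Ψ) = 0 := by rw [map_sub, hΨΦ, sub_self]
      exact congr_fun (congr_arg Subtype.val this) g
    obtain ⟨n, hn⟩ := (eventually_integral_pMap (v₁ := v₁) h2 hψ hcond hϖ hQ hdisc hμF hω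
      (Φ - Ψ) a).exists
    rw [← hn]
    simp_rw [hp, zero_mul, integral_zero]
    rfl
  rw [LinearMap.mem_ker, ← sub_add_cancel Φ Ψ, map_add, h0, LinearMap.mem_ker.1 hΨ, add_zero]

theorem exists_incarnationN (h2 : (2 : F) ≠ 0) (hψ : Continuous ψ)
    (hcond : HasConductorIntegers ψ) (hϖ : IsUniformizer ϖ) (hQ : Q.polarBilin.Nondegenerate)
    (hdisc : IsSquare (disc Q)) (hμF : IsSelfDual ψ (fun x y : F => x * y) μF)
    (hω : IsFiberMeasure μV μF Q {0}ᶜ ω) [IsFiniteMeasureOnCompacts (ω 1)] (v₁ : V) :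
    ∃ J : OrbitalN ψ Q μV v₁ →ₗ[ℂ] (Fˣ → ℂ), IsIncarnationN ψ μF Q μV v₁ ϖ J ∧
      (∀ f, IsLocallyConstant (J f)) ∧
      ∀ Φ, J (pClass h2 hψ Q μV v₁ Φ) = orbitalN h2 hcond Q μV v₁ (ω 1) Φ := by
  have hsurj : Function.Surjective (pClass h2 hψ Q μV v₁) :=
    (Submodule.mkQ_surjective _).comp (pLinear_surjective μV h2 hψ v₁)
  obtain ⟨J, hJ⟩ := exists_linearMap_comp_eq hsurj _
    (ker_pClass_le_ker_orbitalN h2 hψ hcond hϖ hQ hdisc hμF hω)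
  refine ⟨J, fun f a => ?_, fun f => ?_, hJ⟩
  · obtain ⟨Φ, rfl⟩ := pLinear_surjective μV h2 hψ v₁ f
    have h := eventually_integral_pMap (v₁ := v₁) h2 hψ hcond hϖ hQ hdisc hμF hω Φ a
    rw [← hJ] at h
    exact h
  · obtain ⟨Φ, rfl⟩ := hsurj f
    rw [hJ]
    exact isLocallyConstant_orbitalN h2 hcond hϖ (ω 1) Φ

/-- On the fibre over `ξ` the factor `ψ(c⟨v₁, x⟩)` is the constant `ψ(c ξ)` and leaves the fibre
integral. -/
theorem integral_hyperboloid_twist_eq (h2 : (2 : F) ≠ 0) (hψ : Continuous ψ)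
    (hcond : HasConductorIntegers ψ) (hϖ : IsUniformizer ϖ) (hQ : Q.polarBilin.Nondegenerate)
    (hμF : IsSelfDual ψ (fun x y : F => x * y) μF) (hω : IsFiberMeasure μV μF Q {0}ᶜ ω)
    (hdim : 2 ≤ Module.finrank F V) (hv₁ : Q v₁ = 1)
    (hν : IsFiberMeasure (ω 1) μF (fun x => QuadraticMap.polar Q v₁ x.1) {2, -2}ᶜ ν)
    (Φ : SchwartzBruhat V) (c : F) :
    Integrable (fun ξ : Heart F => (∫ x : {x : Hyperboloid Q 1 //
      QuadraticMap.polar Q v₁ x.1 = ξ.1}, Φ.1 x.1.1 ∂(ν ξ.1)) * (ψ (c * ξ.1) : ℂ))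
      (μF.comap Subtype.val) ∧
    ∫ x : Hyperboloid Q 1, Φ.1 x.1 * (ψ (c * QuadraticMap.polar Q v₁ x.1) : ℂ) ∂(ω 1) =
      ∫ ξ : Heart F, (∫ x : {x : Hyperboloid Q 1 //
        QuadraticMap.polar Q v₁ x.1 = ξ.1}, Φ.1 x.1.1 ∂(ν ξ.1)) * (ψ (c * ξ.1) : ℂ)
        ∂(μF.comap Subtype.val) := by
  have hrange : Set.range (Subtype.val : Heart F → F) = {2, -2}ᶜ := by
    ext ξ; simp
  have hemb : MeasurableEmbedding (Subtype.val : Heart F → F) := by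
    refine MeasurableEmbedding.subtype_coe (s := {ξ : F | ξ ≠ 2 ∧ ξ ≠ -2}) ?_
    have : {ξ : F | ξ ≠ 2 ∧ ξ ≠ -2} = {2, -2}ᶜ := by ext ξ; simp
    rw [this]
    exact (Set.toFinite _).isClosed.isOpen_compl.measurableSet
  have h := integral_hyperboloid_eq h2 hψ hcond hϖ hQ hμF hω hdim hv₁ hν
    (SchwartzBruhat.comp_subtype (twist_mem (Q := Q) hcond v₁ c Φ.2) (isClosed_hyperboloid h2 Q 1))
  have e : ∀ ξ, ∫ x : {x : Hyperboloid Q 1 // QuadraticMap.polar Q v₁ x.1 = ξ},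
      Φ.1 x.1.1 * (ψ (c * QuadraticMap.polar Q v₁ x.1.1) : ℂ) ∂(ν ξ) =
      (∫ x : {x : Hyperboloid Q 1 // QuadraticMap.polar Q v₁ x.1 = ξ}, Φ.1 x.1.1 ∂(ν ξ)) *
        (ψ (c * ξ) : ℂ) := by
    intro ξ
    rw [← integral_mul_const]
    exact integral_congr_ae (Eventually.of_forall fun x => by simp only [x.2])
  simp_rw [e] at h
  rw [IntegrableOn, ← hrange, ← hemb.map_comap, hemb.integrable_map_iff, hemb.integral_map] at h
  exact h

end Incarnation

end ThetaTransfer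

/-! ### The transfer map as an integral transform -/

theorem proposition11p1
    {F : Type*} [NontriviallyNormedField F] [IsUltrametricDist F] [LocallyCompactSpace F]
    [MeasurableSpace F] [BorelSpace F] (h2 : (2 : F) ≠ 0)
    {V : Type*} [AddCommGroup V] [Module F V] [FiniteDimensional F V] [TopologicalSpace V]
    [IsTopologicalAddGroup V] [ContinuousSMul F V] [T2Space V] [MeasurableSpace V] [BorelSpace V]
    (ψ : AddChar F Circle) (hψ : Continuous ψ) (hcond : ThetaTransfer.HasConductorIntegers ψ)
    (μF : Measure F) [μF.IsAddHaarMeasure]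
    (hμF : ThetaTransfer.IsSelfDual ψ (fun x y : F => x * y) μF)
    (Q : QuadraticForm F V) (hQ : Q.polarBilin.Nondegenerate)
    (hdim : 3 ≤ Module.finrank F V) (heven : Even (Module.finrank F V))
    (hdisc : IsSquare (ThetaTransfer.disc Q))
    (μV : Measure V) [μV.IsAddHaarMeasure]
    (hμV : ThetaTransfer.IsSelfDual ψ (QuadraticMap.polar Q) μV)
    (v₁ : V) (hv₁ : Q v₁ = 1) (ϖ : F) (hϖ : ThetaTransfer.IsUniformizer ϖ) :
    -- the transfer map exists and is unique
    (∃! t, ThetaTransfer.IsTransferMap ψ Q μV v₁ t) ∧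
    -- the measures on the fibres `X_a` of `Q : V → F`, `a ≠ 0`, exist
    (∃ ω : (a : F) → Measure (ThetaTransfer.Hyperboloid Q a),
      ThetaTransfer.IsFiberMeasure μV μF Q {0}ᶜ ω) ∧
    ∀ ω : (a : F) → Measure (ThetaTransfer.Hyperboloid Q a),
      ThetaTransfer.IsFiberMeasure μV μF Q {0}ᶜ ω →
      -- the measures on the fibres of `x ↦ ⟨v₁, x⟩` on `X₁` over `F ∖ {2, -2}` exist
      (∃ ν : (ξ : F) →
          Measure {x : ThetaTransfer.Hyperboloid Q 1 // QuadraticMap.polar Q v₁ x.1 = ξ},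
        ThetaTransfer.IsFiberMeasure (ω 1) μF (fun x => QuadraticMap.polar Q v₁ x.1)
          {2, -2}ᶜ ν) ∧
      ∀ ν : (ξ : F) →
          Measure {x : ThetaTransfer.Hyperboloid Q 1 // QuadraticMap.polar Q v₁ x.1 = ξ},
        ThetaTransfer.IsFiberMeasure (ω 1) μF (fun x => QuadraticMap.polar Q v₁ x.1)
          {2, -2}ᶜ ν →
        ∃ (JX : ThetaTransfer.OrbitalX Q v₁ →ₗ[ℂ] (ThetaTransfer.Heart F → ℂ))
          (JN : ThetaTransfer.OrbitalN ψ Q μV v₁ →ₗ[ℂ] (Fˣ → ℂ)),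
          ThetaTransfer.IsIncarnationX Q v₁ ν JX ∧
          ThetaTransfer.IsIncarnationN ψ μF Q μV v₁ ϖ JN ∧
          (∀ φ, IsLocallyConstant (JX φ)) ∧
          (∀ f, IsLocallyConstant (JN f)) ∧
          ∀ t, ThetaTransfer.IsTransferMap ψ Q μV v₁ t →
            ∀ (φ : ThetaTransfer.OrbitalX Q v₁) (a : Fˣ),
              Integrable
                (fun ξ : ThetaTransfer.Heart F => JX φ ξ * (ψ ((a : F)⁻¹ * ξ.1) : ℂ))
                (μF.comap Subtype.val) ∧
              JN (t φ) a =
                ThetaTransfer.weilIndex ψ Q μV *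
                  ((ThetaTransfer.absF (a : F) ^ (-(Module.finrank F V : ℝ) / 2) : ℝ) : ℂ) *
                  ∫ ξ : ThetaTransfer.Heart F, JX φ ξ * (ψ ((a : F)⁻¹ * ξ.1) : ℂ)
                    ∂(μF.comap Subtype.val) := by
  refine ⟨ThetaTransfer.existsUnique_transferMap μV h2 hψ hϖ hcond hQ hμV v₁,
    ThetaTransfer.exists_isFiberMeasure_quadraticForm h2 hψ hcond hϖ hQ hμF, fun ω hω =>
    ⟨ThetaTransfer.exists_isFiberMeasure_polar h2 hψ hcond hϖ hQ hμF hω hv₁, fun ν hν => ?_⟩⟩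
  have hfin := hω.finite_on_compacts 1 (by simp)
  obtain ⟨JX, hJX, hJX'⟩ :=
    ThetaTransfer.exists_incarnationX h2 hψ hcond hϖ hQ hμV hω hν
  obtain ⟨JN, hJN, hJN', hJN''⟩ :=
    ThetaTransfer.exists_incarnationN h2 hψ hcond hϖ hQ hdisc hμF hω v₁
  refine ⟨JX, JN, hJX, hJN, hJX', hJN', fun t ht φ a => ?_⟩
  obtain ⟨Φ, rfl⟩ := ThetaTransfer.resClass_surjective hϖ h2 Q v₁ φ
  have e : ∀ ξ : ThetaTransfer.Heart F, JX (ThetaTransfer.resClass h2 Q v₁ Φ) ξ = _ :=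
    hJX (ThetaTransfer.resX h2 Q 1 Φ)
  have key := ThetaTransfer.integral_hyperboloid_twist_eq h2 hψ hcond hϖ hQ hμF hω
    ((Nat.le_succ 2).trans hdim) hv₁ hν Φ (a : F)⁻¹
  -- With `φ` lifted to `Φ ∈ S(V)`, its transfer is the class of `p(Φ)`, whose orbital integrals are
  -- integrals of `Φ` over `X₁`.
  rw [(ThetaTransfer.isTransferMap_iff μV h2 hψ v₁ t).1 ht, hJN'']
  simp_rw [e]
  refine ⟨key.1, ?_⟩
  rw [ThetaTransfer.orbitalN_apply, key.2]
  rfl
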